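/- Let $r\ge 1$ be an integer, let $\alpha>r$ be real, and put $\beta=\alpha-r>0$ and $k=[\alpha]$. **Kernels.** An admissible kernel $q_\alpha:[0,1]\to\mathbb R$ satisfies: (1) $q_\alpha\ge 0$; (2) $\int_0^1 q_\alpha=1$; (3) the derivatives $q_\alpha^{(j)}$ exist and are absolutely continuous on $[0,1]$ for $j=0,1,\dots,k-1$; (4) $q_\alpha^{(j)}(1)=0$ for $j=0,\dots,k-1$; (5) $q_\alpha^{(k)}$ exists on $(0,1)$; (6) $(-1)^kq_\alpha^{(k)}$ is nonnegative and monotonically increasing on $(0,1)$; (7) with $Q_k(t)=\int_{1-t}^1(-1)^kq_\alpha^{(k)}(u)\,du$, the integral $\int_0^t Q_k(u)u^{-(1+\alpha-k)}\,du$ converges and is $O\big(Q_k(t)\,t^{-(\alpha-k)}\big)$ for $0<t\le 1$. A series $\sum u_n$ is called $|N_{q_\alpha}|$-summable if $$\int_A^\infty \frac{dw}{w^2}\,\Big|\sum_{n\le w} n\,u_n\,q_\alpha\Big(\frac nw\Big)\Big|<\infty\quad\text{for some } A>0 .$$ **Theorem.** Let $f:\mathbb R\to\mathbb R$ be $2\pi$-periodic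 and Lebesgue integrable over $(-\pi,\pi)$, with Fourier coefficients $a_n,b_n$, and let $B_n(x)=b_n\cos nx-a_n\sin nx$, so that $\sum_{n\ge1}B_n(x)$ is the conjugate series of the Fourier series of $f$. Fix $x\in\mathbb R$ and real constants $\theta_0,\dots,\theta_{r-1}$, and put $P(u)=\sum_{i=0}^{r-1}\frac{\theta_i}{i!}u^i$, $$h(u)=\frac{\{f(x+u)-P(u)\}-(-1)^r\{f(x-u)-P(-u)\}}{2u^r},\qquad H_\beta(t)=\frac1{\Gamma(\beta)}\int_0^t(t-u)^{\beta-1}h(u)\,du ,$$ where $h$ is assumed to be Lebesgue integrable over $(0,\pi)$. If $H_\beta(+0)=0$, and $H_\beta$ is of bounded variation on $(0,\pi)$ with $\int_0^\pi t^{-\beta}\,|dH_\beta(t)|<\infty$, then the $r$-th derived series $\sum_{n\ge1}\big(\frac{d}{dx}\big)^rB_n(x)$ of the conjugate series of $f$ at $x$ is $|N_{q_\alpha}|$-summable for every admissible kernel $q_\alpha$. -/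

import Mathlib

open MeasureTheory Set Filter Topology

noncomputable section

namespace NevanlinnaSum

/-- `q^{(j)}` on `[0, 1]`; the derivatives at the end points `0` and `1` are one-sided. -/
def kerDeriv (q : ℝ → ℝ) (j : ℕ) : ℝ → ℝ := iteratedDerivWithin j q (Icc 0 1)

/-- `Q_k(t) = ∫_{1-t}^1 (-1)^k q^{(k)}(u) du`. -/
def Qk (q : ℝ → ℝ) (k : ℕ) (t : ℝ) : ℝ :=
  ∫ u in (1 - t)..1, (-1) ^ k * kerDeriv q k u

/-- The kernels `q_α` of the Nevanlinna method of order `α ≥ 0`, with `k = ⌊α⌋`. -/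
structure IsNevanlinnaKernel (α : ℝ) (q : ℝ → ℝ) : Prop where
  nonneg : ∀ t ∈ Icc (0 : ℝ) 1, 0 ≤ q t
  integrable : IntervalIntegrable q volume 0 1
  integral_eq_one : ∫ t in (0 : ℝ)..1, q t = 1
  /-- `q', …, q^{(k-1)}` exist on `[0, 1]`. -/
  differentiableOn : ∀ j : ℕ, j + 1 < ⌊α⌋₊ → DifferentiableOn ℝ (kerDeriv q j) (Icc 0 1)
  /-- `q, q', …, q^{(k-1)}` are absolutely continuous on `[0, 1]`. -/
  absolutelyContinuous : ∀ j < ⌊α⌋₊, AbsolutelyContinuousOnInterval (kerDeriv q j) 0 1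
  /-- `q, q', …, q^{(k-1)}` vanish at `1`. -/
  eq_zero_at_one : ∀ j < ⌊α⌋₊, kerDeriv q j 1 = 0
  /-- `q^{(k)}` exists on `(0, 1)`. -/
  differentiableOn_last :
    ∀ j : ℕ, j + 1 = ⌊α⌋₊ → DifferentiableOn ℝ (kerDeriv q j) (Ioo 0 1)
  sign : ∀ t ∈ Ioo (0 : ℝ) 1, 0 ≤ (-1) ^ ⌊α⌋₊ * kerDeriv q ⌊α⌋₊ t
  monotone : MonotoneOn (fun t => (-1) ^ ⌊α⌋₊ * kerDeriv q ⌊α⌋₊ t) (Ioo 0 1)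
  /-- `∫_0^t Q_k(u) u^{-(1+α-k)} du` converges and is `O(Q_k(t) t^{-(α-k)})` on `(0, 1]`. -/
  growth : ∃ C : ℝ, ∀ t ∈ Ioc (0 : ℝ) 1,
    IntervalIntegrable (fun u => Qk q ⌊α⌋₊ u / u ^ (1 + α - ⌊α⌋₊)) volume 0 t ∧
    ∫ u in (0 : ℝ)..t, Qk q ⌊α⌋₊ u / u ^ (1 + α - ⌊α⌋₊)
      ≤ C * (Qk q ⌊α⌋₊ t / t ^ (α - ⌊α⌋₊))

/-- `∑ u_n` is absolutely summable by the Nevanlinna method with kernel `q`: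
`∫_A^∞ w^{-2} |∑_{n ≤ w} n u_n q(n/w)| dw < ∞` for some `A > 0`. -/
def AbsNevanlinnaSummable (q : ℝ → ℝ) (u : ℕ → ℝ) : Prop :=
  ∃ A : ℝ, 0 < A ∧ IntegrableOn
    (fun w : ℝ => |∑ n ∈ Finset.range (⌊w⌋₊ + 1), (n : ℝ) * u n * q (n / w)| / w ^ 2) (Ioi A)

/-- The Fourier cosine coefficient `a_n`. -/
def fourierA (f : ℝ → ℝ) (n : ℕ) : ℝ :=
  (1 / Real.pi) * ∫ t in (-Real.pi)..Real.pi, f t * Real.cos (n * t)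

/-- The Fourier sine coefficient `b_n`. -/
def fourierB (f : ℝ → ℝ) (n : ℕ) : ℝ :=
  (1 / Real.pi) * ∫ t in (-Real.pi)..Real.pi, f t * Real.sin (n * t)

/-- The term `B_n(y) = b_n cos ny - a_n sin ny` of the conjugate series (it is `0` for `n = 0`). -/
def conjTerm (f : ℝ → ℝ) (n : ℕ) (y : ℝ) : ℝ :=
  fourierB f n * Real.cos (n * y) - fourierA f n * Real.sin (n * y)

/-- The term `(d/dx)^r B_n(x)` of the `r`-th derived conjugate series. -/
def derivedConjTerm (f : ℝ → ℝ) (r : ℕ) (x : ℝ) (n : ℕ) : ℝ :=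
  iteratedDeriv r (conjTerm f n) x

/-- `P(u) = ∑_{i < r} θ_i u^i / i!`. -/
def polyP {r : ℕ} (θ : Fin r → ℝ) (u : ℝ) : ℝ :=
  ∑ i : Fin r, θ i / (Nat.factorial i : ℝ) * u ^ (i : ℕ)

/-- `h(u) = [{f(x+u) - P(u)} - (-1)^r {f(x-u) - P(-u)}] / (2 u^r)`. -/
def hFun (f : ℝ → ℝ) (x : ℝ) {r : ℕ} (θ : Fin r → ℝ) (u : ℝ) : ℝ :=
  ((f (x + u) - polyP θ u) - (-1) ^ r * (f (x - u) - polyP θ (-u))) / (2 * u ^ r)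

/-- The Riemann-Liouville integral `(1/Γ(β)) ∫_0^t (t-u)^{β-1} h(u) du` of order `β > 0`. -/
def rlIntegral (β : ℝ) (h : ℝ → ℝ) (t : ℝ) : ℝ :=
  (1 / Real.Gamma β) * ∫ u in (0 : ℝ)..t, (t - u) ^ (β - 1) * h u

/-- `∫_0^π t^{-β} |dH(t)| < ∞`: the function `H` is of bounded variation on `(0, π)` (here it is
extended by `0` to the line), and the weight `t^{-β}` has a finite integral over `(0, π)` against
the total variation of the Lebesgue-Stieltjes measure `dH`. For `β ≥ 0` bounded variation is part
of the meaning of the condition, as the weight is at least `π^{-β}`. -/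
def FiniteWeightedVariation (β : ℝ) (H : ℝ → ℝ) : Prop :=
  ∃ hH : BoundedVariationOn ((Ioo 0 Real.pi).indicator H) univ,
    ∫⁻ t in Ioo 0 Real.pi, ENNReal.ofReal (t ^ (-β)) ∂hH.vectorMeasure.variation < ⊤

end NevanlinnaSum

end

/-!
The series is compared with Fourier integrals of a fractional primitive of `h`, and each of these
is estimated by the behaviour of its Nevanlinna sums. Write `k = ⌊α⌋ = r + p` and `α = k + γ`, so
that `0 ≤ γ < 1` and `β = p + γ`.

*Reduction to point masses.* Folding the Fourier coefficients onto `(0, π)` gives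
`n u_n = Im (π⁻¹ (-i)^r n^(r+1) ∫_0^π (f(x+u) - (-1)^r f(x-u)) e^{inu} du)`
(`natCast_mul_derivedConjTerm`), and the difference under the integral is `2 u^r h(u)` plus those
monomials `u^j`, `j < r`, whose parity differs from that of `r`. A monomial yields boundary terms
`n^a (-1)^n`, `a ≤ r`, and a constant which is real and so disappears from the imaginary part
(`IsKernelDensity.exists_nevIntegrable_pow`). For `h`, Taylor's formula at `π` turns the integral of
`h G`, `G(u) = n^(r+1) u^r e^{inu}`, into boundary terms `G^(j)(π)`, `j < p`, and the pairing of
`G^(p+1)` with the primitive of `h` of order `p + 1`. That primitive is the fractional integral of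
order `1 - γ` of `H_β`, hence an integral of `(t - v)_+^(1-γ)` against the measure `dH_β(v)`; one
more integration by parts leaves `∫ dH_β(v) ∫_v^π (t - v)^(-γ) G^(p)(t) dt`
(`exists_integral_mul_eq`). By Leibniz's rule only the integrals `fracCoeff` remain.

*Estimates.* The kernel is a `k`-fold integral of the increasing function `m = (-1)^k q^(k)`
(`IsKernelDensity`), so that the Nevanlinna sums of `n^a e^{inu}` are averages against `m` of Riesz
means of order `k - 1`. The Riesz means on the circle are controlled through power series in the
disc; the second mean value inequality then gives a bound by the tail `Q(t) = ∫_{1-t}^1 m` at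
`t = 1 / (w u + 1)` (`IsKernelDensity.exists_norm_nevSum_powExp_add_le`). Integrated against
`(t - v)^(-γ)` this yields, after division by `w²`, a majorant depending on `v` and `w` through the
product `v w` and a power of `v` (`majorant_scale`). Its integral over `w` is finite
because `∫_0^1 Q(s) s^(-1-γ) ds` is, and is a multiple of `v^(-β)`, which the hypothesis on `dH_β`
makes integrable (`IsKernelDensity.nevIntegrable_integral_fracCoeff`).
-/

namespace NevanlinnaSum

/-! ### Kernels as iterated integrals of a monotone density -/

/-- `q` is, on `[0, 1]`, the `k`-fold iterated integral from `1` of a nonnegative increasing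
integrable density `m` that does not vanish almost everywhere. -/
structure IsKernelDensity (k : ℕ) (q m : ℝ → ℝ) : Prop where
  one_le : 1 ≤ k
  mono : MonotoneOn m (Ioo 0 1)
  nonneg : ∀ s ∈ Ioo (0 : ℝ) 1, 0 ≤ m s
  integrable : IntervalIntegrable m volume 0 1
  repr : ∀ t ∈ Icc (0 : ℝ) 1,
    q t = ∫ s in t..1, (s - t) ^ (k - 1) / (Nat.factorial (k - 1) : ℝ) * m s
  pos : 0 < ∫ s in (0 : ℝ)..1, m s

/-- The mass `∫_{1-t}^1 m` that a density puts at distance at most `t` from `1`. -/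
noncomputable def tail (m : ℝ → ℝ) (t : ℝ) : ℝ := ∫ u in (1 - t)..1, m u

/-- Taylor's formula at `1`, by repeated integration by parts: absolute continuity allows the step
up to the last derivative, and the boundary terms vanish. -/
lemma IsNevanlinnaKernel.integral_kerDeriv {α : ℝ} {q : ℝ → ℝ} (hq : IsNevanlinnaKernel α q)
    {t : ℝ} (ht : t ∈ Icc (0 : ℝ) 1) (j : ℕ) (hj : j + 1 ≤ ⌊α⌋₊) :
    q t = ∫ s in t..1, (s - t) ^ j / (Nat.factorial j : ℝ) *
      ((-1) ^ (j + 1) * kerDeriv q (j + 1) s) := by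
  have hderiv : ∀ i, ∀ s ∈ uIoo t 1, deriv (kerDeriv q i) s = kerDeriv q (i + 1) s := by
    intro i s hs
    rw [uIoo_of_le ht.2] at hs
    unfold kerDeriv
    rw [iteratedDerivWithin_succ,
      derivWithin_of_mem_nhds (Icc_mem_nhds (ht.1.trans_lt hs.1) hs.2)]
  have hac : ∀ i < ⌊α⌋₊, AbsolutelyContinuousOnInterval (kerDeriv q i) t 1 := fun i hi =>
    (hq.absolutelyContinuous i hi).mono (by
      rw [uIcc_of_le ht.2, uIcc_of_le zero_le_one]; exact Icc_subset_Icc_left ht.1)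
  have hq0 : kerDeriv q 0 = q := by unfold kerDeriv; simp
  induction j with
  | zero =>
    have h := (hac 0 (by omega)).integral_deriv_eq_sub
    rw [hq.eq_zero_at_one 0 (by omega), hq0, intervalIntegral.integral_congr_uIoo
      (g := fun s => kerDeriv q 1 s) (fun s hs => by simpa [hq0] using hderiv 0 s hs)] at h
    simp [h]
  | succ j ih =>
    rw [ih (by omega)]
    have h1 : AbsolutelyContinuousOnInterval
        (fun s : ℝ => (s - t) ^ (j + 1) / (Nat.factorial (j + 1) : ℝ)) t 1 :=
      ContDiffOn.absolutelyContinuousOnInterval (by fun_prop)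
    have h := h1.integral_mul_deriv_eq_deriv_mul (hac (j + 1) (by omega))
    rw [hq.eq_zero_at_one (j + 1) (by omega)] at h
    have hd : ∀ s : ℝ, deriv (fun s : ℝ => (s - t) ^ (j + 1) / (Nat.factorial (j + 1) : ℝ)) s
        = (s - t) ^ j / (Nat.factorial j : ℝ) := by
      intro s
      have : HasDerivAt (fun s : ℝ => (s - t) ^ (j + 1) / (Nat.factorial (j + 1) : ℝ))
          (((j + 1 : ℕ) : ℝ) * (s - t) ^ j * 1 / (Nat.factorial (j + 1) : ℝ)) s := by
        simpa using (((hasDerivAt_id s).sub_const t).pow (j + 1)).div_const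
          (Nat.factorial (j + 1) : ℝ)
      rw [this.deriv, Nat.factorial_succ]
      have := Nat.cast_add_one_ne_zero (R := ℝ) j
      have := Nat.factorial_ne_zero j
      push_cast
      field_simp
    simp only [hd, sub_self, mul_zero, zero_sub] at h
    rw [intervalIntegral.integral_congr_uIoo (g := fun s =>
      (s - t) ^ (j + 1) / (Nat.factorial (j + 1) : ℝ) * kerDeriv q (j + 1 + 1) s)
      (fun s hs => by simp only [hderiv (j + 1) s hs])] at h
    simp only [ne_eq, Nat.add_eq_zero_iff, one_ne_zero, and_false, not_false_eq_true, zero_pow,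
      zero_div, zero_mul] at h
    have e1 : ∀ s : ℝ, (s - t) ^ j / (Nat.factorial j : ℝ) *
        ((-1) ^ (j + 1) * kerDeriv q (j + 1) s) = (-1) ^ (j + 1) *
        ((s - t) ^ j / (Nat.factorial j : ℝ) * kerDeriv q (j + 1) s) := fun s => by ring
    have e2 : ∀ s : ℝ, (s - t) ^ (j + 1) / (Nat.factorial (j + 1) : ℝ) *
        ((-1) ^ (j + 1 + 1) * kerDeriv q (j + 1 + 1) s) = (-1) ^ (j + 1 + 1) *
        ((s - t) ^ (j + 1) / (Nat.factorial (j + 1) : ℝ) * kerDeriv q (j + 1 + 1) s) :=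
      fun s => by ring
    simp only [e1, e2, intervalIntegral.integral_const_mul]
    rw [h]
    ring

/-- The density of an admissible kernel is its signed `k`-th derivative, whose tail is `Qk`. -/
lemma IsNevanlinnaKernel.isKernelDensity {α : ℝ} {q : ℝ → ℝ} (hq : IsNevanlinnaKernel α q)
    (hk : 1 ≤ ⌊α⌋₊) :
    IsKernelDensity ⌊α⌋₊ q (fun t => (-1) ^ ⌊α⌋₊ * kerDeriv q ⌊α⌋₊ t) := by
  obtain ⟨j, hj⟩ : ∃ j, ⌊α⌋₊ = j + 1 := ⟨⌊α⌋₊ - 1, by omega⟩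
  have hrepr : ∀ t ∈ Icc (0 : ℝ) 1, q t = ∫ s in t..1, (s - t) ^ (⌊α⌋₊ - 1) /
      (Nat.factorial (⌊α⌋₊ - 1) : ℝ) * ((-1) ^ ⌊α⌋₊ * kerDeriv q ⌊α⌋₊ s) := by
    intro t ht
    rw [hj, Nat.add_sub_cancel]
    exact hq.integral_kerDeriv ht j hj.ge
  have hint : IntervalIntegrable (fun t => (-1) ^ ⌊α⌋₊ * kerDeriv q ⌊α⌋₊ t) volume 0 1 := by
    have h := ((hq.absolutelyContinuous j (by omega)).intervalIntegrable_deriv).const_mul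
      ((-1) ^ ⌊α⌋₊)
    refine h.congr_uIoo ?_
    intro s hs
    rw [uIoo_of_le zero_le_one] at hs
    simp only [hj]
    unfold kerDeriv
    rw [iteratedDerivWithin_succ, derivWithin_of_mem_nhds (Icc_mem_nhds hs.1 hs.2)]
  refine ⟨hk, hq.monotone, hq.sign, hint, hrepr, ?_⟩
  -- If the density had integral `0`, the kernel would vanish on `[0, 1]`.
  have h0 : 0 ≤ ∫ s in (0 : ℝ)..1, (-1) ^ ⌊α⌋₊ * kerDeriv q ⌊α⌋₊ s :=
    intervalIntegral.integral_nonneg_of_ae_restrict zero_le_one (by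
      rw [← restrict_Ioo_eq_restrict_Icc]
      exact (ae_restrict_iff' measurableSet_Ioo).2 (ae_of_all _ hq.sign))
  refine h0.lt_of_ne' fun hzero => ?_
  have hae : (fun t => (-1) ^ ⌊α⌋₊ * kerDeriv q ⌊α⌋₊ t) =ᵐ[volume.restrict (Ioc 0 1)] 0 := by
    rw [intervalIntegral.integral_of_le zero_le_one] at hzero
    refine (integral_eq_zero_iff_of_nonneg_ae ?_ hint.1).1 hzero
    rw [← restrict_Ioo_eq_restrict_Ioc]
    exact (ae_restrict_iff' measurableSet_Ioo).2 (ae_of_all _ hq.sign)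
  have hq0 : ∀ t ∈ Icc (0 : ℝ) 1, q t = 0 := by
    intro t ht
    rw [hrepr t ht, intervalIntegral.integral_of_le ht.2]
    refine integral_eq_zero_of_ae ?_
    filter_upwards [ae_restrict_of_ae_restrict_of_subset (Ioc_subset_Ioc_left ht.1) hae]
      with s hs
    simp only [Pi.zero_apply] at hs ⊢
    rw [hs, mul_zero]
  have := hq.integral_eq_one
  rw [intervalIntegral.integral_congr (g := fun _ => (0 : ℝ)) (fun t ht => hq0 t (by
    rwa [uIcc_of_le zero_le_one] at ht))] at this
  simp at this

namespace IsKernelDensity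

variable {k : ℕ} {q m : ℝ → ℝ}

lemma intervalIntegrable (hm : IsKernelDensity k q m) {a b : ℝ} (ha : a ∈ Icc (0 : ℝ) 1)
    (hb : b ∈ Icc (0 : ℝ) 1) : IntervalIntegrable m volume a b :=
  hm.integrable.mono_set (by
    rw [uIcc_of_le zero_le_one]; exact uIcc_subset_Icc ha hb)

lemma integral_nonneg (hm : IsKernelDensity k q m) {a b : ℝ} (ha : 0 ≤ a) (hab : a ≤ b)
    (hb : b ≤ 1) : 0 ≤ ∫ s in a..b, m s :=
  intervalIntegral.integral_nonneg_of_ae_restrict hab (by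
    rw [← restrict_Ioo_eq_restrict_Icc]
    exact (ae_restrict_iff' measurableSet_Ioo).2
      (ae_of_all _ fun s hs => hm.nonneg s ⟨ha.trans_lt hs.1, hs.2.trans_le hb⟩))

lemma tail_mono (hm : IsKernelDensity k q m) {s t : ℝ} (hs : 0 ≤ s) (hst : s ≤ t) (ht : t ≤ 1) :
    tail m s ≤ tail m t := by
  unfold tail
  rw [← intervalIntegral.integral_add_adjacent_intervals (a := 1 - t) (b := 1 - s) (c := 1)
    (hm.intervalIntegrable ⟨by linarith, by linarith⟩ ⟨by linarith, by linarith⟩)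
    (hm.intervalIntegrable ⟨by linarith, by linarith⟩ ⟨by linarith, by linarith⟩)]
  linarith [hm.integral_nonneg (a := 1 - t) (b := 1 - s) (by linarith) (by linarith)
    (by linarith)]

lemma tail_nonneg (hm : IsKernelDensity k q m) {t : ℝ} (h0 : 0 ≤ t) (h1 : t ≤ 1) :
    0 ≤ tail m t := hm.integral_nonneg (by linarith) (by linarith) le_rfl

lemma tail_one_pos (hm : IsKernelDensity k q m) : 0 < tail m 1 := by
  unfold tail; simpa using hm.pos

/-- As `m` increases, `t * m (1 - t)` is at most the mass of `(1 - t, 1)`. -/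
lemma mul_le_tail (hm : IsKernelDensity k q m) {t : ℝ} (h0 : 0 < t) (h1 : t < 1) :
    t * m (1 - t) ≤ tail m t := by
  unfold tail
  have h : ∫ _ in (1 - t)..1, m (1 - t) ≤ ∫ u in (1 - t)..1, m u := by
    rw [intervalIntegral.integral_of_le (by linarith), intervalIntegral.integral_of_le
      (by linarith), integral_Ioc_eq_integral_Ioo, integral_Ioc_eq_integral_Ioo]
    refine setIntegral_mono_on (by simp) ?_ measurableSet_Ioo fun u hu =>
      hm.mono ⟨by linarith, by linarith⟩ ⟨by linarith [hu.1], hu.2⟩ hu.1.le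
    exact (hm.intervalIntegrable (a := 1 - t) (b := 1) ⟨by linarith, by linarith⟩
      ⟨by linarith, by linarith⟩).1.mono_set Ioo_subset_Ioc_self
  simpa using h

/-- A doubling inequality: as `m` increases, the right half of `(1 - t, 1)` has the larger mass. -/
lemma tail_le_two_mul_tail_half (hm : IsKernelDensity k q m) {t : ℝ} (h0 : 0 < t) (h1 : t ≤ 1) :
    tail m t ≤ 2 * tail m (t / 2) := by
  have hlo : ∫ u in (1 - t)..(1 - t / 2), m u ≤ t / 2 * m (1 - t / 2) := by
    have h : ∫ u in (1 - t)..(1 - t / 2), m u ≤ ∫ _ in (1 - t)..(1 - t / 2), m (1 - t / 2) := by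
      rw [intervalIntegral.integral_of_le (by linarith), intervalIntegral.integral_of_le
        (by linarith)]
      refine setIntegral_mono_on ?_ (by simp) measurableSet_Ioc fun u hu =>
        hm.mono ⟨by linarith [hu.1], by linarith [hu.2]⟩ ⟨by linarith, by linarith⟩ hu.2
      exact (hm.intervalIntegrable (a := 1 - t) (b := 1 - t / 2) ⟨by linarith, by linarith⟩
        ⟨by linarith, by linarith⟩).1
    refine h.trans (le_of_eq ?_)
    rw [intervalIntegral.integral_const, smul_eq_mul]
    ring
  have hsplit : tail m t = (∫ u in (1 - t)..(1 - t / 2), m u) + tail m (t / 2) := by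
    unfold tail
    rw [intervalIntegral.integral_add_adjacent_intervals]
    · exact hm.intervalIntegrable ⟨by linarith, by linarith⟩ ⟨by linarith, by linarith⟩
    · exact hm.intervalIntegrable ⟨by linarith, by linarith⟩ ⟨by linarith, by linarith⟩
  linarith [hm.mul_le_tail (t := t / 2) (by linarith) (by linarith)]

lemma abs_le_tail_one (hm : IsKernelDensity k q m) {t : ℝ} (ht : t ∈ Icc (0 : ℝ) 1) :
    |q t| ≤ tail m 1 := by
  rw [hm.repr t ht]
  have hb : ∀ s ∈ Ioo t 1, 0 ≤ (s - t) ^ (k - 1) / (Nat.factorial (k - 1) : ℝ) ∧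
      (s - t) ^ (k - 1) / (Nat.factorial (k - 1) : ℝ) ≤ 1 := by
    intro s hs
    have h1 : (0 : ℝ) ≤ s - t := by linarith [hs.1]
    refine ⟨by positivity, ?_⟩
    rw [div_le_one (by positivity)]
    exact (pow_le_one₀ h1 (by linarith [hs.2, ht.1])).trans
      (by exact_mod_cast Nat.one_le_iff_ne_zero.2 (Nat.factorial_ne_zero _))
  have hi := (hm.intervalIntegrable ht ⟨zero_le_one, le_rfl⟩)
  calc |∫ s in t..1, (s - t) ^ (k - 1) / (Nat.factorial (k - 1) : ℝ) * m s|
      ≤ ∫ s in t..1, m s := by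
        rw [← Real.norm_eq_abs]
        refine intervalIntegral.norm_integral_le_of_norm_le ht.2 ?_ hi
        filter_upwards [volume.ae_ne 1] with s hs1 hs
        have hs' : s ∈ Ioo t 1 := ⟨hs.1, lt_of_le_of_ne hs.2 hs1⟩
        have hms := hm.nonneg s ⟨ht.1.trans_lt hs.1, hs'.2⟩
        rw [Real.norm_eq_abs, abs_of_nonneg (mul_nonneg (hb s hs').1 hms)]
        exact mul_le_of_le_one_left hms (hb s hs').2
    _ = tail m (1 - t) := by unfold tail; simp
    _ ≤ tail m 1 := hm.tail_mono (by linarith [ht.2]) (by linarith [ht.1]) le_rfl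

lemma continuousOn_tail (hm : IsKernelDensity k q m) : ContinuousOn (tail m) (Icc 0 1) := by
  have h := intervalIntegral.continuousOn_primitive_interval_left (μ := volume) (f := m)
    (a := 0) (b := 1) ((intervalIntegrable_iff' (by simp)).1 hm.integrable)
  rw [uIcc_of_le zero_le_one] at h
  exact h.comp (by fun_prop) fun t ht => ⟨by linarith [ht.2], by linarith [ht.1]⟩

end IsKernelDensity

/-! ### The second mean value inequality -/

/-- Bonnet's inequality in layer-cake form: a weight `0 ≤ φ ≤ M` costs a factor `M` as soon as
the integrals of `g` over all superlevel sets of `φ` are bounded. -/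
lemma norm_setIntegral_mul_le_of_superlevel {I : Set ℝ} {φ : ℝ → ℝ} {g : ℝ → ℂ} {M K : ℝ}
    (hI : MeasurableSet I) (hφm : AEMeasurable φ (volume.restrict I))
    (hφ : ∀ s ∈ I, 0 ≤ φ s ∧ φ s ≤ M) (hM : 0 ≤ M) (hg : IntegrableOn g I)
    (hK : ∀ c, 0 < c → ‖∫ s in I ∩ {s | c < φ s}, g s‖ ≤ K) :
    ‖∫ s in I, (φ s : ℂ) * g s‖ ≤ M * K := by
  set F : ℝ → ℝ → ℂ := fun s c => {p : ℝ × ℝ | p.2 < φ p.1}.indicator (fun p => g p.1) (s, c)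
    with hF
  have hset : NullMeasurableSet {p : ℝ × ℝ | p.2 < φ p.1}
      ((volume.restrict I).prod (volume.restrict (Ioc 0 M))) :=
    nullMeasurableSet_lt measurable_snd.aemeasurable hφm.comp_fst
  have hint : Integrable (Function.uncurry F)
      ((volume.restrict I).prod (volume.restrict (Ioc 0 M))) := by
    have h1 : Integrable (fun p : ℝ × ℝ => g p.1)
        ((volume.restrict I).prod (volume.restrict (Ioc 0 M))) := by
      simpa using hg.mul_prod (integrable_const (1 : ℂ) (μ := volume.restrict (Ioc 0 M)))
    exact h1.indicator₀ hset
  have hinner : ∀ s ∈ I, ∫ c in Ioc 0 M, F s c = (φ s : ℂ) * g s := by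
    intro s hs
    have h2 : ∀ c, F s c = (Iio (φ s)).indicator (fun _ => g s) c := by
      intro c; simp [hF, indicator_apply]
    simp only [h2]
    rw [setIntegral_indicator measurableSet_Iio, setIntegral_const]
    have h3 : volume.real (Ioc 0 M ∩ Iio (φ s)) = φ s := by
      have : Ioc 0 M ∩ Iio (φ s) = Ioo 0 (φ s) := by
        ext c; simp only [mem_inter_iff, mem_Ioc, mem_Iio, mem_Ioo]
        constructor
        · rintro ⟨⟨h, _⟩, h'⟩; exact ⟨h, h'⟩
        · rintro ⟨h, h'⟩; exact ⟨⟨h, h'.le.trans (hφ s hs).2⟩, h'⟩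
      rw [this, Real.volume_real_Ioo_of_le (hφ s hs).1, sub_zero]
    rw [h3]; simp
  have hswap : ∫ s in I, (φ s : ℂ) * g s = ∫ c in Ioc 0 M, ∫ s in I, F s c := by
    rw [← integral_integral_swap hint]
    exact (setIntegral_congr_fun hI hinner).symm
  rw [hswap]
  have hbound : ∀ c ∈ Ioc 0 M, ‖∫ s in I, F s c‖ ≤ K := by
    intro c hc
    have h4 : ∀ s, F s c = {s | c < φ s}.indicator g s := by
      intro s; simp [hF, indicator_apply]
    simp only [h4]
    rw [integral_indicator₀ (nullMeasurableSet_lt aemeasurable_const hφm),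
      Measure.restrict_restrict₀ (nullMeasurableSet_lt aemeasurable_const hφm), inter_comm]
    exact hK c hc.1
  have h := norm_setIntegral_le_of_norm_le_const (μ := volume) (s := Ioc 0 M) (by simp) hbound
  rwa [Real.volume_real_Ioc_of_le hM, sub_zero, mul_comm] at h

/-- Second mean value inequality for an increasing nonnegative weight. -/
lemma norm_integral_monotoneOn_mul_le {a b : ℝ} (hab : a ≤ b) {φ : ℝ → ℝ} {g : ℝ → ℂ} {M K : ℝ}
    (hφ : MonotoneOn φ (Ioc a b)) (hφ0 : ∀ s ∈ Ioc a b, 0 ≤ φ s)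
    (hφM : ∀ s ∈ Ioc a b, φ s ≤ M) (hM : 0 ≤ M)
    (hg : IntervalIntegrable g volume a b)
    (hK : ∀ c ∈ Icc a b, ‖∫ s in c..b, g s‖ ≤ K) :
    ‖∫ s in a..b, (φ s : ℂ) * g s‖ ≤ M * K := by
  rw [intervalIntegral.integral_of_le hab]
  refine norm_setIntegral_mul_le_of_superlevel measurableSet_Ioc
    (aemeasurable_restrict_of_monotoneOn measurableSet_Ioc hφ)
    (fun s hs => ⟨hφ0 s hs, hφM s hs⟩) hM hg.1 fun c _ => ?_
  set T := Ioc a b ∩ {s | c < φ s} with hT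
  rcases T.eq_empty_or_nonempty with h | h
  · rw [h]
    simpa using (norm_nonneg _).trans (hK b ⟨hab, le_rfl⟩)
  have hbdd : BddBelow T := ⟨a, fun s hs => hs.1.1.le⟩
  have hd : sInf T ∈ Icc a b := by
    obtain ⟨s, hs⟩ := h
    exact ⟨le_csInf ⟨s, hs⟩ fun s hs => hs.1.1.le, (csInf_le hbdd hs).trans hs.1.2⟩
  have h1 : Ioc (sInf T) b ⊆ T := by
    intro s hs
    obtain ⟨t, ht, hts⟩ := exists_lt_of_csInf_lt h hs.1
    have hs' : s ∈ Ioc a b := ⟨hd.1.trans_lt hs.1, hs.2⟩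
    exact ⟨hs', ht.2.trans_le (hφ ht.1 hs' hts.le)⟩
  have h2 : T ⊆ Icc (sInf T) b := fun s hs => ⟨csInf_le hbdd hs, hs.1.2⟩
  have hae : T =ᵐ[volume] Ioc (sInf T) b :=
    (h2.eventuallyLE.trans Ioc_ae_eq_Icc.symm.le).antisymm h1.eventuallyLE
  rw [setIntegral_congr_set hae, ← intervalIntegral.integral_of_le hd.2]
  exact hK _ hd

/-- Second mean value inequality for a decreasing nonnegative weight. -/
lemma norm_integral_antitoneOn_mul_le {a b : ℝ} (hab : a ≤ b) {φ : ℝ → ℝ} {g : ℝ → ℂ} {M K : ℝ}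
    (hφ : AntitoneOn φ (Icc a b)) (hφ0 : ∀ s ∈ Icc a b, 0 ≤ φ s)
    (hφM : ∀ s ∈ Icc a b, φ s ≤ M)
    (hg : IntervalIntegrable g volume a b)
    (hK : ∀ c ∈ Icc a b, ‖∫ s in a..c, g s‖ ≤ K) :
    ‖∫ s in a..b, (φ s : ℂ) * g s‖ ≤ M * K := by
  have hM : 0 ≤ M := (hφ0 a ⟨le_rfl, hab⟩).trans (hφM a ⟨le_rfl, hab⟩)
  have hmem : ∀ s ∈ Ioc (-b) (-a), -s ∈ Icc a b := fun s hs =>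
    ⟨by linarith [hs.2], by linarith [hs.1]⟩
  have h := norm_integral_monotoneOn_mul_le (a := -b) (b := -a) (by linarith)
    (φ := fun s => φ (-s)) (g := fun s => g (-s)) (M := M) (K := K)
    (fun s hs t ht hst => hφ (hmem t ht) (hmem s hs) (by linarith))
    (fun s hs => hφ0 _ (hmem s hs)) (fun s hs => hφM _ (hmem s hs)) hM
    ((IntervalIntegrable.iff_comp_neg (a := b) (b := a)).1 hg.symm) (fun c hc => by
      rw [intervalIntegral.integral_comp_neg, neg_neg]
      exact hK _ ⟨by linarith [hc.2], by linarith [hc.1]⟩)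
  rwa [intervalIntegral.integral_comp_neg (fun s => (φ s : ℂ) * g s), neg_neg, neg_neg] at h

/-! ### Riesz means of `∑ n ^ a * z ^ n` on the unit circle -/

/-- Power sums with a binomial weight. The weight makes the induction on `i` close: a factor `n`
is traded for a difference of binomial coefficients, and for `i = 0` the sum is explicit. -/
lemma exists_norm_tsum_pow_mul_choose_le (i : ℕ) : ∀ j : ℕ, ∃ C : ℝ, 0 ≤ C ∧ ∀ x : ℂ, ‖x‖ < 1 →
    Summable (fun n : ℕ => (n : ℂ) ^ i * ((n + j).choose j : ℂ) * x ^ n) ∧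
    ‖∑' n : ℕ, (n : ℂ) ^ i * ((n + j).choose j : ℂ) * x ^ n‖ ≤ C * (‖1 - x‖⁻¹) ^ (i + j + 1) := by
  induction i with
  | zero =>
    intro j
    refine ⟨1, zero_le_one, fun x hx => ?_⟩
    have h := hasSum_choose_mul_geometric_of_norm_lt_one j hx
    simp only [pow_zero, one_mul]
    refine ⟨h.summable, ?_⟩
    rw [h.tsum_eq]
    simp
  | succ i ih =>
    intro j
    obtain ⟨C₁, hC₁, h₁⟩ := ih (j + 1)
    obtain ⟨C₂, hC₂, h₂⟩ := ih j
    refine ⟨(j + 1) * (C₁ + 2 * C₂), by positivity, fun x hx => ?_⟩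
    obtain ⟨s₁, b₁⟩ := h₁ x hx
    obtain ⟨s₂, b₂⟩ := h₂ x hx
    -- a factor `n` raises the lower index of the binomial coefficient:
    -- `n * choose (n + j) j = (j + 1) * (choose (n + j + 1) (j + 1) - choose (n + j) j)`
    have key : ∀ n : ℕ, (n : ℂ) ^ (i + 1) * ((n + j).choose j : ℂ) * x ^ n = (j + 1) *
        ((n : ℂ) ^ i * ((n + (j + 1)).choose (j + 1) : ℂ) * x ^ n -
          (n : ℂ) ^ i * ((n + j).choose j : ℂ) * x ^ n) := by
      intro n
      have h : ((n + j + 1 : ℕ) : ℂ) * ((n + j).choose j : ℂ)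
          = ((n + (j + 1)).choose (j + 1) : ℂ) * ((j + 1 : ℕ) : ℂ) := by
        exact_mod_cast Nat.add_one_mul_choose_eq (n + j) j
      push_cast at h
      linear_combination (-(n : ℂ) ^ i * x ^ n) * (-h)
    have hd0 : 0 < ‖1 - x‖ := norm_pos_iff.2 (sub_ne_zero.2 (by rintro rfl; simp at hx))
    have hd2 : ‖1 - x‖ ≤ 2 := (norm_sub_le _ _).trans (by rw [norm_one]; linarith)
    have hinv : 1 ≤ 2 * ‖1 - x‖⁻¹ := by
      rw [← div_eq_mul_inv, one_le_div hd0]; exact hd2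
    simp only [key]
    refine ⟨(s₁.sub s₂).mul_left _, ?_⟩
    rw [tsum_mul_left, s₁.tsum_sub s₂, norm_mul]
    have hj : ‖((j : ℂ) + 1)‖ = (j : ℝ) + 1 := by
      rw [← Nat.cast_succ, Complex.norm_natCast]; push_cast; ring
    rw [hj, mul_assoc]
    gcongr
    calc _ ≤ C₁ * (‖1 - x‖⁻¹) ^ (i + (j + 1) + 1) + C₂ * (‖1 - x‖⁻¹) ^ (i + j + 1) :=
          (norm_sub_le _ _).trans (add_le_add b₁ b₂)
      _ ≤ C₁ * (‖1 - x‖⁻¹) ^ (i + (j + 1) + 1)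
          + C₂ * (‖1 - x‖⁻¹) ^ (i + j + 1) * (2 * ‖1 - x‖⁻¹) := by
          exact add_le_add le_rfl (le_mul_of_one_le_right (by positivity) hinv)
      _ = _ := by ring

lemma exists_norm_tsum_pow_mul_geometric_le (b : ℕ) : ∃ C : ℝ, 0 ≤ C ∧ ∀ x : ℂ, ‖x‖ < 1 →
    ‖∑' n : ℕ, (n : ℂ) ^ b * x ^ n‖ ≤ C * (‖1 - x‖⁻¹) ^ (b + 1) := by
  obtain ⟨C, hC, h⟩ := exists_norm_tsum_pow_mul_choose_le b 0
  exact ⟨C, hC, fun x hx => by simpa using (h x hx).2⟩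

/-- The Riesz mean `∑_{n ≤ y} n ^ a (y - n) ^ κ z ^ n`. -/
noncomputable def rieszSum (a κ : ℕ) (y : ℝ) (z : ℂ) : ℂ :=
  ∑ n ∈ Finset.range (⌊y⌋₊ + 1), (n : ℂ) ^ a * ((y - n : ℝ) : ℂ) ^ κ * z ^ n

/-- Inside the disc, the Riesz mean is the full series minus its tail; both are polynomial
combinations of power sums `∑ n ^ b x ^ n = O(|1 - x| ^ (-b - 1))`. -/
lemma exists_norm_rieszSum_le_of_norm_lt_one (a κ : ℕ) : ∃ C : ℝ, 0 ≤ C ∧ ∀ (x : ℂ) (y W : ℝ),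
    ‖x‖ < 1 → 0 ≤ y → y + 1 ≤ W → ‖1 - x‖⁻¹ ≤ W →
    ‖rieszSum a κ y x‖ ≤ C * (W ^ κ * (‖1 - x‖⁻¹) ^ (a + 1) + W ^ a * (‖1 - x‖⁻¹) ^ (κ + 1)) := by
  choose B hB0 hB using exists_norm_tsum_pow_mul_geometric_le
  refine ⟨(∑ j ∈ Finset.range (κ + 1), (κ.choose j : ℝ) * B (a + j)) +
    ∑ i ∈ Finset.range (a + 1), ∑ j ∈ Finset.range (κ + 1),
      (a.choose i : ℝ) * (κ.choose j : ℝ) * B (i + j) * 2 ^ κ,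
    add_nonneg (Finset.sum_nonneg fun j _ => mul_nonneg (by positivity) (hB0 _))
      (Finset.sum_nonneg fun i _ => Finset.sum_nonneg fun j _ =>
        mul_nonneg (mul_nonneg (by positivity) (hB0 _)) (by positivity)), ?_⟩
  intro x y W hx hy hyW hdW
  set δ := ‖1 - x‖⁻¹ with hδ
  have hd0 : 0 < ‖1 - x‖ := norm_pos_iff.2 (sub_ne_zero.2 (by rintro rfl; simp at hx))
  have hd2 : ‖1 - x‖ ≤ 2 := (norm_sub_le _ _).trans (by rw [norm_one]; linarith)
  have hδ0 : 0 < δ := inv_pos.2 hd0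
  have hδ2 : 1 ≤ 2 * δ := by
    rw [hδ, ← div_eq_mul_inv, one_le_div hd0]; exact hd2
  have hW0 : 0 < W := by linarith
  have hsum : ∀ b : ℕ, Summable fun n : ℕ => (n : ℂ) ^ b * x ^ n := fun b =>
    summable_pow_mul_geometric_of_norm_lt_one b hx
  set N := ⌊y⌋₊ + 1 with hN
  have hN1 : (N : ℝ) ≤ W := by
    rw [hN]; push_cast; linarith [Nat.floor_le hy]
  have hNy : |y - N| ≤ 1 := by
    rw [hN]; push_cast
    rw [abs_le]; constructor <;> linarith [Nat.floor_le hy, Nat.lt_floor_add_one y]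
  -- The full series: expand `(y - n) ^ κ` in powers of `n`.
  have hexp1 : ∀ n : ℕ, (n : ℂ) ^ a * ((y - n : ℝ) : ℂ) ^ κ * x ^ n =
      ∑ j ∈ Finset.range (κ + 1), ((κ.choose j : ℂ) * (y : ℂ) ^ (κ - j) * (-1) ^ j) *
        ((n : ℂ) ^ (a + j) * x ^ n) := by
    intro n
    have : ((y - n : ℝ) : ℂ) = -(n : ℂ) + y := by push_cast; ring
    rw [this, add_pow, Finset.mul_sum, Finset.sum_mul]
    refine Finset.sum_congr rfl fun j _ => ?_
    rw [neg_pow]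
    ring
  have hsF : Summable fun n : ℕ => (n : ℂ) ^ a * ((y - n : ℝ) : ℂ) ^ κ * x ^ n := by
    simp only [hexp1]
    exact summable_sum fun j _ => (hsum _).mul_left _
  have hF : ‖∑' n : ℕ, (n : ℂ) ^ a * ((y - n : ℝ) : ℂ) ^ κ * x ^ n‖ ≤
      (∑ j ∈ Finset.range (κ + 1), (κ.choose j : ℝ) * B (a + j)) * (W ^ κ * δ ^ (a + 1)) := by
    simp only [hexp1]
    rw [Summable.tsum_finsetSum fun j _ => (hsum _).mul_left _, Finset.sum_mul]
    refine norm_sum_le_of_le _ fun j hj => ?_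
    rw [tsum_mul_left, norm_mul]
    have hj' : j ≤ κ := Nat.lt_succ_iff.1 (Finset.mem_range.1 hj)
    have e1 : ‖(κ.choose j : ℂ) * (y : ℂ) ^ (κ - j) * (-1) ^ j‖ ≤ κ.choose j * W ^ (κ - j) := by
      rw [norm_mul, norm_mul, norm_pow, norm_pow, norm_neg, norm_one, one_pow, mul_one,
        Complex.norm_natCast, Complex.norm_real, Real.norm_eq_abs, abs_of_nonneg hy]
      gcongr
      linarith
    calc _ ≤ (κ.choose j * W ^ (κ - j)) * (B (a + j) * δ ^ (a + j + 1)) :=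
          mul_le_mul e1 (hB _ x hx) (norm_nonneg _) (by positivity)
      _ = κ.choose j * B (a + j) * (W ^ (κ - j) * δ ^ j * δ ^ (a + 1)) := by ring
      _ ≤ κ.choose j * B (a + j) * (W ^ (κ - j) * W ^ j * δ ^ (a + 1)) := by
          have := hB0 (a + j)
          gcongr
      _ = _ := by rw [← pow_add, Nat.sub_add_cancel hj']
  -- The tail: after the shift by `N`, the factor `y - N` is at most `1` in absolute value, so that
  -- only the powers of `N` contribute powers of `W`.
  have hexp2 : ∀ n : ℕ, ((n + N : ℕ) : ℂ) ^ a * ((y - (n + N : ℕ) : ℝ) : ℂ) ^ κ * x ^ (n + N) =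
      ∑ i ∈ Finset.range (a + 1), ∑ j ∈ Finset.range (κ + 1),
        ((a.choose i : ℂ) * (N : ℂ) ^ (a - i) * ((κ.choose j : ℂ) *
          ((y - N : ℝ) : ℂ) ^ (κ - j) * (-1) ^ j) * x ^ N) *
        ((n : ℂ) ^ (i + j) * x ^ n) := by
    intro n
    have h1 : ((y - (n + N : ℕ) : ℝ) : ℂ) = -(n : ℂ) + ((y - N : ℝ) : ℂ) := by push_cast; ring
    have h2 : ((n + N : ℕ) : ℂ) = (n : ℂ) + N := by push_cast; ring
    rw [h1, h2, add_pow, add_pow, Finset.sum_mul_sum, Finset.sum_mul]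
    refine Finset.sum_congr rfl fun i _ => ?_
    rw [Finset.sum_mul]
    refine Finset.sum_congr rfl fun j _ => ?_
    rw [neg_pow]
    ring
  have hT : ‖∑' n : ℕ, ((n + N : ℕ) : ℂ) ^ a * ((y - (n + N : ℕ) : ℝ) : ℂ) ^ κ * x ^ (n + N)‖ ≤
      (∑ i ∈ Finset.range (a + 1), ∑ j ∈ Finset.range (κ + 1),
      (a.choose i : ℝ) * (κ.choose j : ℝ) * B (i + j) * 2 ^ κ) * (W ^ a * δ ^ (κ + 1)) := by
    simp only [hexp2]
    rw [Summable.tsum_finsetSum fun i _ => summable_sum fun j _ => (hsum _).mul_left _,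
      Finset.sum_mul]
    refine norm_sum_le_of_le _ fun i hi => ?_
    rw [Summable.tsum_finsetSum fun j _ => (hsum _).mul_left _, Finset.sum_mul]
    refine norm_sum_le_of_le _ fun j hj => ?_
    rw [tsum_mul_left, norm_mul]
    have hi' : i ≤ a := Nat.lt_succ_iff.1 (Finset.mem_range.1 hi)
    have hj' : j ≤ κ := Nat.lt_succ_iff.1 (Finset.mem_range.1 hj)
    have e1 : ‖(a.choose i : ℂ) * (N : ℂ) ^ (a - i) * ((κ.choose j : ℂ) *
          ((y - N : ℝ) : ℂ) ^ (κ - j) * (-1) ^ j) * x ^ N‖ ≤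
        a.choose i * κ.choose j * W ^ (a - i) := by
      rw [norm_mul, norm_mul, norm_mul, norm_mul, norm_mul, norm_pow, norm_pow, norm_pow,
        norm_pow, norm_neg, norm_one, one_pow, mul_one, Complex.norm_natCast,
        Complex.norm_natCast, Complex.norm_natCast, Complex.norm_real, Real.norm_eq_abs]
      calc _ ≤ (a.choose i : ℝ) * W ^ (a - i) * (κ.choose j * 1) * 1 := by
            gcongr
            · exact pow_le_one₀ (abs_nonneg _) hNy
            · exact pow_le_one₀ (norm_nonneg _) hx.le
        _ = _ := by ring
    have hδpow : δ ^ j ≤ 2 ^ κ * δ ^ κ := by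
      obtain ⟨l, rfl⟩ := Nat.exists_eq_add_of_le hj'
      calc δ ^ j ≤ δ ^ j * (2 ^ j * (2 * δ) ^ l) := by
            refine le_mul_of_one_le_right (by positivity) ?_
            exact one_le_mul_of_one_le_of_one_le (one_le_pow₀ one_le_two) (one_le_pow₀ hδ2)
        _ = _ := by rw [mul_pow]; ring
    have := hB0 (i + j)
    calc _ ≤ (a.choose i * κ.choose j * W ^ (a - i)) * (B (i + j) * δ ^ (i + j + 1)) :=
          mul_le_mul e1 (hB _ x hx) (norm_nonneg _) (by positivity)
      _ = a.choose i * κ.choose j * B (i + j) * (W ^ (a - i) * δ ^ i * δ ^ j * δ) := by ring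
      _ ≤ a.choose i * κ.choose j * B (i + j) * (W ^ (a - i) * W ^ i * (2 ^ κ * δ ^ κ) * δ) := by
          gcongr
      _ = _ := by rw [← pow_add, Nat.sub_add_cancel hi']; ring
  have hsplit : rieszSum a κ y x = (∑' n : ℕ, (n : ℂ) ^ a * ((y - n : ℝ) : ℂ) ^ κ * x ^ n) -
      ∑' n : ℕ, ((n + N : ℕ) : ℂ) ^ a * ((y - (n + N : ℕ) : ℝ) : ℂ) ^ κ * x ^ (n + N) := by
    rw [← hsF.sum_add_tsum_nat_add N]
    unfold rieszSum
    ring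
  rw [hsplit]
  refine (norm_sub_le _ _).trans ((add_le_add hF hT).trans ?_)
  rw [add_mul]
  have hA : 0 ≤ ∑ j ∈ Finset.range (κ + 1), (κ.choose j : ℝ) * B (a + j) :=
    Finset.sum_nonneg fun j _ => mul_nonneg (by positivity) (hB0 _)
  have hA' : 0 ≤ ∑ i ∈ Finset.range (a + 1), ∑ j ∈ Finset.range (κ + 1),
      (a.choose i : ℝ) * (κ.choose j : ℝ) * B (i + j) * 2 ^ κ :=
    Finset.sum_nonneg fun i _ => Finset.sum_nonneg fun j _ =>
        mul_nonneg (mul_nonneg (by positivity) (hB0 _)) (by positivity)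
  gcongr
  · exact le_add_of_nonneg_right (by positivity)
  · exact le_add_of_nonneg_left (by positivity)

lemma two_div_pi_mul_le_norm_one_sub_exp {u : ℝ} (hu : u ∈ Ioc 0 Real.pi) :
    2 / Real.pi * u ≤ ‖1 - Complex.exp (Complex.I * u)‖ := by
  rw [← norm_neg, neg_sub, Complex.norm_exp_I_mul_ofReal_sub_one, norm_mul, Real.norm_eq_abs,
    Real.norm_eq_abs]
  have h := Real.mul_le_sin (x := u / 2) (by linarith [hu.1]) (by linarith [hu.2])
  have h' : Real.sin (u / 2) ≤ |Real.sin (u / 2)| := le_abs_self _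
  rw [abs_of_pos (two_pos)]
  calc 2 / Real.pi * u = 2 * (2 / Real.pi * (u / 2)) := by ring
    _ ≤ _ := by linarith

/-- The bound for Riesz means on the unit circle, obtained from the disc by a radial limit. Since
`w u ≥ 1` and `u ≤ π < 4`, both `y + 1` and `|1 - x|⁻¹` are at most `W = 5 w` near the limit. -/
lemma exists_norm_rieszSum_exp_le (a κ : ℕ) : ∃ C : ℝ, 0 ≤ C ∧ ∀ u ∈ Ioc 0 Real.pi, ∀ w y : ℝ,
    1 ≤ w * u → 0 ≤ y → y ≤ w →
    ‖rieszSum a κ y (Complex.exp (Complex.I * u))‖ ≤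
      C * (w ^ κ * (u⁻¹) ^ (a + 1) + w ^ a * (u⁻¹) ^ (κ + 1)) := by
  obtain ⟨C, hC, h⟩ := exists_norm_rieszSum_le_of_norm_lt_one a κ
  refine ⟨C * (5 ^ (κ + a) * 2 ^ (a + κ + 1)), by positivity, fun u hu w y hwu hy hyw => ?_⟩
  set z := Complex.exp (Complex.I * u) with hz
  have hπ := Real.pi_pos
  have hu0 := hu.1
  have hw : 0 < w := pos_of_mul_pos_left (by linarith) hu0.le
  have hlow := two_div_pi_mul_le_norm_one_sub_exp hu
  have hz0 : 0 < ‖1 - z‖ := lt_of_lt_of_le (by positivity) hlow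
  have hδ : ‖1 - z‖⁻¹ < 2 * u⁻¹ := by
    have : ‖1 - z‖⁻¹ ≤ (2 / Real.pi * u)⁻¹ := inv_anti₀ (by positivity) hlow
    refine this.trans_lt ?_
    rw [mul_inv, inv_div]
    have : 0 < u⁻¹ := inv_pos.2 hu0
    gcongr
    linarith [Real.pi_lt_four]
  have huw : u⁻¹ ≤ w := by rw [inv_le_iff_one_le_mul₀ hu0]; exact hwu
  have hyW : y + 1 ≤ 5 * w := by
    have : 1 ≤ w * 4 := hwu.trans (by gcongr; linarith [hu.2, Real.pi_lt_four])
    linarith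
  -- The Riesz mean is a polynomial in `z`, so it is the limit of its values along the radius.
  have hx : Tendsto (fun ρ : ℝ => (ρ : ℂ) * z) (𝓝[<] 1) (𝓝 z) := by
    have : Tendsto (fun ρ : ℝ => (ρ : ℂ) * z) (𝓝 1) (𝓝 (((1 : ℝ) : ℂ) * z)) :=
      Continuous.tendsto (by fun_prop) _
    simpa using this.mono_left nhdsWithin_le_nhds
  have hlimδ : Tendsto (fun ρ : ℝ => ‖1 - (ρ : ℂ) * z‖⁻¹) (𝓝[<] 1) (𝓝 (‖1 - z‖⁻¹)) :=
    ((tendsto_const_nhds.sub hx).norm).inv₀ hz0.ne'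
  have hR : Continuous (rieszSum a κ y) := by unfold rieszSum; fun_prop
  have hlim := ((hR.tendsto z).comp hx).norm
  have hzn : ‖z‖ = 1 := by rw [hz, mul_comm]; exact Complex.norm_exp_ofReal_mul_I u
  refine le_of_tendsto hlim ?_
  filter_upwards [hlimδ.eventually (gt_mem_nhds hδ), self_mem_nhdsWithin,
    (nhdsWithin_le_nhds (s := Iio (1 : ℝ))) (lt_mem_nhds (zero_lt_one' ℝ))] with ρ h1 h2 h3
  have hρ : ‖(ρ : ℂ) * z‖ < 1 := by
    rw [norm_mul, hzn, mul_one, Complex.norm_real, Real.norm_eq_abs, abs_of_pos h3]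
    exact h2
  have hu' : 0 < u⁻¹ := inv_pos.2 hu0
  refine (h (ρ * z) y (5 * w) hρ hy hyW (by linarith)).trans ?_
  rw [mul_assoc]
  gcongr
  have e1 : ‖1 - (ρ : ℂ) * z‖⁻¹ ^ (a + 1) ≤ 2 ^ (a + κ + 1) * (u⁻¹) ^ (a + 1) :=
    calc _ ≤ (2 * u⁻¹) ^ (a + 1) := by gcongr
      _ = 2 ^ (a + 1) * (u⁻¹) ^ (a + 1) := mul_pow _ _ _
      _ ≤ _ := by gcongr <;> first | omega | norm_num
  have e2 : ‖1 - (ρ : ℂ) * z‖⁻¹ ^ (κ + 1) ≤ 2 ^ (a + κ + 1) * (u⁻¹) ^ (κ + 1) :=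
    calc _ ≤ (2 * u⁻¹) ^ (κ + 1) := by gcongr
      _ = 2 ^ (κ + 1) * (u⁻¹) ^ (κ + 1) := mul_pow _ _ _
      _ ≤ _ := by gcongr <;> first | omega | norm_num
  have e3 : (5 * w) ^ κ ≤ 5 ^ (κ + a) * w ^ κ := by
    rw [mul_pow]; gcongr <;> first | omega | norm_num
  have e4 : (5 * w) ^ a ≤ 5 ^ (κ + a) * w ^ a := by
    rw [mul_pow]; gcongr <;> first | omega | norm_num
  calc _ ≤ (5 ^ (κ + a) * w ^ κ) * (2 ^ (a + κ + 1) * (u⁻¹) ^ (a + 1)) +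
        (5 ^ (κ + a) * w ^ a) * (2 ^ (a + κ + 1) * (u⁻¹) ^ (κ + 1)) := by gcongr
    _ = _ := by ring

/-! ### Nevanlinna sums of power-weighted exponentials -/

/-- The Nevanlinna sum `∑_{n ≤ w} c n * q (n / w)`. -/
noncomputable def nevSum (q : ℝ → ℝ) (c : ℕ → ℂ) (w : ℝ) : ℂ :=
  ∑ n ∈ Finset.range (⌊w⌋₊ + 1), c n * (q (n / w) : ℂ)

/-- The sequence `n ^ a * exp (i n u)`. -/
noncomputable def powExp (a : ℕ) (u : ℝ) (n : ℕ) : ℂ :=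
  (n : ℂ) ^ a * Complex.exp (Complex.I * u) ^ n

/-- The truncated power `(y - n) ^ κ`, taken to be `0` for `y < n` (also when `κ = 0`). -/
noncomputable def truncPow (κ n : ℕ) (y : ℝ) : ℝ := if (n : ℝ) ≤ y then (y - n) ^ κ else 0

lemma rieszSum_eq_sum_truncPow (a κ : ℕ) {y : ℝ} (hy : 0 ≤ y) (z : ℂ) {N : ℕ} (hN : ⌊y⌋₊ ≤ N) :
    rieszSum a κ y z =
      ∑ n ∈ Finset.range (N + 1), ((n : ℂ) ^ a * z ^ n) * (truncPow κ n y : ℂ) := by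
  unfold rieszSum
  rw [← Finset.sum_subset (Finset.range_mono (Nat.succ_le_succ hN))]
  · refine Finset.sum_congr rfl fun n hn => ?_
    have : (n : ℝ) ≤ y :=
      (Nat.le_floor_iff hy).1 (Nat.lt_succ_iff.1 (Finset.mem_range.1 hn))
    rw [truncPow, if_pos this]
    push_cast
    ring
  · intro n _ hn
    have : ¬ (n : ℝ) ≤ y := fun h => hn (Finset.mem_range.2 (Nat.lt_succ_iff.2 (Nat.le_floor h)))
    rw [truncPow, if_neg this]
    simp

lemma intervalIntegrable_truncPow_mul (κ n : ℕ) (w c d : ℝ) :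
    IntervalIntegrable (fun s => truncPow κ n (w * s)) volume c d := by
  have h : (fun s => truncPow κ n (w * s)) =
      {s : ℝ | (n : ℝ) ≤ w * s}.indicator (fun s => (w * s - n) ^ κ) := by
    ext s; simp [truncPow, indicator_apply]
  have hc : IntervalIntegrable (fun s : ℝ => (w * s - n) ^ κ) volume c d :=
    Continuous.intervalIntegrable (by fun_prop) _ _
  have hm : MeasurableSet {s : ℝ | (n : ℝ) ≤ w * s} :=
    measurableSet_le measurable_const (by fun_prop)
  rw [h]
  exact ⟨hc.1.indicator hm, hc.2.indicator hm⟩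

/-- Off the jump or corner at `w s = n` the truncated powers differentiate like powers. -/
lemma hasDerivAt_truncPow_mul (κ n : ℕ) {w s : ℝ} (hs : w * s ≠ n) :
    HasDerivAt (fun s => truncPow (κ + 1) n (w * s)) (w * (κ + 1) * truncPow κ n (w * s)) s := by
  have hcont : Continuous fun s : ℝ => w * s := by fun_prop
  rcases lt_or_gt_of_ne hs with h | h
  · have : (fun s => truncPow (κ + 1) n (w * s)) =ᶠ[𝓝 s] fun _ => (0 : ℝ) := by
      filter_upwards [hcont.continuousAt.eventually (gt_mem_nhds h)] with t ht
      rw [truncPow, if_neg (not_le.2 ht)]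
    rw [truncPow, if_neg (not_le.2 h), mul_zero]
    exact (hasDerivAt_const s (0 : ℝ)).congr_of_eventuallyEq this
  · have : (fun s => truncPow (κ + 1) n (w * s)) =ᶠ[𝓝 s] fun s => (w * s - n) ^ (κ + 1) := by
      filter_upwards [hcont.continuousAt.eventually (lt_mem_nhds h)] with t ht
      rw [truncPow, if_pos ht.le]
    rw [truncPow, if_pos h.le]
    refine HasDerivAt.congr_of_eventuallyEq ?_ this
    have hd : HasDerivAt (fun s : ℝ => w * s - n) w s := by
      simpa using ((hasDerivAt_id s).const_mul w).sub_const (n : ℝ)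
    refine (hd.pow (κ + 1)).congr_deriv ?_
    push_cast
    ring

lemma continuous_truncPow_succ (κ n : ℕ) : Continuous (truncPow (κ + 1) n) := by
  have : truncPow (κ + 1) n = fun y : ℝ => (max (y - n) 0) ^ (κ + 1) := by
    ext y
    unfold truncPow
    split_ifs with h
    · rw [max_eq_left (by linarith)]
    · rw [max_eq_right (by linarith [not_le.1 h]), zero_pow (Nat.succ_ne_zero _)]
  rw [this]; fun_prop

lemma integral_truncPow_mul (κ n : ℕ) {w : ℝ} (hw : 0 < w) (c d : ℝ) :
    ∫ s in c..d, truncPow κ n (w * s) =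
      (truncPow (κ + 1) n (w * d) - truncPow (κ + 1) n (w * c)) / (w * (κ + 1)) := by
  have h := integral_eq_of_hasDerivAt_off_countable
    (fun s => truncPow (κ + 1) n (w * s)) (fun s => w * (κ + 1) * truncPow κ n (w * s))
    (a := c) (b := d) (s := {(n : ℝ) / w}) (countable_singleton _)
    (((continuous_truncPow_succ κ n).comp (by fun_prop)).continuousOn)
    (fun s hs => hasDerivAt_truncPow_mul κ n (fun h => hs.2 (by
      rw [mem_singleton_iff, eq_div_iff hw.ne', mul_comm]; exact h)))
    ((intervalIntegrable_truncPow_mul κ n w c d).const_mul _)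
  rw [intervalIntegral.integral_const_mul] at h
  rw [← h]
  field_simp

lemma intervalIntegrable_rieszSum (a κ : ℕ) (z : ℂ) {w : ℝ} (hw : 0 ≤ w) {c d : ℝ}
    (hc : 0 ≤ c) (hcd : c ≤ d) :
    IntervalIntegrable (fun s => rieszSum a κ (w * s) z) volume c d := by
  have h : IntervalIntegrable (fun s : ℝ => ∑ n ∈ Finset.range (⌊w * d⌋₊ + 1),
      ((n : ℂ) ^ a * z ^ n) * (truncPow κ n (w * s) : ℂ)) volume c d := by
    have h1 := IntervalIntegrable.sum (μ := volume) (a := c) (b := d)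
      (Finset.range (⌊w * d⌋₊ + 1))
      (f := fun (n : ℕ) (s : ℝ) => ((n : ℂ) ^ a * z ^ n) * (truncPow κ n (w * s) : ℂ))
      fun n _ => by
        have := intervalIntegrable_truncPow_mul κ n w c d
        exact IntervalIntegrable.const_mul ⟨this.1.ofReal, this.2.ofReal⟩ _
    exact h1.congr (fun s _ => by simp)
  refine h.congr_uIoo fun s hs => ?_
  rw [uIoo_of_le hcd] at hs
  exact (rieszSum_eq_sum_truncPow a κ (mul_nonneg hw (hc.trans hs.1.le)) z
    (Nat.floor_mono (mul_le_mul_of_nonneg_left hs.2.le hw))).symm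

/-- Integration in the parameter raises the order of a Riesz mean by one. -/
lemma integral_rieszSum (a κ : ℕ) (z : ℂ) {w : ℝ} (hw : 0 < w) {c d : ℝ}
    (hc : 0 ≤ c) (hcd : c ≤ d) :
    ∫ s in c..d, rieszSum a κ (w * s) z =
      (rieszSum a (κ + 1) (w * d) z - rieszSum a (κ + 1) (w * c) z) / (w * (κ + 1)) := by
  have hcw : w * c ≤ w * d := mul_le_mul_of_nonneg_left hcd hw.le
  rw [rieszSum_eq_sum_truncPow a (κ + 1) (y := w * c) (mul_nonneg hw.le hc) z
      (Nat.floor_mono hcw),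
    rieszSum_eq_sum_truncPow a (κ + 1) (mul_nonneg hw.le (hc.trans hcd)) z le_rfl,
    intervalIntegral.integral_congr (g := fun s : ℝ => ∑ n ∈ Finset.range (⌊w * d⌋₊ + 1),
      ((n : ℂ) ^ a * z ^ n) * (truncPow κ n (w * s) : ℂ))]
  · rw [intervalIntegral.integral_finsetSum]
    · rw [← Finset.sum_sub_distrib, Finset.sum_div]
      refine Finset.sum_congr rfl fun n _ => ?_
      rw [intervalIntegral.integral_const_mul, intervalIntegral.integral_ofReal,
        integral_truncPow_mul κ n hw]
      push_cast
      ring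
    · intro n _
      have := intervalIntegrable_truncPow_mul κ n w c d
      exact IntervalIntegrable.const_mul ⟨this.1.ofReal, this.2.ofReal⟩ _
  · intro s hs
    rw [uIcc_of_le hcd] at hs
    exact rieszSum_eq_sum_truncPow a κ (mul_nonneg hw.le (hc.trans hs.1)) z
      (Nat.floor_mono (mul_le_mul_of_nonneg_left hs.2 hw.le))

namespace IsKernelDensity

variable {k : ℕ} {q m : ℝ → ℝ}

lemma intervalIntegrable_mul_truncPow (hm : IsKernelDensity k q m) (κ n : ℕ) {w : ℝ} (hw : 0 < w)
    {b c : ℝ} (hb : b ∈ Icc (0 : ℝ) 1) (hc : c ∈ Icc (0 : ℝ) 1) :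
    IntervalIntegrable (fun s => m s * truncPow κ n (w * s)) volume b c := by
  have hmb := hm.intervalIntegrable hb hc
  have hbd : ∀ s ∈ uIoc b c, ‖truncPow κ n (w * s)‖ ≤ w ^ κ := by
    intro s hs
    have hs1 : s ≤ 1 := hs.2.trans (max_le hb.2 hc.2)
    unfold truncPow
    split_ifs with h
    · rw [Real.norm_eq_abs, abs_pow, abs_of_nonneg (by linarith)]
      exact pow_le_pow_left₀ (by linarith) (by nlinarith [n.cast_nonneg (α := ℝ)]) _
    · simp; positivity
  rw [intervalIntegrable_iff] at hmb ⊢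
  refine Integrable.mul_bdd (c := w ^ κ) hmb
    ((intervalIntegrable_iff.1 (intervalIntegrable_truncPow_mul _ n w b c)).1) ?_
  exact (ae_restrict_iff' measurableSet_uIoc).2 (ae_of_all _ hbd)

/-- Expanding the kernel turns its sums into averages of Riesz means against the density. -/
lemma nevSum_powExp_eq (hm : IsKernelDensity k q m) (a : ℕ) (u : ℝ) {w : ℝ} (hw : 0 < w) :
    nevSum q (powExp a u) w = ((w ^ (k - 1) * Nat.factorial (k - 1) : ℝ) : ℂ)⁻¹ *
      ∫ s in (0 : ℝ)..1, (m s : ℂ) * rieszSum a (k - 1) (w * s) (Complex.exp (Complex.I * u)) := by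
  set z := Complex.exp (Complex.I * u)
  have hterm : ∀ n ∈ Finset.range (⌊w⌋₊ + 1), q (n / w) = (w ^ (k - 1) *
      Nat.factorial (k - 1) : ℝ)⁻¹ * ∫ s in (0 : ℝ)..1, m s * truncPow (k - 1) n (w * s) := by
    intro n hn
    have hnw : (n : ℝ) ≤ w :=
      (Nat.le_floor_iff hw.le).1 (Nat.lt_succ_iff.1 (Finset.mem_range.1 hn))
    have h0 : (0 : ℝ) ≤ n / w := by positivity
    have h1 : (n : ℝ) / w ≤ 1 := (div_le_one hw).2 hnw
    have hi := fun b c hb hc =>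
      hm.intervalIntegrable_mul_truncPow (b := b) (c := c) (k - 1) n hw hb hc
    rw [hm.repr _ ⟨h0, h1⟩, ← intervalIntegral.integral_add_adjacent_intervals
      (hi 0 (n / w) ⟨le_rfl, zero_le_one⟩ ⟨h0, h1⟩) (hi (n / w) 1 ⟨h0, h1⟩ ⟨zero_le_one, le_rfl⟩)]
    have hz : ∫ s in (0 : ℝ)..(n / w), m s * truncPow (k - 1) n (w * s) = 0 := by
      rw [intervalIntegral.integral_congr_uIoo (g := fun _ => (0 : ℝ))]
      · simp
      · intro s hs
        rw [uIoo_of_le h0] at hs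
        have : w * s < n := by rw [mul_comm]; exact (lt_div_iff₀ hw).1 hs.2
        simp only [truncPow, if_neg (not_le.2 this), mul_zero]
    rw [hz, zero_add, ← intervalIntegral.integral_const_mul]
    refine intervalIntegral.integral_congr_uIoo fun s hs => ?_
    rw [uIoo_of_le h1] at hs
    have : (n : ℝ) ≤ w * s := by rw [mul_comm]; exact ((div_lt_iff₀ hw).1 hs.1).le
    simp only [truncPow, if_pos this]
    have e : w * s - n = w * (s - n / w) := by field_simp
    rw [e, mul_pow]
    have := Nat.factorial_ne_zero (k - 1)
    field_simp
  have hR : ∫ s in (0 : ℝ)..1, (m s : ℂ) * rieszSum a (k - 1) (w * s) z =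
      ∑ n ∈ Finset.range (⌊w⌋₊ + 1), ((n : ℂ) ^ a * z ^ n) *
        ((∫ s in (0 : ℝ)..1, m s * truncPow (k - 1) n (w * s) : ℝ) : ℂ) := by
    rw [intervalIntegral.integral_congr (g := fun s : ℝ => ∑ n ∈ Finset.range (⌊w⌋₊ + 1),
      ((n : ℂ) ^ a * z ^ n) * ((m s * truncPow (k - 1) n (w * s) : ℝ) : ℂ))]
    · rw [intervalIntegral.integral_finsetSum]
      · refine Finset.sum_congr rfl fun n _ => ?_
        rw [intervalIntegral.integral_const_mul, intervalIntegral.integral_ofReal]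
      · intro n _
        have := hm.intervalIntegrable_mul_truncPow (b := 0) (c := 1) (k - 1) n hw
          ⟨le_rfl, zero_le_one⟩ ⟨zero_le_one, le_rfl⟩
        exact IntervalIntegrable.const_mul ⟨this.1.ofReal, this.2.ofReal⟩ _
    · intro s hs
      rw [uIcc_of_le zero_le_one] at hs
      simp only
      rw [rieszSum_eq_sum_truncPow a (k - 1) (mul_nonneg hw.le hs.1) z (N := ⌊w⌋₊)
        (Nat.floor_mono (mul_le_of_le_one_right hw.le hs.2)), Finset.mul_sum]
      refine Finset.sum_congr rfl fun n _ => ?_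
      push_cast
      ring
  rw [hR, Finset.mul_sum]
  unfold nevSum
  refine Finset.sum_congr rfl fun n hn => ?_
  rw [hterm n hn, powExp]
  push_cast
  ring

/-- The bound for Nevanlinna sums away from `u = 0`, by splitting the average of Riesz means against
the density at distance `1 / (w u)` from `1`. -/
lemma exists_norm_nevSum_powExp_le (hm : IsKernelDensity k q m) (a : ℕ) :
    ∃ C : ℝ, 0 ≤ C ∧ ∀ u ∈ Ioc 0 Real.pi, ∀ w : ℝ, 1 ≤ w * u →
      ‖nevSum q (powExp a u) w‖ ≤
        C * tail m (w * u)⁻¹ * (w * u⁻¹ ^ a + w ^ (a + 1) * (u⁻¹ / w) ^ k) := by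
  obtain ⟨κ, rfl⟩ : ∃ κ, k = κ + 1 := ⟨k - 1, by have := hm.one_le; omega⟩
  obtain ⟨C₁, hC₁, h₁⟩ := exists_norm_rieszSum_exp_le a κ
  obtain ⟨C₂, hC₂, h₂⟩ := exists_norm_rieszSum_exp_le a (κ + 1)
  refine ⟨C₁ + 2 * C₂, by positivity, fun u hu w hwu => ?_⟩
  have hu0 := hu.1
  have hw : 0 < w := pos_of_mul_pos_left (by linarith) hu0.le
  set U := u⁻¹ with hU
  have hU0 : 0 < U := inv_pos.2 hu0
  have hUu : u * U = 1 := mul_inv_cancel₀ hu0.ne'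
  have hUw : U ≤ w := by rw [hU, inv_le_iff_one_le_mul₀ hu0]; exact hwu
  set τ := (w * u)⁻¹ with hτ
  have hτ0 : 0 < τ := by positivity
  have hτ1 : τ ≤ 1 := inv_le_one_of_one_le₀ hwu
  set z := Complex.exp (Complex.I * u) with hz
  set g : ℝ → ℂ := fun s => rieszSum a κ (w * s) z with hg
  have hQ := hm.tail_nonneg hτ0.le hτ1
  set B₁ := C₁ * (w ^ κ * U ^ (a + 1) + w ^ a * U ^ (κ + 1)) with hB₁
  set B₂ := C₂ * (w ^ (κ + 1) * U ^ (a + 1) + w ^ a * U ^ (κ + 1 + 1)) with hB₂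
  have hgi : ∀ c d : ℝ, 0 ≤ c → c ≤ d → IntervalIntegrable g volume c d := fun c d hc hcd =>
    intervalIntegrable_rieszSum a κ z hw.le hc hcd
  have hgB : ∀ s ∈ Icc (0 : ℝ) 1, ‖g s‖ ≤ B₁ := fun s hs =>
    h₁ u hu w (w * s) hwu (mul_nonneg hw.le hs.1) (mul_le_of_le_one_right hw.le hs.2)
  have hmg : ∀ c d : ℝ, c ∈ Icc (0 : ℝ) 1 → d ∈ Icc (0 : ℝ) 1 → c ≤ d →
      IntervalIntegrable (fun s => (m s : ℂ) * g s) volume c d := by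
    intro c d hc hd hcd
    have h := hm.intervalIntegrable hc hd
    have hg' := hgi c d hc.1 hcd
    rw [intervalIntegrable_iff] at h hg' ⊢
    refine Integrable.mul_bdd (c := B₁) h.ofReal hg'.1 ?_
    refine (ae_restrict_iff' measurableSet_uIoc).2 (ae_of_all _ fun s hs => hgB s ?_)
    rw [uIoc_of_le hcd] at hs
    exact ⟨hc.1.trans hs.1.le, hs.2.trans hd.2⟩
  -- near `1` the mass of the density is a tail, and the Riesz means of order `κ` are bounded
  have hright : ‖∫ s in (1 - τ)..1, (m s : ℂ) * g s‖ ≤ tail m τ * B₁ := by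
    unfold tail
    rw [← intervalIntegral.integral_mul_const]
    refine intervalIntegral.norm_integral_le_of_norm_le (by linarith) ?_
      ((hm.intervalIntegrable ⟨by linarith, by linarith⟩ ⟨zero_le_one, le_rfl⟩).mul_const _)
    filter_upwards [volume.ae_ne 1] with s hs1 hs
    have hs0 : 0 < s := lt_of_le_of_lt (by linarith) hs.1
    have hms := hm.nonneg s ⟨hs0, lt_of_le_of_ne hs.2 hs1⟩
    rw [norm_mul, Complex.norm_real, Real.norm_eq_abs, abs_of_nonneg hms]
    exact mul_le_mul_of_nonneg_left (hgB s ⟨hs0.le, hs.2⟩) hms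
  -- away from `1` the density increases up to a value bounded by the tail, and the oscillation of
  -- the Riesz means shows in their primitive, a Riesz mean of order `κ + 1`
  have hleft : ‖∫ s in (0 : ℝ)..(1 - τ), (m s : ℂ) * g s‖ ≤
      (tail m τ * (w * u)) * (2 * B₂ / w) := by
    refine norm_integral_monotoneOn_mul_le (by linarith)
      (hm.mono.mono fun s hs => ⟨hs.1, by linarith [hs.2]⟩)
      (fun s hs => hm.nonneg s ⟨hs.1, by linarith [hs.2]⟩) (fun s hs => ?_) (by positivity)
      (hgi _ _ le_rfl (by linarith)) fun c hc => ?_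
    · have hτ1' : τ < 1 := by linarith [hs.1, hs.2]
      have h := hm.mul_le_tail hτ0 hτ1'
      have h' : m s ≤ m (1 - τ) :=
        hm.mono ⟨hs.1, by linarith [hs.2]⟩ ⟨by linarith, by linarith⟩ hs.2
      refine h'.trans ?_
      have hwu' : w * u = τ⁻¹ := by rw [hτ, inv_inv]
      rw [hwu', ← div_eq_mul_inv, le_div_iff₀ hτ0, mul_comm]
      exact h
    · have hR : ∀ y ∈ Icc (0 : ℝ) 1, ‖rieszSum a (κ + 1) (w * y) z‖ ≤ B₂ := fun y hy =>
        h₂ u hu w (w * y) hwu (mul_nonneg hw.le hy.1) (mul_le_of_le_one_right hw.le hy.2)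
      rw [hg, integral_rieszSum a κ z hw hc.1 hc.2, norm_div]
      have e : ‖((w : ℂ) * (κ + 1))‖ = w * (κ + 1) := by
        rw [norm_mul, Complex.norm_real, Real.norm_eq_abs, abs_of_pos hw, ← Nat.cast_succ,
          Complex.norm_natCast]
        push_cast; ring
      rw [e]
      refine div_le_div₀ (by positivity) ((norm_sub_le _ _).trans ?_) hw ?_
      · rw [two_mul]
        exact add_le_add (hR _ ⟨by linarith, by linarith⟩) (hR _ ⟨hc.1, by linarith [hc.2]⟩)
      · exact le_mul_of_one_le_right hw.le (by linarith [κ.cast_nonneg (α := ℝ)])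
  have hS : nevSum q (powExp a u) w = ((w ^ (κ + 1 - 1) * Nat.factorial (κ + 1 - 1) : ℝ) : ℂ)⁻¹ *
      ∫ s in (0 : ℝ)..1, (m s : ℂ) * g s := hm.nevSum_powExp_eq a u hw
  rw [hS, norm_mul, ← intervalIntegral.integral_add_adjacent_intervals
    (hmg 0 (1 - τ) ⟨le_rfl, zero_le_one⟩ ⟨by linarith, by linarith⟩ (by linarith))
    (hmg (1 - τ) 1 ⟨by linarith, by linarith⟩ ⟨zero_le_one, le_rfl⟩ (by linarith))]
  have hfac : ‖((w ^ (κ + 1 - 1) * Nat.factorial (κ + 1 - 1) : ℝ) : ℂ)⁻¹‖ ≤ (w ^ κ)⁻¹ := by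
    rw [norm_inv, Complex.norm_real, Real.norm_eq_abs, abs_of_pos (by positivity),
      Nat.add_sub_cancel]
    exact inv_anti₀ (by positivity) (le_mul_of_one_le_right (by positivity)
      (by exact_mod_cast Nat.one_le_iff_ne_zero.2 (Nat.factorial_ne_zero _)))
  calc _ ≤ (w ^ κ)⁻¹ * ((tail m τ * (w * u)) * (2 * B₂ / w) + tail m τ * B₁) := by
        refine mul_le_mul hfac ((norm_add_le _ _).trans (add_le_add hleft hright))
          (norm_nonneg _) (by positivity)
    _ = (w ^ κ)⁻¹ * tail m τ * (2 * (u * B₂) + B₁) := by field_simp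
    _ ≤ (w ^ κ)⁻¹ * tail m τ * ((C₁ + 2 * C₂) * (w ^ (κ + 1) * U ^ a + w ^ a * U ^ (κ + 1))) := by
        have e2 : u * B₂ = C₂ * (w ^ (κ + 1) * U ^ a + w ^ a * U ^ (κ + 1)) := by
          rw [hB₂]
          linear_combination (C₂ * (w ^ (κ + 1) * U ^ a + w ^ a * U ^ (κ + 1))) * hUu
        have e1 : B₁ ≤ C₁ * (w ^ (κ + 1) * U ^ a + w ^ a * U ^ (κ + 1)) := by
          have : w ^ κ * U ^ (a + 1) ≤ w ^ (κ + 1) * U ^ a := by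
            rw [pow_succ U, pow_succ w]
            calc w ^ κ * (U ^ a * U) ≤ w ^ κ * (U ^ a * w) := by gcongr
              _ = _ := by ring
          rw [hB₁]; gcongr
        gcongr
        linarith
    _ = _ := by
        rw [div_pow]
        field_simp
        ring

/-- The basic estimate for `S = ∑_{n ≤ w} n ^ (a + e) q (n / w) e ^ {i n u}`, written with
`u + 1 / w` in place of `u` so as to be uniform for `0 < u ≤ π`. -/
lemma exists_norm_nevSum_powExp_add_le (hm : IsKernelDensity k q m) {a : ℕ} (ha : a ≤ k) (e : ℕ) :
    ∃ C : ℝ, 0 ≤ C ∧ ∀ u ∈ Ioc 0 Real.pi, ∀ w : ℝ, 1 ≤ w →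
      ‖nevSum q (powExp (a + e) u) w‖ ≤
        C * w ^ (e + 1) * (u + w⁻¹)⁻¹ ^ a * tail m (w * u + 1)⁻¹ := by
  obtain ⟨C, hC, h⟩ := hm.exists_norm_nevSum_powExp_le (a + e)
  refine ⟨2 * C * 2 * 2 ^ a + 2 * 2 * 2 ^ a, by positivity, fun u hu w hw => ?_⟩
  have hu0 := hu.1
  have hw0 : 0 < w := by linarith
  set V := (u + w⁻¹)⁻¹ with hV
  have hV0 : 0 < V := by positivity
  have hwu0 : 0 < w * u := by positivity
  have hT0 : 0 ≤ tail m (w * u + 1)⁻¹ :=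
    hm.tail_nonneg (by positivity) (inv_le_one_of_one_le₀ (by linarith))
  set T := tail m (w * u + 1)⁻¹ with hT
  have hE : 0 ≤ w ^ (e + 1) * V ^ a * T := by positivity
  rcases le_or_gt 1 (w * u) with hwu | hwu
  · set U := u⁻¹ with hU
    have hU0 : 0 < U := inv_pos.2 hu0
    have hUw : U ≤ w := by rw [hU, inv_le_iff_one_le_mul₀ hu0]; exact hwu
    have hwi : w⁻¹ ≤ u := by rw [inv_le_iff_one_le_mul₀ hw0, mul_comm]; exact hwu
    have hUV : U ≤ 2 * V := by
      rw [hU, hV, ← div_eq_mul_inv, inv_le_comm₀ hu0 (by positivity), inv_div]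
      linarith
    have htail : tail m (w * u)⁻¹ ≤ 2 * T := by
      refine (hm.tail_le_two_mul_tail_half (by positivity) (inv_le_one_of_one_le₀ hwu)).trans ?_
      refine mul_le_mul_of_nonneg_left (hm.tail_mono (by positivity) ?_ ?_) two_pos.le
      · rw [div_eq_mul_inv, ← mul_inv]
        exact inv_anti₀ (by positivity) (by linarith)
      · exact inv_le_one_of_one_le₀ (by linarith)
    have hmain : w * U ^ (a + e) + w ^ (a + e + 1) * (U / w) ^ k ≤ 2 * (w ^ (e + 1) * U ^ a) := by
      have h1 : w * U ^ (a + e) ≤ w ^ (e + 1) * U ^ a :=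
        calc w * U ^ (a + e) = w * U ^ a * U ^ e := by ring
          _ ≤ w * U ^ a * w ^ e := by gcongr
          _ = _ := by ring
      have h2 : w ^ (a + e + 1) * (U / w) ^ k ≤ w ^ (e + 1) * U ^ a :=
        calc w ^ (a + e + 1) * (U / w) ^ k ≤ w ^ (a + e + 1) * (U / w) ^ a := by
              gcongr w ^ (a + e + 1) * ?_
              exact pow_le_pow_of_le_one (by positivity) ((div_le_one hw0).2 hUw) ha
          _ = _ := by rw [div_pow]; field_simp; ring
      linarith
    calc _ ≤ C * tail m (w * u)⁻¹ * (w * U ^ (a + e) + w ^ (a + e + 1) * (U / w) ^ k) :=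
          h u hu w hwu
      _ ≤ C * (2 * T) * (2 * (w ^ (e + 1) * (2 * V) ^ a)) := by
          gcongr
          exact hmain.trans (by gcongr)
      _ = 2 * C * 2 * 2 ^ a * (w ^ (e + 1) * V ^ a * T) := by rw [mul_pow]; ring
      _ ≤ (2 * C * 2 * 2 ^ a + 2 * 2 * 2 ^ a) * (w ^ (e + 1) * V ^ a * T) :=
          mul_le_mul_of_nonneg_right (le_add_of_nonneg_right (by positivity)) hE
      _ = _ := by ring
  · -- for `w u < 1` the trivial bound suffices
    have hVw : w ≤ 2 * V := by
      rw [hV, ← div_eq_mul_inv, le_div_iff₀ (by positivity), mul_add, mul_inv_cancel₀ hw0.ne']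
      linarith
    have hTlow : tail m 1 ≤ 2 * T := by
      refine (hm.tail_le_two_mul_tail_half one_pos le_rfl).trans ?_
      refine mul_le_mul_of_nonneg_left (hm.tail_mono (by norm_num) ?_ ?_) two_pos.le
      · rw [one_div]; exact inv_anti₀ (by positivity) (by linarith)
      · exact inv_le_one_of_one_le₀ (by linarith)
    have htriv : ‖nevSum q (powExp (a + e) u) w‖ ≤ (w + 1) * (w ^ (a + e) * tail m 1) := by
      have hcard : ((Finset.range (⌊w⌋₊ + 1)).card : ℝ) ≤ w + 1 := by
        rw [Finset.card_range]; push_cast; linarith [Nat.floor_le hw0.le]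
      have hnn : 0 ≤ w ^ (a + e) * tail m 1 := by have := hm.tail_one_pos; positivity
      refine le_trans ?_ (mul_le_mul_of_nonneg_right hcard hnn)
      rw [← nsmul_eq_mul]
      refine norm_sum_le_of_le _ (fun n hn => ?_) |>.trans (Finset.sum_const _).le
      have hnw : (n : ℝ) ≤ w :=
        (Nat.le_floor_iff hw0.le).1 (Nat.lt_succ_iff.1 (Finset.mem_range.1 hn))
      rw [powExp, norm_mul, norm_mul, norm_pow, norm_pow, mul_comm Complex.I,
        Complex.norm_exp_ofReal_mul_I, one_pow, mul_one, Complex.norm_natCast, Complex.norm_real]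
      gcongr
      exact hm.abs_le_tail_one ⟨by positivity, (div_le_one hw0).2 hnw⟩
    have ht1 := hm.tail_one_pos
    calc _ ≤ (w + 1) * (w ^ (a + e) * tail m 1) := htriv
      _ ≤ (w + w) * (w ^ (a + e) * (2 * T)) := by gcongr
      _ = 2 * 2 * (w ^ (e + 1) * w ^ a * T) := by ring
      _ ≤ 2 * 2 * (w ^ (e + 1) * (2 * V) ^ a * T) := by gcongr
      _ = 2 * 2 * 2 ^ a * (w ^ (e + 1) * V ^ a * T) := by rw [mul_pow]; ring
      _ ≤ (2 * C * 2 * 2 ^ a + 2 * 2 * 2 ^ a) * (w ^ (e + 1) * V ^ a * T) :=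
          mul_le_mul_of_nonneg_right (le_add_of_nonneg_left (by positivity)) hE
      _ = _ := by ring

end IsKernelDensity

/-! ### Fractional averages of the sums -/

lemma intervalIntegrable_sub_rpow {γ : ℝ} (hγ1 : γ < 1) (v d e : ℝ) :
    IntervalIntegrable (fun t => (t - v) ^ (-γ)) volume d e := by
  simpa using (intervalIntegral.intervalIntegrable_rpow' (a := d - v) (b := e - v)
      (show -1 < -γ by linarith)).comp_sub_right v

lemma integral_sub_rpow {γ : ℝ} (hγ1 : γ < 1) (v d : ℝ) :
    ∫ t in v..d, (t - v) ^ (-γ) = (d - v) ^ (1 - γ) / (1 - γ) := by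
  rw [intervalIntegral.integral_comp_sub_right (fun t => t ^ (-γ)), sub_self,
    integral_rpow (Or.inl (by linarith)), show -γ + 1 = 1 - γ by ring,
    Real.zero_rpow (by linarith), sub_zero]

lemma hasDerivAt_powExp (a n : ℕ) (t : ℝ) :
    HasDerivAt (fun t => powExp a t n) (Complex.I * powExp (a + 1) t n) t := by
  have e : ∀ b : ℕ, (fun t : ℝ => powExp b t n) =
      fun t : ℝ => (n : ℂ) ^ b * Complex.exp (n * (Complex.I * t)) := by
    intro b; ext t; rw [powExp, ← Complex.exp_nat_mul]
  have h : HasDerivAt (fun t : ℝ => Complex.exp (n * (Complex.I * t)))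
      (Complex.exp (n * (Complex.I * t)) * (n * (Complex.I * 1))) t :=
    (((Complex.ofRealCLM.hasDerivAt (x := t)).const_mul Complex.I).const_mul (n : ℂ)).cexp
  rw [e a, congrFun (e (a + 1)) t]
  refine (h.const_mul ((n : ℂ) ^ a)).congr_deriv ?_
  ring

lemma hasDerivAt_nevSum_powExp (q : ℝ → ℝ) (a : ℕ) (w t : ℝ) :
    HasDerivAt (fun t => nevSum q (powExp a t) w)
      (Complex.I * nevSum q (powExp (a + 1) t) w) t := by
  unfold nevSum
  rw [Finset.mul_sum]
  refine (HasDerivAt.fun_sum fun n _ => (hasDerivAt_powExp a n t).mul_const _).congr_deriv ?_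
  exact Finset.sum_congr rfl fun n _ => by ring

lemma continuous_nevSum_powExp (q : ℝ → ℝ) (a : ℕ) (w : ℝ) :
    Continuous fun t => nevSum q (powExp a t) w :=
  continuous_iff_continuousAt.2 fun t => (hasDerivAt_nevSum_powExp q a w t).continuousAt

namespace IsKernelDensity

variable {k : ℕ} {q m : ℝ → ℝ}

lemma tail_inv_anti (hm : IsKernelDensity k q m) {x y : ℝ} (hx : 1 ≤ x) (hxy : x ≤ y) :
    tail m y⁻¹ ≤ tail m x⁻¹ :=
  hm.tail_mono (inv_nonneg.2 (by linarith)) (inv_anti₀ (by linarith) hxy) (inv_le_one_of_one_le₀ hx)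

lemma tail_inv_nonneg (hm : IsKernelDensity k q m) {x : ℝ} (hx : 1 ≤ x) : 0 ≤ tail m x⁻¹ :=
  hm.tail_nonneg (by positivity) (inv_le_one_of_one_le₀ hx)

/-- Unweighted integrals of the sums away from `0`. Since `i` times the sum with exponent `a + 1` is
the derivative of the sum with exponent `a`, integration by parts lowers the exponents `b` and
`b + p + 1` together. -/
lemma exists_norm_integral_pow_mul_nevSum_le (hm : IsKernelDensity k q m) (p b : ℕ)
    (hbp : b + p ≤ k) : ∃ C : ℝ, 0 ≤ C ∧ ∀ w c d : ℝ, 1 ≤ w → 0 < c → c ≤ d → d ≤ Real.pi →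
      ‖∫ t in c..d, (t : ℂ) ^ b * nevSum q (powExp (b + p + 1) t) w‖ ≤
        C * (w * c⁻¹ ^ p * tail m (w * c + 1)⁻¹) := by
  -- a bound for the boundary terms at both end points
  have hbd : ∀ b : ℕ, b + p ≤ k → ∃ C : ℝ, 0 ≤ C ∧ ∀ w c t : ℝ, 1 ≤ w → 0 < c → c ≤ t →
      t ≤ Real.pi → ‖(t : ℂ) ^ b * nevSum q (powExp (b + p) t) w‖ ≤
        C * (w * c⁻¹ ^ p * tail m (w * c + 1)⁻¹) := by
    intro b hb
    obtain ⟨C, hC, h⟩ := hm.exists_norm_nevSum_powExp_add_le hb 0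
    refine ⟨C, hC, fun w c t hw hc hct htπ => ?_⟩
    have ht : 0 < t := hc.trans_le hct
    have h' := h t ⟨ht, htπ⟩ w hw
    rw [norm_mul, norm_pow, Complex.norm_real, Real.norm_eq_abs, abs_of_pos ht]
    simp only [add_zero, zero_add, pow_one] at h'
    have h1 : (t + w⁻¹)⁻¹ ≤ t⁻¹ := inv_anti₀ ht (by linarith [inv_pos.2 (by linarith : 0 < w)])
    have h2 : tail m (w * t + 1)⁻¹ ≤ tail m (w * c + 1)⁻¹ :=
      hm.tail_inv_anti (by nlinarith) (by nlinarith)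
    have h3 := hm.tail_inv_nonneg (x := w * t + 1) (by nlinarith)
    have h4 : t⁻¹ ≤ c⁻¹ := inv_anti₀ hc hct
    have h5 : 0 ≤ (t + w⁻¹)⁻¹ := by positivity
    calc t ^ b * ‖nevSum q (powExp (b + p) t) w‖
        ≤ t ^ b * (C * w * (t⁻¹) ^ (b + p) * tail m (w * c + 1)⁻¹) := by
          gcongr
          exact h'.trans (by gcongr)
      _ = C * (w * (t⁻¹) ^ p * tail m (w * c + 1)⁻¹) := by
          rw [pow_add, inv_pow t b]; field_simp
      _ ≤ _ := by
          have := h3.trans h2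
          gcongr
  induction b with
  | zero =>
    obtain ⟨C, hC, h⟩ := hbd 0 hbp
    refine ⟨2 * C, by positivity, fun w c d hw hc hcd hd => ?_⟩
    have hFTC : ∫ t in c..d, Complex.I * nevSum q (powExp (0 + p + 1) t) w =
        nevSum q (powExp (0 + p) d) w - nevSum q (powExp (0 + p) c) w :=
      intervalIntegral.integral_eq_sub_of_hasDerivAt
        (fun t _ => hasDerivAt_nevSum_powExp q (0 + p) w t)
        ((continuous_const.mul (continuous_nevSum_powExp q _ w)).intervalIntegrable _ _)
    rw [intervalIntegral.integral_const_mul] at hFTC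
    simp only [pow_zero, one_mul]
    have hn := congrArg norm hFTC
    rw [norm_mul, Complex.norm_I, one_mul] at hn
    rw [hn]
    have h1 := h w c d hw hc hcd hd
    have h2 := h w c c hw hc le_rfl (hcd.trans hd)
    simp only [pow_zero, one_mul] at h1 h2
    exact (norm_sub_le _ _).trans (by linarith)
  | succ b ih =>
    obtain ⟨C₁, hC₁, h₁⟩ := ih (by omega)
    obtain ⟨C₂, hC₂, h₂⟩ := hbd (b + 1) hbp
    refine ⟨2 * C₂ + (b + 1) * C₁, by positivity, fun w c d hw hc hcd hd => ?_⟩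
    have hd1 : ∀ t : ℝ,
        HasDerivAt (fun t : ℝ => (t : ℂ) ^ (b + 1)) ((b + 1 : ℂ) * (t : ℂ) ^ b) t := by
      intro t
      refine ((Complex.ofRealCLM.hasDerivAt (x := t)).pow (b + 1)).congr_deriv ?_
      simp
    have hIBP := intervalIntegral.integral_mul_deriv_eq_deriv_mul (a := c) (b := d)
      (fun t _ => hd1 t) (fun t _ => hasDerivAt_nevSum_powExp q (b + 1 + p) w t)
      ((by fun_prop : Continuous fun t : ℝ => (b + 1 : ℂ) * (t : ℂ) ^ b).intervalIntegrable _ _)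
      ((continuous_const.mul (continuous_nevSum_powExp q _ w)).intervalIntegrable _ _)
    have e1 : ∀ t : ℝ, (t : ℂ) ^ (b + 1) * (Complex.I * nevSum q (powExp (b + 1 + p + 1) t) w) =
        Complex.I * ((t : ℂ) ^ (b + 1) * nevSum q (powExp (b + 1 + p + 1) t) w) :=
      fun t => by ring
    have e2 : ∀ t : ℝ, (b + 1 : ℂ) * (t : ℂ) ^ b * nevSum q (powExp (b + 1 + p) t) w =
        (b + 1 : ℂ) * ((t : ℂ) ^ b * nevSum q (powExp (b + p + 1) t) w) := by
      intro t; rw [show b + 1 + p = b + p + 1 by ring]; ring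
    simp only [e1, e2, intervalIntegral.integral_const_mul] at hIBP
    have hn := congrArg norm hIBP
    rw [norm_mul, Complex.norm_I, one_mul] at hn
    rw [hn]
    have h1 := h₁ w c d hw hc hcd hd
    have hbn : ‖((b : ℂ) + 1)‖ = b + 1 := by
      rw [← Nat.cast_succ, Complex.norm_natCast]; push_cast; ring
    refine (norm_sub_le _ _).trans ((add_le_add ((norm_sub_le _ _).trans (add_le_add
      (h₂ w c d hw hc hcd hd) (h₂ w c c hw hc le_rfl (hcd.trans hd)))) ?_).trans
      (le_of_eq ?_) (b := C₂ * (w * c⁻¹ ^ p * tail m (w * c + 1)⁻¹) +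
        C₂ * (w * c⁻¹ ^ p * tail m (w * c + 1)⁻¹) +
        (b + 1) * (C₁ * (w * c⁻¹ ^ p * tail m (w * c + 1)⁻¹))))
    · rw [norm_mul, hbn]
      gcongr
    · ring

/-- The Nevanlinna sums of `fracCoeff γ p b v`, that is, of the transform of a point mass at `v`.
The integral is split at `v + 1 / w`, the scale on which the sums oscillate. -/
lemma exists_norm_integral_rpow_mul_nevSum_le (hm : IsKernelDensity k q m) (p b : ℕ)
    (hbp : b + p ≤ k) {γ : ℝ} (hγ0 : 0 ≤ γ) (hγ1 : γ < 1) :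
    ∃ C : ℝ, 0 ≤ C ∧ ∀ v ∈ Ioo 0 Real.pi, ∀ w : ℝ, 1 ≤ w →
      ‖∫ t in v..Real.pi, ((t - v) ^ (-γ) : ℝ) *
        ((t : ℂ) ^ b * nevSum q (powExp (b + p + 1) t) w)‖ ≤
        C * (w * w ^ γ * (v + w⁻¹)⁻¹ ^ p * tail m (w * v + 1)⁻¹) := by
  obtain ⟨C₁, hC₁, h₁⟩ := hm.exists_norm_nevSum_powExp_add_le hbp 1
  obtain ⟨C₂, hC₂, h₂⟩ := hm.exists_norm_integral_pow_mul_nevSum_le p b hbp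
  have hγ' : 0 < 1 - γ := by linarith
  refine ⟨C₁ / (1 - γ) + C₂, by positivity, fun v hv w hw => ?_⟩
  have hv0 := hv.1
  have hw0 : 0 < w := by linarith
  have hwi : 0 < w⁻¹ := inv_pos.2 hw0
  set c := v + w⁻¹ with hc
  have hc0 : 0 < c := by positivity
  have hwc : w * c = w * v + 1 := by rw [hc, mul_add, mul_inv_cancel₀ hw0.ne']
  set T := tail m (w * v + 1)⁻¹ with hT
  have hwv : 0 < w * v := by positivity
  have hT0 : 0 ≤ T := hm.tail_inv_nonneg (by linarith)
  have hwγ : 0 < w ^ γ := Real.rpow_pos_of_pos hw0 _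
  set g : ℝ → ℂ := fun t => (t : ℂ) ^ b * nevSum q (powExp (b + p + 1) t) w with hg
  have hgc : Continuous g := by
    have := continuous_nevSum_powExp q (b + p + 1) w
    fun_prop
  have hφg : ∀ d e : ℝ,
      IntervalIntegrable (fun t => (((t - v) ^ (-γ) : ℝ) : ℂ) * g t) volume d e := by
    intro d e
    have := intervalIntegrable_sub_rpow hγ1 v d e
    exact IntervalIntegrable.mul_continuousOn ⟨this.1.ofReal, this.2.ofReal⟩ hgc.continuousOn
  -- near `v` the kernel is integrable and `g` is bounded
  have hnear : ∀ d : ℝ, v ≤ d → d ≤ c → d ≤ Real.pi →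
      ‖∫ t in v..d, (((t - v) ^ (-γ) : ℝ) : ℂ) * g t‖ ≤
        C₁ / (1 - γ) * (w * w ^ γ * c⁻¹ ^ p * T) := by
    intro d hvd hdc hdπ
    have hgB : ∀ t ∈ Ioc v d, ‖g t‖ ≤ C₁ * (w ^ 2 * c⁻¹ ^ p * T) := by
      intro t ht
      have ht0 : 0 < t := hv0.trans ht.1
      have h' := h₁ t ⟨ht0, ht.2.trans hdπ⟩ w hw
      have a1 : (t + w⁻¹)⁻¹ ≤ c⁻¹ := inv_anti₀ hc0 (by rw [hc]; linarith [ht.1])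
      have a2 : tail m (w * t + 1)⁻¹ ≤ T :=
        hm.tail_inv_anti (by linarith) (by nlinarith [ht.1])
      have a3 := hm.tail_inv_nonneg (x := w * t + 1) (by nlinarith)
      have a4 : t ≤ c := ht.2.trans hdc
      rw [hg]
      simp only
      rw [norm_mul, norm_pow, Complex.norm_real, Real.norm_eq_abs, abs_of_pos ht0]
      calc t ^ b * ‖nevSum q (powExp (b + p + 1) t) w‖
          ≤ c ^ b * (C₁ * w ^ 2 * (c⁻¹) ^ (b + p) * T) := by
            gcongr
            exact h'.trans (by
              have : 0 ≤ (t + w⁻¹)⁻¹ := by positivity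
              gcongr)
        _ = _ := by rw [pow_add, inv_pow c b]; field_simp
    have hle : (d - v) ^ (1 - γ) ≤ w⁻¹ * w ^ γ := by
      calc (d - v) ^ (1 - γ) ≤ (w⁻¹) ^ (1 - γ) :=
            Real.rpow_le_rpow (by linarith) (by linarith) hγ'.le
        _ = _ := by
            rw [Real.rpow_sub hwi, Real.rpow_one, Real.inv_rpow hw0.le, div_inv_eq_mul]
    have hb := intervalIntegral.norm_integral_le_of_norm_le (μ := volume) hvd
      (f := fun t => (((t - v) ^ (-γ) : ℝ) : ℂ) * g t)
      (g := fun t => (t - v) ^ (-γ) * (C₁ * (w ^ 2 * c⁻¹ ^ p * T)))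
      (ae_of_all _ fun t ht => by
        have h0 : 0 ≤ (t - v) ^ (-γ) := Real.rpow_nonneg (by linarith [ht.1]) _
        rw [norm_mul, Complex.norm_real, Real.norm_eq_abs, abs_of_nonneg h0]
        exact mul_le_mul_of_nonneg_left (hgB t ht) h0)
      ((intervalIntegrable_sub_rpow hγ1 v v d).mul_const _)
    rw [intervalIntegral.integral_mul_const, integral_sub_rpow hγ1] at hb
    refine hb.trans ?_
    calc _ ≤ (w⁻¹ * w ^ γ) / (1 - γ) * (C₁ * (w ^ 2 * c⁻¹ ^ p * T)) := by gcongr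
      _ = _ := by field_simp
  rcases le_or_gt Real.pi c with hcπ | hcπ
  · refine (hnear Real.pi hv.2.le hcπ le_rfl).trans ?_
    have : 0 ≤ w * w ^ γ * c⁻¹ ^ p * T := by positivity
    exact mul_le_mul_of_nonneg_right (by linarith) this
  · have hvc : v ≤ c := by linarith
    -- away from `v` the kernel decreases from `w ^ γ`
    have hfar : ‖∫ t in c..Real.pi, (((t - v) ^ (-γ) : ℝ) : ℂ) * g t‖ ≤
        w ^ γ * (C₂ * (w * c⁻¹ ^ p * T)) := by
      have hpos : ∀ t ∈ Icc c Real.pi, 0 < t - v := fun t ht => by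
        have := ht.1; rw [hc] at this; linarith
      have hanti : AntitoneOn (fun t => (t - v) ^ (-γ)) (Icc c Real.pi) := fun s hs t ht hst =>
        Real.rpow_le_rpow_of_nonpos (hpos s hs) (by linarith) (by linarith)
      refine norm_integral_antitoneOn_mul_le hcπ.le hanti
        (fun t ht => Real.rpow_nonneg (hpos t ht).le _) (fun t ht => ?_)
        (hgc.intervalIntegrable _ _) fun d hd => ?_
      · refine (hanti ⟨le_rfl, hcπ.le⟩ ht ht.1).trans (le_of_eq ?_)
        simp only
        rw [hc, add_sub_cancel_left, Real.inv_rpow hw0.le, Real.rpow_neg hw0.le, inv_inv]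
      · refine (h₂ w c d hw hc0 hd.1 hd.2).trans ?_
        have : tail m (w * c + 1)⁻¹ ≤ T := hm.tail_inv_anti (by linarith) (by linarith)
        gcongr
    rw [← intervalIntegral.integral_add_adjacent_intervals (hφg v c)
      (hφg c Real.pi)]
    refine (norm_add_le _ _).trans ((add_le_add (hnear c hvc le_rfl hcπ.le) hfar).trans
      (le_of_eq ?_))
    ring

end IsKernelDensity

/-- The majorant, after division by `w ^ 2`, of the Nevanlinna sums of the transform of a point mass
at `v`. -/
noncomputable def majorant (m : ℝ → ℝ) (γ : ℝ) (p : ℕ) (v w : ℝ) : ℝ :=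
  w ^ (γ - 1) * (v + w⁻¹)⁻¹ ^ p * tail m (w * v + 1)⁻¹

/-- Homogeneity: up to a power of `v` the majorant depends on the product `v * w` only. -/
lemma majorant_scale (m : ℝ → ℝ) (γ : ℝ) (p : ℕ) {v w : ℝ} (hv : 0 < v) (hw : 0 < w) :
    majorant m γ p v w = v ^ (1 - γ - p) * majorant m γ p 1 (v * w) := by
  unfold majorant
  have h1 : (v + w⁻¹)⁻¹ = v⁻¹ * (1 + (v * w)⁻¹)⁻¹ := by
    rw [← mul_inv, mul_add, mul_one, mul_inv, ← mul_assoc, mul_inv_cancel₀ hv.ne', one_mul]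
  have h2 : v ^ (1 - γ - p) * (v * w) ^ (γ - 1) = w ^ (γ - 1) * v⁻¹ ^ p := by
    rw [Real.mul_rpow hv.le hw.le, ← mul_assoc, ← Real.rpow_add hv,
      show 1 - γ - p + (γ - 1) = -(p : ℝ) by ring, Real.rpow_neg hv.le, Real.rpow_natCast, inv_pow]
    ring
  rw [h1, mul_pow, mul_comm w v, mul_one, ← mul_assoc, ← mul_assoc (v ^ (1 - γ - p)),
    ← mul_assoc (v ^ (1 - γ - p)), h2]

lemma IsKernelDensity.majorant_nonneg {k : ℕ} {q m : ℝ → ℝ} (hm : IsKernelDensity k q m)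
    (γ : ℝ) (p : ℕ) {v w : ℝ} (hv : 0 < v) (hw : 0 < w) : 0 ≤ majorant m γ p v w := by
  have := hm.tail_inv_nonneg (x := w * v + 1) (by nlinarith [mul_pos hw hv])
  unfold majorant
  positivity

lemma IsKernelDensity.continuousOn_majorant {k : ℕ} {q m : ℝ → ℝ} (hm : IsKernelDensity k q m)
    (γ : ℝ) (p : ℕ) :
    ContinuousOn (fun z : ℝ × ℝ => majorant m γ p z.1 z.2) (Ioi 0 ×ˢ Ioi 0) := by
  unfold majorant
  have hne : ∀ z ∈ (Ioi (0 : ℝ) ×ˢ Ioi (0 : ℝ)), z.2 ≠ 0 := fun z hz => (ne_of_gt hz.2)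
  refine (ContinuousOn.mul ?_ (ContinuousOn.pow (ContinuousOn.inv₀ ?_ ?_) _)).mul ?_
  · exact ContinuousOn.rpow_const (by fun_prop) fun z hz => Or.inl (hne z hz)
  · exact continuousOn_fst.add (continuousOn_snd.inv₀ hne)
  · intro z hz
    have h1 : 0 < z.1 := hz.1
    have h2 : 0 < z.2 := hz.2
    positivity
  · refine hm.continuousOn_tail.comp (ContinuousOn.inv₀ (by fun_prop) ?_) ?_
    · intro z hz
      have h1 : 0 < z.1 := hz.1
      have h2 : 0 < z.2 := hz.2
      positivity
    · intro z hz
      have h1 : 0 < z.1 := hz.1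
      have h2 : 0 < z.2 := hz.2
      have h3 : 0 < z.2 * z.1 := mul_pos h2 h1
      exact ⟨by positivity, inv_le_one_of_one_le₀ (by linarith)⟩

/-- Near `0` the majorant at `v = 1` behaves like `w ^ (p + γ - 1)`. Near infinity the substitution
`s = 1 / w` turns its integral into that of `tail m s / s ^ (1 + γ)`. -/
lemma IsKernelDensity.integrableOn_majorant_one {k : ℕ} {q m : ℝ → ℝ}
    (hm : IsKernelDensity k q m) {γ : ℝ} {p : ℕ} (hpγ : 0 < p + γ)
    (hg : IntegrableOn (fun s => tail m s / s ^ (1 + γ)) (Ioc 0 1)) :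
    IntegrableOn (majorant m γ p 1) (Ioi 0) := by
  have hcont : ContinuousOn (majorant m γ p 1) (Ioi 0) :=
    (hm.continuousOn_majorant γ p).comp (f := fun w : ℝ => ((1 : ℝ), w)) (by fun_prop)
      fun w hw => ⟨by simp, hw⟩
  rw [← Ioc_union_Ioi_eq_Ioi (zero_le_one' ℝ)]
  refine IntegrableOn.union ?_ ?_
  · have h1 : IntegrableOn (fun w : ℝ => tail m 1 * w ^ (γ + p - 1)) (Ioc 0 1) :=
      ((intervalIntegral.intervalIntegrable_rpow' (a := 0) (b := 1) (by linarith)).1).const_mul _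
    refine Integrable.mono' h1
      ((hcont.mono Ioc_subset_Ioi_self).aestronglyMeasurable measurableSet_Ioc) ?_
    refine (ae_restrict_iff' measurableSet_Ioc).2 (ae_of_all _ fun w hw => ?_)
    have hw0 := hw.1
    rw [Real.norm_eq_abs, abs_of_nonneg (hm.majorant_nonneg γ p one_pos hw0)]
    unfold majorant
    have e1 : (1 + w⁻¹)⁻¹ ≤ w := by
      rw [inv_le_comm₀ (by positivity) hw0]; linarith
    have e2 : tail m (w * 1 + 1)⁻¹ ≤ tail m 1 := by
      have := hm.tail_inv_anti (x := 1) (y := w * 1 + 1) le_rfl (by linarith)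
      simpa using this
    have e3 := hm.tail_inv_nonneg (x := w * 1 + 1) (by linarith)
    calc _ ≤ w ^ (γ - 1) * w ^ p * tail m 1 := by gcongr
      _ = _ := by
        rw [← Real.rpow_natCast w p, ← Real.rpow_add hw0, mul_comm]
        congr 2; ring
  · set f : ℝ → ℝ := (Ioc (0 : ℝ) 1).indicator (fun s => tail m s / s ^ (1 + γ)) with hf
    have hfi : IntegrableOn f (Ioi 0) :=
      ((integrable_indicator_iff measurableSet_Ioc).2 hg).integrableOn
    have h1 := ((integrableOn_Ioi_comp_rpow_iff f (p := -1) (by norm_num)).2 hfi).mono_set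
      (Ioi_subset_Ioi (zero_le_one' ℝ))
    refine Integrable.mono' h1
      ((hcont.mono (Ioi_subset_Ioi zero_le_one)).aestronglyMeasurable measurableSet_Ioi) ?_
    refine (ae_restrict_iff' measurableSet_Ioi).2 (ae_of_all _ fun w hw => ?_)
    have hw1 : 1 < w := hw
    have hw0 : 0 < w := by linarith
    rw [Real.norm_eq_abs, abs_of_nonneg (hm.majorant_nonneg γ p one_pos hw0)]
    have hmem : w ^ (-1 : ℝ) ∈ Ioc (0 : ℝ) 1 := by
      rw [Real.rpow_neg_one]; exact ⟨inv_pos.2 hw0, inv_le_one_of_one_le₀ hw1.le⟩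
    rw [hf, indicator_of_mem hmem]
    unfold majorant
    have e1 : (1 + w⁻¹)⁻¹ ^ p ≤ 1 :=
      pow_le_one₀ (by positivity) (inv_le_one_of_one_le₀ (by linarith [inv_pos.2 hw0]))
    have e2 : tail m (w * 1 + 1)⁻¹ ≤ tail m w⁻¹ := hm.tail_inv_anti hw1.le (by linarith)
    have e3 := hm.tail_inv_nonneg (x := w * 1 + 1) (by linarith)
    calc _ ≤ w ^ (γ - 1) * 1 * tail m w⁻¹ := by gcongr
      _ = _ := by
        rw [abs_neg, abs_one, one_mul, Real.rpow_neg_one, smul_eq_mul, Real.inv_rpow hw0.le,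
          div_inv_eq_mul, mul_one, mul_comm (tail m w⁻¹), ← mul_assoc, ← Real.rpow_add hw0]
        congr 2; ring

/-- The scaling law: the majorant at `v` has integral at most a constant times `v ^ (-(p + γ))`. -/
lemma IsKernelDensity.exists_lintegral_majorant_le {k : ℕ} {q m : ℝ → ℝ}
    (hm : IsKernelDensity k q m) {γ : ℝ} {p : ℕ} (hpγ : 0 < p + γ)
    (hg : IntegrableOn (fun s => tail m s / s ^ (1 + γ)) (Ioc 0 1)) :
    ∃ K : ℝ, 0 ≤ K ∧ ∀ v : ℝ, 0 < v →
      ∫⁻ w in Ioi 1, ENNReal.ofReal (majorant m γ p v w) ≤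
        ENNReal.ofReal (K * v ^ (-(p + γ))) := by
  have h1 := hm.integrableOn_majorant_one hpγ hg
  refine ⟨∫ w in Ioi 0, majorant m γ p 1 w, setIntegral_nonneg measurableSet_Ioi fun w hw =>
    hm.majorant_nonneg γ p one_pos hw, fun v hv => ?_⟩
  have h2 : IntegrableOn (fun w => majorant m γ p 1 (v * w)) (Ioi 0) :=
    (integrableOn_Ioi_comp_mul_left_iff _ 0 hv).2 (by rwa [mul_zero])
  have hint : IntegrableOn (fun w => v ^ (1 - γ - p) * majorant m γ p 1 (v * w)) (Ioi 0) :=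
    Integrable.const_mul h2 _
  calc ∫⁻ w in Ioi 1, ENNReal.ofReal (majorant m γ p v w)
      ≤ ∫⁻ w in Ioi 0, ENNReal.ofReal (majorant m γ p v w) :=
        lintegral_mono_set (Ioi_subset_Ioi zero_le_one)
    _ = ∫⁻ w in Ioi 0, ENNReal.ofReal (v ^ (1 - γ - p) * majorant m γ p 1 (v * w)) :=
        setLIntegral_congr_fun measurableSet_Ioi fun w hw => by
          simp only [majorant_scale m γ p hv hw]
    _ = ENNReal.ofReal (∫ w in Ioi 0, v ^ (1 - γ - p) * majorant m γ p 1 (v * w)) := by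
        rw [ofReal_integral_eq_lintegral_ofReal hint]
        exact (ae_restrict_iff' measurableSet_Ioi).2 (ae_of_all _ fun w hw =>
          mul_nonneg (Real.rpow_nonneg hv.le _)
            (hm.majorant_nonneg γ p one_pos (mul_pos hv hw)))
    _ ≤ _ := by
        refine ENNReal.ofReal_le_ofReal (le_of_eq ?_)
        rw [integral_const_mul, integral_comp_mul_left_Ioi _ _ hv, mul_zero, smul_eq_mul,
          ← mul_assoc, ← Real.rpow_neg_one v, ← Real.rpow_add hv, mul_comm]
        congr 2; ring

/-! ### Absolutely summable sequences -/

/-- The condition `∫_1^∞ w^{-2} |∑_{n ≤ w} c n q (n / w)| dw < ∞`. For `c n = n * u n` this is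
the absolute summability of `∑ u n`. -/
def NevIntegrable (q : ℝ → ℝ) (c : ℕ → ℂ) : Prop :=
  IntegrableOn (fun w : ℝ => nevSum q c w / (w : ℂ) ^ 2) (Ioi 1)

lemma NevIntegrable.const_mul {q : ℝ → ℝ} {c : ℕ → ℂ} (hc : NevIntegrable q c) (a : ℂ) :
    NevIntegrable q (fun n => a * c n) := by
  unfold NevIntegrable
  have h : ∀ w : ℝ, nevSum q (fun n => a * c n) w / (w : ℂ) ^ 2 =
      a * (nevSum q c w / (w : ℂ) ^ 2) := by
    intro w
    unfold nevSum
    rw [mul_div_assoc', Finset.mul_sum]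
    simp only [mul_assoc]
  simp only [h]
  exact Integrable.const_mul hc a

lemma NevIntegrable.add {q : ℝ → ℝ} {c d : ℕ → ℂ} (hc : NevIntegrable q c)
    (hd : NevIntegrable q d) : NevIntegrable q (fun n => c n + d n) := by
  unfold NevIntegrable
  have h : ∀ w : ℝ, nevSum q (fun n => c n + d n) w / (w : ℂ) ^ 2 =
      nevSum q c w / (w : ℂ) ^ 2 + nevSum q d w / (w : ℂ) ^ 2 := by
    intro w
    unfold nevSum
    rw [← add_div, ← Finset.sum_add_distrib]
    simp only [add_mul]
  simp only [h]
  exact Integrable.add hc hd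

lemma NevIntegrable.zero {q : ℝ → ℝ} : NevIntegrable q (fun _ => 0) := by
  unfold NevIntegrable nevSum
  simp

lemma NevIntegrable.sum {q : ℝ → ℝ} {ι : Type*} (s : Finset ι) {c : ι → ℕ → ℂ}
    (hc : ∀ i ∈ s, NevIntegrable q (c i)) : NevIntegrable q (fun n => ∑ i ∈ s, c i n) := by
  classical
  induction s using Finset.induction_on with
  | empty => simpa using NevIntegrable.zero
  | insert i s hi ih =>
    simp only [Finset.sum_insert hi]
    exact (hc i (Finset.mem_insert_self i s)).add
      (ih fun j hj => hc j (Finset.mem_insert_of_mem hj))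

lemma aestronglyMeasurable_nevSum {q : ℝ → ℝ} (hq : ContinuousOn q (Icc 0 1)) (c : ℕ → ℂ) :
    AEStronglyMeasurable (fun w : ℝ => nevSum q c w / (w : ℂ) ^ 2) (volume.restrict (Ioi 1)) := by
  have hcover : Ioi (1 : ℝ) ⊆ ⋃ N : ℕ, Ico (N : ℝ) (N + 1) ∩ Ioi 0 := by
    intro w hw
    have hw0 : (0 : ℝ) < w := zero_lt_one.trans hw
    exact mem_iUnion.2 ⟨⌊w⌋₊, ⟨Nat.floor_le hw0.le, Nat.lt_floor_add_one w⟩, hw0⟩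
  refine AEStronglyMeasurable.mono_measure ?_ (Measure.restrict_mono hcover le_rfl)
  refine aestronglyMeasurable_iUnion_iff.2 fun N => ?_
  have hfix : ∀ w ∈ Ico (N : ℝ) (N + 1) ∩ Ioi 0, nevSum q c w / (w : ℂ) ^ 2 =
      (∑ n ∈ Finset.range (N + 1), c n * (q (n / w) : ℂ)) / (w : ℂ) ^ 2 := by
    intro w hw
    have : ⌊w⌋₊ = N := (Nat.floor_eq_iff hw.2.le).2 ⟨hw.1.1, hw.1.2⟩
    rw [nevSum, this]
  have hmeas : MeasurableSet (Ico (N : ℝ) (N + 1) ∩ Ioi 0) :=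
    measurableSet_Ico.inter measurableSet_Ioi
  refine AEStronglyMeasurable.congr ?_ ((ae_restrict_iff' hmeas).2 (ae_of_all _ fun w hw =>
    (hfix w hw).symm))
  refine ContinuousOn.aestronglyMeasurable (ContinuousOn.div ?_ (by fun_prop) ?_) hmeas
  · refine continuousOn_finsetSum _ fun n hn => ContinuousOn.mul continuousOn_const ?_
    refine Complex.continuous_ofReal.comp_continuousOn (hq.comp (ContinuousOn.div (by fun_prop)
      (by fun_prop) fun w hw => (ne_of_gt hw.2)) fun w hw => ?_)
    have hw0 : 0 < w := hw.2
    have hn' : (n : ℝ) ≤ N := by exact_mod_cast Nat.lt_succ_iff.1 (Finset.mem_range.1 hn)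
    exact ⟨by positivity, (div_le_one hw0).2 (hn'.trans hw.1.1)⟩
  · intro w hw
    have hw0 : 0 < w := hw.2
    exact pow_ne_zero _ (by exact_mod_cast hw0.ne')

lemma enorm_div_sq_le_of_norm_le {z : ℂ} {w B : ℝ} (hw : 0 < w) (h : ‖z‖ ≤ w ^ 2 * B) :
    ‖z / (w : ℂ) ^ 2‖ₑ ≤ ENNReal.ofReal B := by
  rw [← ofReal_norm]
  refine ENNReal.ofReal_le_ofReal ?_
  rw [norm_div, norm_pow, Complex.norm_real, Real.norm_eq_abs, abs_of_pos hw,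
    div_le_iff₀ (by positivity), mul_comm]
  exact h

lemma sq_mul_majorant (m : ℝ → ℝ) (γ : ℝ) (p : ℕ) (v : ℝ) {w : ℝ} (hw : 0 < w) :
    w ^ 2 * majorant m γ p v w = w * w ^ γ * (v + w⁻¹)⁻¹ ^ p * tail m (w * v + 1)⁻¹ := by
  rw [majorant, Real.rpow_sub_one hw.ne']
  field_simp

/-- The Fourier integral over `(v, π)` of `t ^ b (t - v) ^ (-γ)`, with the weight
`n ^ (b + p + 1)`. -/
noncomputable def fracCoeff (γ : ℝ) (p b : ℕ) (v : ℝ) (n : ℕ) : ℂ :=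
  ∫ t in v..Real.pi, ((t - v) ^ (-γ) : ℝ) * ((t : ℂ) ^ b * powExp (b + p + 1) t n)

lemma continuous_powExp (a n : ℕ) : Continuous fun t => powExp a t n :=
  continuous_iff_continuousAt.2 fun t => (hasDerivAt_powExp a n t).continuousAt

lemma norm_powExp (a n : ℕ) (t : ℝ) : ‖powExp a t n‖ = (n : ℝ) ^ a := by
  rw [powExp, norm_mul, norm_pow, norm_pow, mul_comm Complex.I, Complex.norm_exp_ofReal_mul_I,
    one_pow, mul_one, Complex.norm_natCast]

lemma nevSum_fracCoeff (q : ℝ → ℝ) {γ : ℝ} (hγ1 : γ < 1) (p b : ℕ) (v w : ℝ) :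
    nevSum q (fracCoeff γ p b v) w = ∫ t in v..Real.pi, ((t - v) ^ (-γ) : ℝ) *
        ((t : ℂ) ^ b * nevSum q (powExp (b + p + 1) t) w) := by
  have hi : ∀ n : ℕ, IntervalIntegrable (fun t : ℝ => (((t - v) ^ (-γ) : ℝ) : ℂ) *
      ((t : ℂ) ^ b * powExp (b + p + 1) t n) * (q (n / w) : ℂ)) volume v Real.pi := by
    intro n
    have h := intervalIntegrable_sub_rpow hγ1 v v Real.pi
    have hc := continuous_powExp (b + p + 1) n
    exact (IntervalIntegrable.mul_continuousOn ⟨h.1.ofReal, h.2.ofReal⟩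
      (by fun_prop : Continuous fun t : ℝ =>
        (t : ℂ) ^ b * powExp (b + p + 1) t n).continuousOn).mul_const _
  have e : ∀ t : ℝ, (((t - v) ^ (-γ) : ℝ) : ℂ) *
        ((t : ℂ) ^ b * nevSum q (powExp (b + p + 1) t) w) =
      ∑ n ∈ Finset.range (⌊w⌋₊ + 1), (((t - v) ^ (-γ) : ℝ) : ℂ) *
      ((t : ℂ) ^ b * powExp (b + p + 1) t n) * (q (n / w) : ℂ) := by
    intro t
    rw [nevSum, Finset.mul_sum, Finset.mul_sum]
    exact Finset.sum_congr rfl fun n _ => by ring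
  simp only [e]
  rw [intervalIntegral.integral_finsetSum fun n _ => hi n, nevSum]
  exact Finset.sum_congr rfl fun n _ => (intervalIntegral.integral_mul_const _ _).symm

lemma norm_fracCoeff_le {γ : ℝ} (hγ1 : γ < 1) (p b n : ℕ) {v : ℝ} (hv : v ∈ Ioo 0 Real.pi) :
    ‖fracCoeff γ p b v n‖ ≤
      Real.pi ^ (1 - γ) / (1 - γ) * (Real.pi ^ b * (n : ℝ) ^ (b + p + 1)) := by
  have hb := intervalIntegral.norm_integral_le_of_norm_le (μ := volume) hv.2.le
    (f := fun t : ℝ => (((t - v) ^ (-γ) : ℝ) : ℂ) * ((t : ℂ) ^ b * powExp (b + p + 1) t n))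
    (g := fun t => (t - v) ^ (-γ) * (Real.pi ^ b * (n : ℝ) ^ (b + p + 1)))
    (ae_of_all _ fun t ht => by
      have h0 : 0 ≤ (t - v) ^ (-γ) := Real.rpow_nonneg (by linarith [ht.1]) _
      have ht0 : 0 < t := hv.1.trans ht.1
      rw [norm_mul, norm_mul, norm_powExp, norm_pow, Complex.norm_real, Complex.norm_real,
        Real.norm_eq_abs, Real.norm_eq_abs, abs_of_nonneg h0, abs_of_pos ht0]
      gcongr
      exact ht.2)
    ((intervalIntegrable_sub_rpow hγ1 v _ _).mul_const _)
  rw [intervalIntegral.integral_mul_const, integral_sub_rpow hγ1] at hb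
  refine hb.trans ?_
  have h1 : 0 < 1 - γ := by linarith
  gcongr ?_ / _ * _
  exact Real.rpow_le_rpow (by linarith [hv.2]) (by linarith [hv.1]) h1.le

lemma aestronglyMeasurable_integral_sub_rpow_mul (γ : ℝ) {g : ℝ → ℂ} (hg : Continuous g)
    {ν : Measure ℝ} [IsFiniteMeasure ν] (hν : ∀ᵐ v ∂ν, v ∈ Ioo 0 Real.pi) :
    AEStronglyMeasurable (fun v => ∫ t in v..Real.pi, ((t - v) ^ (-γ) : ℝ) * g t) ν := by
  have hm : StronglyMeasurable (Function.uncurry fun v t : ℝ =>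
      {z : ℝ × ℝ | z.1 < z.2 ∧ z.2 ≤ Real.pi}.indicator
        (fun z => (((z.2 - z.1) ^ (-γ) : ℝ) : ℂ) * g z.2) (v, t)) := by
    refine Measurable.stronglyMeasurable (Measurable.indicator ?_ ?_)
    · have := hg.measurable
      fun_prop
    · exact (measurableSet_lt measurable_fst measurable_snd).inter
        (measurableSet_le measurable_snd measurable_const)
  refine (hm.integral_prod_right (ν := volume)).aestronglyMeasurable.congr ?_
  filter_upwards [hν] with v hv
  rw [intervalIntegral.integral_of_le hv.2.le, ← integral_indicator measurableSet_Ioc]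
  rfl

lemma integrable_fracCoeff {γ : ℝ} (hγ1 : γ < 1) (p b n : ℕ)
    {ν : Measure ℝ} [IsFiniteMeasure ν] (hν : ∀ᵐ v ∂ν, v ∈ Ioo 0 Real.pi) :
    Integrable (fun v => fracCoeff γ p b v n) ν := by
  have hc := continuous_powExp (b + p + 1) n
  refine Integrable.of_bound (aestronglyMeasurable_integral_sub_rpow_mul γ (g := fun t : ℝ =>
    (t : ℂ) ^ b * powExp (b + p + 1) t n) (by fun_prop) hν) _
    (hν.mono fun v hv => norm_fracCoeff_le hγ1 p b n hv)

namespace IsKernelDensity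

variable {k : ℕ} {q m : ℝ → ℝ}

lemma nevIntegrable_powExp_pi (hm : IsKernelDensity k q m) (hq : ContinuousOn q (Icc 0 1))
    {γ : ℝ} {p : ℕ} (hγ0 : 0 ≤ γ) (hpγ : 0 < p + γ)
    (hg : IntegrableOn (fun s => tail m s / s ^ (1 + γ)) (Ioc 0 1)) {a : ℕ} (ha : a ≤ k) :
    NevIntegrable q (powExp a Real.pi) := by
  obtain ⟨C, hC, h⟩ := hm.exists_norm_nevSum_powExp_add_le ha 0
  obtain ⟨K, _, hK'⟩ := hm.exists_lintegral_majorant_le hpγ hg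
  have hπ := Real.pi_pos
  have hb : ∀ w ∈ Ioi (1 : ℝ), ‖nevSum q (powExp a Real.pi) w / (w : ℂ) ^ 2‖ₑ ≤
      ENNReal.ofReal (C * (Real.pi + 1) ^ p) * ENNReal.ofReal (majorant m γ p Real.pi w) := by
    intro w hw
    have hw1 : 1 < w := hw
    have hw0 : 0 < w := by linarith
    rw [← ENNReal.ofReal_mul (by positivity)]
    refine enorm_div_sq_le_of_norm_le hw0 ?_
    rw [mul_left_comm, sq_mul_majorant m γ p Real.pi hw0]
    have h' := h Real.pi ⟨hπ, le_rfl⟩ w hw1.le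
    simp only [add_zero, zero_add, pow_one] at h'
    have hwi : 0 < w⁻¹ := inv_pos.2 hw0
    have e1 : (Real.pi + w⁻¹)⁻¹ ^ a ≤ 1 := pow_le_one₀ (by positivity)
      (inv_le_one_of_one_le₀ (by linarith [Real.pi_gt_three]))
    have e2 : 1 ≤ (Real.pi + 1) ^ p * (Real.pi + w⁻¹)⁻¹ ^ p := by
      rw [← mul_pow]
      refine one_le_pow₀ ?_
      rw [← div_eq_mul_inv, one_le_div (by positivity)]
      linarith [inv_le_one_of_one_le₀ hw1.le]
    have e3 : 1 ≤ w ^ γ := Real.one_le_rpow hw1.le hγ0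
    have e4 := hm.tail_inv_nonneg (x := w * Real.pi + 1) (by nlinarith)
    calc _ ≤ C * w * (Real.pi + w⁻¹)⁻¹ ^ a * tail m (w * Real.pi + 1)⁻¹ := h'
      _ ≤ C * w * 1 * tail m (w * Real.pi + 1)⁻¹ := by gcongr
      _ = C * (w * 1) * 1 * tail m (w * Real.pi + 1)⁻¹ := by ring
      _ ≤ C * (w * w ^ γ) * ((Real.pi + 1) ^ p * (Real.pi + w⁻¹)⁻¹ ^ p) *
          tail m (w * Real.pi + 1)⁻¹ := by gcongr
      _ = _ := by ring
  refine ⟨aestronglyMeasurable_nevSum hq _, ?_⟩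
  refine (setLIntegral_mono' measurableSet_Ioi hb).trans_lt ?_
  rw [lintegral_const_mul' _ _ ENNReal.ofReal_ne_top]
  exact ENNReal.mul_lt_top ENNReal.ofReal_lt_top ((hK' _ hπ).trans_lt ENNReal.ofReal_lt_top)

/-- Superposition over `v` of the point-mass transforms, weighted by a measure with a finite
moment of order `-(p + γ)`; this is where the scaling of the majorant is used. -/
lemma nevIntegrable_integral_fracCoeff (hm : IsKernelDensity k q m)
    (hq : ContinuousOn q (Icc 0 1)) {γ : ℝ} {p b : ℕ} (hγ0 : 0 ≤ γ) (hγ1 : γ < 1)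
    (hpγ : 0 < p + γ)
    (hg : IntegrableOn (fun s => tail m s / s ^ (1 + γ)) (Ioc 0 1)) (hbp : b + p ≤ k)
    {ν : Measure ℝ} [IsFiniteMeasure ν] (hν : ∀ᵐ v ∂ν, v ∈ Ioo 0 Real.pi)
    (hνβ : ∫⁻ v, ENNReal.ofReal (v ^ (-(p + γ))) ∂ν < ⊤) :
    NevIntegrable q (fun n => ∫ v, fracCoeff γ p b v n ∂ν) := by
  obtain ⟨C, hC, h⟩ := hm.exists_norm_integral_rpow_mul_nevSum_le p b hbp hγ0 hγ1
  obtain ⟨K, hK, hK'⟩ := hm.exists_lintegral_majorant_le hpγ hg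
  have hb : ∀ w ∈ Ioi (1 : ℝ),
      ‖nevSum q (fun n => ∫ v, fracCoeff γ p b v n ∂ν) w / (w : ℂ) ^ 2‖ₑ ≤
      ∫⁻ v, ENNReal.ofReal C * ENNReal.ofReal (majorant m γ p v w) ∂ν := by
    intro w hw
    have hw1 : 1 < w := hw
    have hw0 : 0 < w := by linarith
    have e : nevSum q (fun n => ∫ v, fracCoeff γ p b v n ∂ν) w / (w : ℂ) ^ 2 =
        ∫ v, nevSum q (fracCoeff γ p b v) w / (w : ℂ) ^ 2 ∂ν := by
      rw [integral_div]
      unfold nevSum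
      rw [integral_finsetSum _ fun n _ => (integrable_fracCoeff hγ1 p b n hν).mul_const _]
      simp only [integral_mul_const]
    rw [e]
    refine (enorm_integral_le_lintegral_enorm _).trans (lintegral_mono_ae ?_)
    filter_upwards [hν] with v hv
    rw [← ENNReal.ofReal_mul hC]
    refine enorm_div_sq_le_of_norm_le hw0 ?_
    rw [mul_left_comm, sq_mul_majorant m γ p v hw0, nevSum_fracCoeff q hγ1]
    exact h v hv w hw1.le
  refine ⟨aestronglyMeasurable_nevSum hq _, ?_⟩
  refine (setLIntegral_mono' measurableSet_Ioi hb).trans_lt ?_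
  have hνr : ν.restrict (Ioo 0 Real.pi) = ν := Measure.restrict_eq_self_of_ae_mem hν
  have hmeas : AEMeasurable (Function.uncurry fun (w v : ℝ) =>
      ENNReal.ofReal C * ENNReal.ofReal (majorant m γ p v w))
      ((volume.restrict (Ioi 1)).prod ν) := by
    refine AEMeasurable.const_mul (AEMeasurable.ennreal_ofReal ?_) _
    rw [← hνr, Measure.prod_restrict]
    have hc : ContinuousOn (fun z : ℝ × ℝ => majorant m γ p z.2 z.1)
        (Ioi 1 ×ˢ Ioo 0 Real.pi) :=
      (hm.continuousOn_majorant γ p).comp (f := Prod.swap) continuous_swap.continuousOn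
        fun z hz => ⟨hz.2.1, show (0 : ℝ) < z.1 from lt_trans zero_lt_one hz.1⟩
    exact hc.aemeasurable (measurableSet_Ioi.prod measurableSet_Ioo)
  rw [lintegral_lintegral_swap hmeas]
  calc _ ≤ ∫⁻ v, ENNReal.ofReal (C * K) * ENNReal.ofReal (v ^ (-(p + γ))) ∂ν := by
        refine lintegral_mono_ae ?_
        filter_upwards [hν] with v hv
        rw [lintegral_const_mul' _ _ ENNReal.ofReal_ne_top, ← ENNReal.ofReal_mul (by positivity),
          mul_assoc, ENNReal.ofReal_mul hC]
        gcongr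
        exact hK' v hv.1
    _ < ⊤ := by
        rw [lintegral_const_mul' _ _ ENNReal.ofReal_ne_top]
        exact ENNReal.mul_lt_top ENNReal.ofReal_lt_top hνβ

end IsKernelDensity

/-! ### Inversion of the Riemann-Liouville integral -/

lemma intervalIntegrable_beta {γ β : ℝ} (hγ1 : γ < 1) (hβ : 0 < β) :
    IntervalIntegrable (fun x : ℝ => (1 - x) ^ (-γ) * x ^ (β - 1)) volume 0 1 := by
  have h := (Complex.betaIntegral_convergent (u := (β : ℂ)) (v := ((1 - γ : ℝ) : ℂ)) (by simpa)
    (by rw [Complex.ofReal_re]; linarith)).norm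
  refine h.congr_uIoo fun x hx => ?_
  rw [uIoo_of_le zero_le_one] at hx
  simp only
  have e1 : (x : ℂ) ^ ((β : ℂ) - 1) = ((x ^ (β - 1) : ℝ) : ℂ) := by
    rw [Complex.ofReal_cpow hx.1.le]; push_cast; rfl
  have e2 : (1 - (x : ℂ)) ^ (((1 - γ : ℝ) : ℂ) - 1) = (((1 - x) ^ (-γ) : ℝ) : ℂ) := by
    rw [Complex.ofReal_cpow (by linarith [hx.2])]; push_cast; congr 1; ring
  have p1 := Real.rpow_nonneg hx.1.le (β - 1)
  have p2 := Real.rpow_nonneg (by linarith [hx.2] : 0 ≤ 1 - x) (-γ)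
  rw [e1, e2, ← Complex.ofReal_mul, Complex.norm_real, Real.norm_eq_abs,
    abs_of_nonneg (mul_nonneg p1 p2), mul_comm]

/-- The Beta integral `∫_0^1 (1 - x) ^ (-γ) x ^ (β - 1) dx`. -/
noncomputable def betaConst (γ β : ℝ) : ℝ := ∫ x in (0 : ℝ)..1, (1 - x) ^ (-γ) * x ^ (β - 1)

lemma betaConst_pos {γ β : ℝ} (hγ1 : γ < 1) (hβ : 0 < β) : 0 < betaConst γ β :=
  intervalIntegral.intervalIntegral_pos_of_pos_on (intervalIntegrable_beta hγ1 hβ)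
    (fun x hx => mul_pos (Real.rpow_pos_of_pos (by linarith [hx.2]) _)
      (Real.rpow_pos_of_pos hx.1 _)) one_pos

lemma beta_scale {γ β u τ t : ℝ} (ht : t ∈ Ioo u τ) :
    (τ - t) ^ (-γ) * (t - u) ^ (β - 1) = (τ - u) ^ (β - γ - 1) *
      ((1 - (t - u) / (τ - u)) ^ (-γ) * ((t - u) / (τ - u)) ^ (β - 1)) := by
  have h0 : 0 < τ - u := by linarith [ht.1, ht.2]
  have h1 : 0 < t - u := by linarith [ht.1]
  have h2 : 0 < τ - t := by linarith [ht.2]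
  have e : 1 - (t - u) / (τ - u) = (τ - t) / (τ - u) := by field_simp; ring
  rw [e, Real.div_rpow h2.le h0.le, Real.div_rpow h1.le h0.le,
    show β - γ - 1 = -γ + (β - 1) by ring, Real.rpow_add h0]
  have := (Real.rpow_pos_of_pos h0 (-γ)).ne'
  have := (Real.rpow_pos_of_pos h0 (β - 1)).ne'
  field_simp

lemma intervalIntegrable_beta_scaled {γ β : ℝ} (hγ1 : γ < 1) (hβ : 0 < β) {u τ : ℝ} (h : u < τ) :
    IntervalIntegrable (fun t => (τ - t) ^ (-γ) * (t - u) ^ (β - 1)) volume u τ := by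
  have h0 : 0 < τ - u := by linarith
  have h1 := (intervalIntegrable_beta hγ1 hβ).comp_mul_left (c := (τ - u)⁻¹)
  simp only [zero_div, one_div, inv_inv] at h1
  have h2 := (h1.comp_sub_right u).const_mul ((τ - u) ^ (β - γ - 1))
  rw [zero_add, sub_add_cancel] at h2
  refine h2.congr_uIoo fun t ht => ?_
  rw [uIoo_of_le h.le] at ht
  simp only
  rw [beta_scale ht, div_eq_inv_mul]

lemma integral_beta_scaled (γ β : ℝ) {u τ : ℝ} (h : u < τ) :
    ∫ t in u..τ, (τ - t) ^ (-γ) * (t - u) ^ (β - 1) = betaConst γ β * (τ - u) ^ (β - γ) := by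
  have h0 : 0 < τ - u := by linarith
  rw [intervalIntegral.integral_congr_uIoo (g := fun t => (τ - u) ^ (β - γ - 1) *
    ((fun y => (1 - y / (τ - u)) ^ (-γ) * (y / (τ - u)) ^ (β - 1)) (t - u))) (fun t ht => by
      rw [uIoo_of_le h.le] at ht; exact beta_scale ht),
    intervalIntegral.integral_const_mul, intervalIntegral.integral_comp_sub_right
      (fun y => (1 - y / (τ - u)) ^ (-γ) * (y / (τ - u)) ^ (β - 1)), sub_self,
    intervalIntegral.integral_comp_div (fun y => (1 - y) ^ (-γ) * y ^ (β - 1)) h0.ne', zero_div,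
    div_self h0.ne', smul_eq_mul, ← betaConst, ← mul_assoc]
  conv_lhs => rw [← Real.rpow_add_one h0.ne', sub_add_cancel, mul_comm]

/-- Composition of fractional integrals: `I^{1-γ} I^β h` is a multiple of
`∫ (τ - u) ^ (β - γ) h`. -/
lemma integral_rpow_mul_rlIntegral {γ β : ℝ} (hγ1 : γ < 1) (hβ : 0 < β) {h : ℝ → ℝ} {τ : ℝ}
    (hτ : 0 < τ) (hβγ : 0 ≤ β - γ) (hh : IntegrableOn h (Ioc 0 τ)) :
    ∫ t in (0 : ℝ)..τ, (τ - t) ^ (-γ) * rlIntegral β h t =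
      betaConst γ β / Real.Gamma β * ∫ u in (0 : ℝ)..τ, (τ - u) ^ (β - γ) * h u := by
  set F : ℝ × ℝ → ℝ := {z : ℝ × ℝ | z.2 ≤ z.1}.indicator
    (fun z => (τ - z.1) ^ (-γ) * (z.1 - z.2) ^ (β - 1) * h z.2) with hF
  have hset : MeasurableSet {z : ℝ × ℝ | z.2 ≤ z.1} :=
    measurableSet_le measurable_snd measurable_fst
  have hFm : AEStronglyMeasurable F
      ((volume.restrict (Ioc 0 τ)).prod (volume.restrict (Ioc 0 τ))) := by
    refine AEStronglyMeasurable.indicator (AEStronglyMeasurable.mul ?_ hh.1.comp_snd) hset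
    exact (Measurable.mul (by fun_prop) (by fun_prop)).aestronglyMeasurable
  have hslice : ∀ u ∈ Ioo 0 τ, ∀ c : ℝ, (fun t => {z : ℝ × ℝ | z.2 ≤ z.1}.indicator
      (fun z => (τ - z.1) ^ (-γ) * (z.1 - z.2) ^ (β - 1) * c) (t, u)) =
      (Ici u).indicator (fun t => (τ - t) ^ (-γ) * (t - u) ^ (β - 1) * c) := by
    intro u _ c; ext t; simp [indicator_apply]
  have hIci : ∀ u ∈ Ioo 0 τ, (Ioc 0 τ ∩ Ici u : Set ℝ) = Icc u τ := by
    intro u hu; ext t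
    simp only [mem_inter_iff, mem_Ioc, mem_Ici, mem_Icc]
    exact ⟨fun h => ⟨h.2, h.1.2⟩, fun h => ⟨⟨hu.1.trans_le h.1, h.2⟩, h.1⟩⟩
  have hsi : ∀ u ∈ Ioo 0 τ, ∀ c : ℝ, Integrable (fun t => {z : ℝ × ℝ | z.2 ≤ z.1}.indicator
      (fun z => (τ - z.1) ^ (-γ) * (z.1 - z.2) ^ (β - 1) * c) (t, u))
      (volume.restrict (Ioc 0 τ)) := by
    intro u hu c
    rw [hslice u hu c, integrable_indicator_iff measurableSet_Ici, IntegrableOn,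
      Measure.restrict_restrict measurableSet_Ici, inter_comm, hIci u hu, ← IntegrableOn,
      integrableOn_Icc_iff_integrableOn_Ioc]
    exact ((intervalIntegrable_beta_scaled hγ1 hβ hu.2).1).mul_const c
  have hsv : ∀ u ∈ Ioo 0 τ, ∀ c : ℝ, ∫ t in Ioc 0 τ, {z : ℝ × ℝ | z.2 ≤ z.1}.indicator
      (fun z => (τ - z.1) ^ (-γ) * (z.1 - z.2) ^ (β - 1) * c) (t, u) =
      betaConst γ β * (τ - u) ^ (β - γ) * c := by
    intro u hu c
    rw [hslice u hu c, setIntegral_indicator measurableSet_Ici, hIci u hu,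
      integral_Icc_eq_integral_Ioc, ← intervalIntegral.integral_of_le hu.2.le,
      intervalIntegral.integral_mul_const, integral_beta_scaled γ β hu.2]
  have hmem : ∀ᵐ u ∂(volume.restrict (Ioc 0 τ)), u ∈ Ioo 0 τ := by
    rw [← restrict_Ioo_eq_restrict_Ioc]
    exact ae_restrict_mem measurableSet_Ioo
  have hwint : ∀ g : ℝ → ℝ, IntegrableOn g (Ioc 0 τ) →
      IntegrableOn (fun u => betaConst γ β * (τ - u) ^ (β - γ) * g u) (Ioc 0 τ) := by
    intro g hg
    refine Integrable.bdd_mul (c := betaConst γ β * τ ^ (β - γ)) hg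
      (Measurable.aestronglyMeasurable (by fun_prop)) ?_
    refine (ae_restrict_iff' measurableSet_Ioc).2 (ae_of_all _ fun u hu => ?_)
    have hB := (betaConst_pos hγ1 hβ).le
    have h1 : 0 ≤ τ - u := by linarith [hu.2]
    rw [Real.norm_eq_abs, abs_of_nonneg (mul_nonneg hB (Real.rpow_nonneg h1 _))]
    exact mul_le_mul_of_nonneg_left (Real.rpow_le_rpow h1 (by linarith [hu.1]) hβγ) hB
  have hFi : Integrable F ((volume.restrict (Ioc 0 τ)).prod (volume.restrict (Ioc 0 τ))) := by
    rw [integrable_prod_iff' hFm]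
    refine ⟨hmem.mono fun u hu => hsi u hu (h u), ?_⟩
    refine (hwint _ hh.norm).congr ?_
    filter_upwards [hmem] with u hu
    rw [← hsv u hu ‖h u‖]
    refine setIntegral_congr_fun measurableSet_Ioc fun t ht => ?_
    simp only [hF, indicator_apply, mem_ofPred_eq]
    split_ifs with hut
    · have p1 := Real.rpow_nonneg (by linarith [ht.2] : 0 ≤ τ - t) (-γ)
      have p2 := Real.rpow_nonneg (by linarith : 0 ≤ t - u) (β - 1)
      rw [norm_mul, Real.norm_eq_abs (_ * _), abs_of_nonneg (mul_nonneg p1 p2)]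
    · simp
  have hrl : ∀ t ∈ Ioc 0 τ, (τ - t) ^ (-γ) * rlIntegral β h t =
      (1 / Real.Gamma β) * ∫ u in Ioc 0 τ, F (t, u) := by
    intro t ht
    have e : ∀ u, F (t, u) = (Iic t).indicator
        (fun u => (τ - t) ^ (-γ) * ((t - u) ^ (β - 1) * h u)) u := by
      intro u; simp only [hF, indicator_apply, mem_ofPred_eq, mem_Iic]
      split_ifs
      · ring
      · rfl
    have e2 : (Ioc 0 τ ∩ Iic t : Set ℝ) = Ioc 0 t := by
      ext s; simp only [mem_inter_iff, mem_Ioc, mem_Iic]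
      exact ⟨fun h => ⟨h.1.1, h.2⟩, fun h => ⟨⟨h.1, h.2.trans ht.2⟩, h.2⟩⟩
    simp only [e]
    rw [setIntegral_indicator measurableSet_Iic, e2, integral_const_mul, rlIntegral,
      intervalIntegral.integral_of_le ht.1.le]
    ring
  have hcol : (fun u => ∫ t in Ioc 0 τ, F (t, u)) =ᵐ[volume.restrict (Ioc 0 τ)]
      fun u => betaConst γ β * ((τ - u) ^ (β - γ) * h u) :=
    hmem.mono fun u hu => (hsv u hu (h u)).trans (mul_assoc _ _ _)
  rw [intervalIntegral.integral_of_le hτ.le, setIntegral_congr_fun measurableSet_Ioc hrl,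
    integral_const_mul, integral_integral_swap (f := fun t u => F (t, u)) hFi,
    integral_congr_ae hcol, integral_const_mul, intervalIntegral.integral_of_le hτ.le]
  ring

/-- Fractional integration of the distribution function of a measure. -/
lemma integral_rpow_mul_measureReal {γ : ℝ} (hγ1 : γ < 1) {ν : Measure ℝ} [IsFiniteMeasure ν]
    (hν : ∀ᵐ v ∂ν, 0 < v) (τ : ℝ) :
    IntegrableOn (fun t => (τ - t) ^ (-γ) * ν.real (Ioc 0 t)) (Ioc 0 τ) ∧
    ∫ t in Ioc 0 τ, (τ - t) ^ (-γ) * ν.real (Ioc 0 t) =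
      ∫ v, (max (τ - v) 0) ^ (1 - γ) / (1 - γ) ∂ν := by
  have hγ' : 1 - γ ≠ 0 := by linarith
  set F : ℝ × ℝ → ℝ := {z : ℝ × ℝ | z.2 ≤ z.1}.indicator (fun z => (τ - z.1) ^ (-γ)) with hF
  have hset : MeasurableSet {z : ℝ × ℝ | z.2 ≤ z.1} :=
    measurableSet_le measurable_snd measurable_fst
  have hpow : ∀ c : ℝ, IntervalIntegrable (fun t => (τ - t) ^ (-γ)) volume c τ := by
    intro c
    simpa using ((intervalIntegral.intervalIntegrable_rpow' (a := 0) (b := τ - c)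
      (show -1 < -γ by linarith)).comp_sub_left τ).symm
  have hFi : Integrable F ((volume.restrict (Ioc 0 τ)).prod ν) := by
    have h1 : Integrable (fun z : ℝ × ℝ => (τ - z.1) ^ (-γ) * (1 : ℝ))
        ((volume.restrict (Ioc 0 τ)).prod ν) :=
      Integrable.mul_prod (hpow 0).1 (integrable_const (1 : ℝ))
    simp only [mul_one] at h1
    exact h1.indicator hset
  have hν0 : ν.restrict (Ioi 0) = ν := Measure.restrict_eq_self_of_ae_mem hν
  have hinner : ∀ t, ∫ v, F (t, v) ∂ν = (τ - t) ^ (-γ) * ν.real (Ioc 0 t) := by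
    intro t
    have e : ∀ v, F (t, v) = (Iic t).indicator (fun _ => (τ - t) ^ (-γ)) v := by
      intro v; simp [hF, indicator_apply]
    simp only [e]
    rw [integral_indicator measurableSet_Iic, setIntegral_const, smul_eq_mul, mul_comm]
    congr 1
    conv_lhs => rw [← hν0]
    rw [measureReal_restrict_apply measurableSet_Iic, inter_comm, Ioi_inter_Iic]
  refine ⟨(hFi.integral_prod_left).congr (ae_of_all _ hinner), ?_⟩
  simp only [← hinner]
  rw [integral_integral_swap (f := fun t v => F (t, v)) hFi]
  refine integral_congr_ae ?_
  filter_upwards [hν] with v hv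
  have e : ∀ t, F (t, v) = (Ici v).indicator (fun t => (τ - t) ^ (-γ)) t := by
    intro t; simp [hF, indicator_apply]
  simp only [e]
  rw [setIntegral_indicator measurableSet_Ici]
  rcases le_or_gt v τ with hvτ | hvτ
  · have e2 : (Ioc 0 τ ∩ Ici v : Set ℝ) = Icc v τ := by
      ext t; simp only [mem_inter_iff, mem_Ioc, mem_Ici, mem_Icc]
      exact ⟨fun h => ⟨h.2, h.1.2⟩, fun h => ⟨⟨hv.trans_le h.1, h.2⟩, h.1⟩⟩
    rw [e2, integral_Icc_eq_integral_Ioc, ← intervalIntegral.integral_of_le hvτ,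
      intervalIntegral.integral_comp_sub_left (fun t => t ^ (-γ)), sub_self,
      integral_rpow (Or.inl (by linarith)), show -γ + 1 = 1 - γ by ring, Real.zero_rpow hγ',
      sub_zero, max_eq_left (by linarith)]
  · have e2 : (Ioc 0 τ ∩ Ici v : Set ℝ) = ∅ := by
      ext t; simp only [mem_inter_iff, mem_Ioc, mem_Ici, mem_empty_iff_false, iff_false]
      rintro ⟨⟨_, h1⟩, h2⟩; linarith
    rw [e2, max_eq_right (by linarith), Real.zero_rpow hγ']
    simp

/-- The measure `dH` on `(0, π)`, split into its Jordan parts. The extension of `H` by `0` may jump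
at `0` and at `π`; the first jump is excluded by `H(+0) = 0`, the second by restricting to `(0, π)`. -/
lemma exists_measures_of_finiteWeightedVariation {β : ℝ} {H : ℝ → ℝ}
    (hH0 : Tendsto H (𝓝[>] 0) (𝓝 0)) (hH : FiniteWeightedVariation β H) :
    ∃ ν₁ ν₂ : Measure ℝ, (IsFiniteMeasure ν₁ ∧ IsFiniteMeasure ν₂) ∧
      (∀ᵐ v ∂ν₁, v ∈ Ioo 0 Real.pi) ∧ (∀ᵐ v ∂ν₂, v ∈ Ioo 0 Real.pi) ∧
      ∫⁻ v, ENNReal.ofReal (v ^ (-β)) ∂ν₁ < ⊤ ∧ ∫⁻ v, ENNReal.ofReal (v ^ (-β)) ∂ν₂ < ⊤ ∧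
      ∀ᵐ t, t ∈ Ioo 0 Real.pi → H t = ν₁.real (Ioc 0 t) - ν₂.real (Ioc 0 t) := by
  obtain ⟨hF, hfin⟩ := hH
  set F := (Ioo 0 Real.pi).indicator H with hFdef
  set μ : SignedMeasure ℝ := hF.vectorMeasure with hμ
  set P := μ.toJordanDecomposition.posPart with hP
  set N := μ.toJordanDecomposition.negPart with hN
  have hvar : P + N = hF.vectorMeasure.variation := μ.totalVariation_eq_variation
  have hPle : P ≤ hF.vectorMeasure.variation := by rw [← hvar]; exact Measure.le_add_right le_rfl
  have hNle : N ≤ hF.vectorMeasure.variation := by rw [← hvar]; exact Measure.le_add_left le_rfl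
  have hlim0 : Function.rightLim F 0 = 0 := by
    refine rightLim_eq_of_tendsto (hH0.congr' ?_)
    filter_upwards [Ioo_mem_nhdsGT Real.pi_pos] with t ht
    rw [hFdef, indicator_of_mem ht]
  refine ⟨P.restrict (Ioo 0 Real.pi), N.restrict (Ioo 0 Real.pi),
    ⟨inferInstance, inferInstance⟩, ae_restrict_mem measurableSet_Ioo,
    ae_restrict_mem measurableSet_Ioo,
    (lintegral_mono' (Measure.restrict_mono le_rfl hPle) le_rfl).trans_lt hfin,
    (lintegral_mono' (Measure.restrict_mono le_rfl hNle) le_rfl).trans_lt hfin, ?_⟩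
  -- The Stieltjes measure of `(0, t]` uses the right limit of `F`, which is `F t` almost
  -- everywhere.
  filter_upwards [hF.locallyBoundedVariationOn.ae_differentiableAt] with t ht htI
  have hrl : Function.rightLim F t = F t :=
    rightLim_eq_of_tendsto (ht.continuousAt.tendsto.mono_left nhdsWithin_le_nhds)
  have h1 : μ (Ioc 0 t) = F t := by
    rw [hμ, hF.vectorMeasure_Ioc htI.1.le, hrl, hlim0, sub_zero]
  have h2 := μ.apply_eq_posPart_real_sub_negPart_real (measurableSet_Ioc (a := 0) (b := t))
  have h3 : Ioc 0 t ∩ Ioo 0 Real.pi = Ioc 0 t :=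
    inter_eq_left.2 fun s hs => ⟨hs.1, hs.2.trans_lt htI.2⟩
  rw [measureReal_restrict_apply measurableSet_Ioc, measureReal_restrict_apply measurableSet_Ioc,
    h3, ← h2, h1, hFdef, indicator_of_mem htI]

/-- If `H = I^β h` with `β = p + γ` is the distribution function of `ν₁ - ν₂`, then
`I^{p+1} h` is a fractional integral of order `1 - γ` of that measure. -/
lemma exists_integral_pow_mul_eq {γ : ℝ} (hγ1 : γ < 1) {p : ℕ} (hpγ : 0 < p + γ)
    {h : ℝ → ℝ} (hh : IntegrableOn h (Ioo 0 Real.pi)) {ν₁ ν₂ : Measure ℝ}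
    [IsFiniteMeasure ν₁] [IsFiniteMeasure ν₂]
    (hν₁ : ∀ᵐ v ∂ν₁, v ∈ Ioo 0 Real.pi) (hν₂ : ∀ᵐ v ∂ν₂, v ∈ Ioo 0 Real.pi)
    (hH : ∀ᵐ t, t ∈ Ioo 0 Real.pi →
      rlIntegral (p + γ) h t = ν₁.real (Ioc 0 t) - ν₂.real (Ioc 0 t)) :
    ∃ κ : ℝ, ∀ τ ∈ Ioc 0 Real.pi, ∫ u in (0 : ℝ)..τ, (τ - u) ^ p * h u =
      κ * ((∫ v, (max (τ - v) 0) ^ (1 - γ) ∂ν₁) - ∫ v, (max (τ - v) 0) ^ (1 - γ) ∂ν₂) := by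
  refine ⟨Real.Gamma (p + γ) / betaConst γ (p + γ) / (1 - γ), fun τ hτ => ?_⟩
  have hh' : IntegrableOn h (Ioc 0 τ) :=
    ((integrableOn_Ioc_iff_integrableOn_Ioo).2 hh).mono_set (Ioc_subset_Ioc_right hτ.2)
  have hA := integral_rpow_mul_rlIntegral hγ1 hpγ hτ.1
    (by rw [add_sub_cancel_right]; positivity) hh'
  obtain ⟨i₁, e₁⟩ := integral_rpow_mul_measureReal hγ1 (hν₁.mono fun v hv => hv.1) τ
  obtain ⟨i₂, e₂⟩ := integral_rpow_mul_measureReal hγ1 (hν₂.mono fun v hv => hv.1) τ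
  have hB : ∫ t in (0 : ℝ)..τ, (τ - t) ^ (-γ) * rlIntegral (p + γ) h t =
      ((∫ v, (max (τ - v) 0) ^ (1 - γ) ∂ν₁) - ∫ v, (max (τ - v) 0) ^ (1 - γ) ∂ν₂) / (1 - γ) := by
    rw [sub_div, ← integral_div, ← integral_div, ← e₁, ← e₂, ← integral_sub i₁ i₂,
      intervalIntegral.integral_of_le hτ.1.le]
    refine integral_congr_ae ?_
    rw [← restrict_Ioo_eq_restrict_Ioc]
    refine (ae_restrict_iff' measurableSet_Ioo).2 ?_
    filter_upwards [hH] with t ht htτ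
    rw [ht ⟨htτ.1, htτ.2.trans_le hτ.2⟩]
    ring
  rw [hB] at hA
  simp only [add_sub_cancel_right, Real.rpow_natCast] at hA
  have hG := (Real.Gamma_pos_of_pos hpγ).ne'
  have hBe := (betaConst_pos hγ1 hpγ).ne'
  have h1 : 1 - γ ≠ 0 := by linarith
  rw [div_mul_eq_mul_div, mul_div_assoc, hA]
  field_simp

/-! ### Fractional integration by parts -/

lemma intervalIntegrable_ofReal_mul {h : ℝ → ℝ} (hh : IntegrableOn h (Ioo 0 Real.pi)) {G : ℝ → ℂ}
    (hG : Continuous G) : IntervalIntegrable (fun u => (h u : ℂ) * G u) volume 0 Real.pi := by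
  have h1 : IntervalIntegrable (fun u => (h u : ℂ)) volume 0 Real.pi := by
    rw [intervalIntegrable_iff_integrableOn_Ioo_of_le Real.pi_pos.le]
    exact hh.ofReal
  exact h1.mul_continuousOn hG.continuousOn

/-- Taylor's formula at `π` with integral remainder. -/
lemma taylor_at_pi {p : ℕ} {G : ℝ → ℂ} (hG : ContDiff ℝ (p + 1 : ℕ) G) {u : ℝ}
    (hu : u < Real.pi) :
    G u = (∑ j ∈ Finset.range (p + 1),
        (((Nat.factorial j : ℝ)⁻¹ * (u - Real.pi) ^ j : ℝ) : ℂ) * iteratedDeriv j G Real.pi) +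
      ((-1) ^ (p + 1) / (Nat.factorial p : ℂ)) *
        ∫ t in u..Real.pi, ((t - u) ^ p : ℝ) * iteratedDeriv (p + 1) G t := by
  have h := taylor_integral_remainder (x := u) (x₀ := Real.pi) (n := p) hG.contDiffOn
  have hud : UniqueDiffOn ℝ (uIcc Real.pi u) := uniqueDiffOn_uIcc hu.ne'
  have hit : ∀ j ≤ p + 1, ∀ t ∈ uIcc Real.pi u,
      iteratedDerivWithin j G (uIcc Real.pi u) t = iteratedDeriv j G t := fun j hj t ht =>
    iteratedDerivWithin_eq_iteratedDeriv hud
      ((hG.of_le (by exact_mod_cast hj)).contDiffAt) ht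
  rw [taylor_within_apply, sub_eq_iff_eq_add, add_comm] at h
  rw [h]
  congr 1
  · refine Finset.sum_congr rfl fun j hj => ?_
    rw [hit j (by have := Finset.mem_range.1 hj; omega) _ left_mem_uIcc, Complex.real_smul]
  · rw [intervalIntegral.integral_congr (g := fun t => (((-1) ^ p / (Nat.factorial p : ℂ))) *
      ((((t - u) ^ p : ℝ) : ℂ) * iteratedDeriv (p + 1) G t)) (fun t ht => by
        simp only
        rw [hit (p + 1) le_rfl t ht, Complex.real_smul]
        have : (u - t) ^ p = (-1) ^ p * (t - u) ^ p := by rw [← mul_pow]; ring_nf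
        rw [this]
        push_cast
        ring), intervalIntegral.integral_const_mul, intervalIntegral.integral_symm]
    ring

/-- The kernel `(t - u)_+ ^ p` swaps a weight on `u` with a weight on `t`. -/
lemma integral_integral_pow_swap {h : ℝ → ℝ} (hh : IntegrableOn h (Ioo 0 Real.pi)) (p : ℕ)
    {g : ℝ → ℂ} (hg : Continuous g) :
    IntervalIntegrable (fun u => (h u : ℂ) * ∫ t in u..Real.pi, ((t - u) ^ p : ℝ) * g t)
      volume 0 Real.pi ∧
    ∫ u in (0 : ℝ)..Real.pi, (h u : ℂ) * ∫ t in u..Real.pi, ((t - u) ^ p : ℝ) * g t =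
      ∫ t in (0 : ℝ)..Real.pi, g t * ((∫ u in (0 : ℝ)..t, (t - u) ^ p * h u : ℝ) : ℂ) := by
  have hπ := Real.pi_pos
  set S : Set (ℝ × ℝ) := {z | z.1 < z.2 ∧ z.2 - z.1 ≤ Real.pi} with hS
  have hSm : MeasurableSet S := (measurableSet_lt measurable_fst measurable_snd).inter
    (measurableSet_le (measurable_snd.sub measurable_fst) measurable_const)
  set F : ℝ × ℝ → ℂ := fun z => S.indicator (fun z => (((z.2 - z.1) ^ p : ℝ) : ℂ)) z *
    ((h z.1 : ℂ) * g z.2) with hF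
  have hh' : IntegrableOn (fun u => (h u : ℂ)) (Ioc 0 Real.pi) :=
    ((integrableOn_Ioc_iff_integrableOn_Ioo).2 hh).ofReal
  have hFi : Integrable F ((volume.restrict (Ioc 0 Real.pi)).prod
      (volume.restrict (Ioc 0 Real.pi))) := by
    refine Integrable.bdd_mul (c := Real.pi ^ p)
      (hh'.mul_prod ((hg.intervalIntegrable 0 Real.pi).1)) ?_ (ae_of_all _ fun z => ?_)
    · exact (Measurable.indicator (by fun_prop) hSm).aestronglyMeasurable
    · simp only [indicator_apply]
      split_ifs with hz
      · rw [Complex.norm_real, Real.norm_eq_abs, abs_pow, abs_of_nonneg (by linarith [hz.1])]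
        exact pow_le_pow_left₀ (by linarith [hz.1]) hz.2 _
      · simp; positivity
  have hrow : ∀ u ∈ Ioc 0 Real.pi, ∫ t in Ioc 0 Real.pi, F (u, t) =
      (h u : ℂ) * ∫ t in u..Real.pi, ((t - u) ^ p : ℝ) * g t := by
    intro u hu
    have e : ∀ t ∈ Ioc 0 Real.pi, F (u, t) = (Ioi u).indicator
        (fun t => (h u : ℂ) * ((((t - u) ^ p : ℝ) : ℂ) * g t)) t := by
      intro t ht
      have : ((u, t) ∈ S) ↔ t ∈ Ioi u :=
        ⟨fun hz => hz.1, fun hz => ⟨hz, by simp only; linarith [ht.2, hu.1]⟩⟩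
      simp only [hF, indicator_apply, this]
      split_ifs
      · ring
      · ring
    have e2 : (Ioc 0 Real.pi ∩ Ioi u : Set ℝ) = Ioc u Real.pi := by
      ext t; simp only [mem_inter_iff, mem_Ioc, mem_Ioi]
      exact ⟨fun h => ⟨h.2, h.1.2⟩, fun h => ⟨⟨hu.1.trans h.1, h.2⟩, h.1⟩⟩
    rw [setIntegral_congr_fun measurableSet_Ioc e, setIntegral_indicator measurableSet_Ioi, e2,
      integral_const_mul, intervalIntegral.integral_of_le hu.2]
  have hcol : ∀ t ∈ Ioc 0 Real.pi, ∫ u in Ioc 0 Real.pi, F (u, t) =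
      g t * ((∫ u in (0 : ℝ)..t, (t - u) ^ p * h u : ℝ) : ℂ) := by
    intro t ht
    have e : ∀ u ∈ Ioc 0 Real.pi, F (u, t) = (Iio t).indicator
        (fun u => g t * (((t - u) ^ p * h u : ℝ) : ℂ)) u := by
      intro u hu
      have : ((u, t) ∈ S) ↔ u ∈ Iio t :=
        ⟨fun hz => hz.1, fun hz => ⟨hz, by simp only; linarith [ht.2, hu.1]⟩⟩
      simp only [hF, indicator_apply, this]
      split_ifs
      · push_cast; ring
      · ring
    have e2 : (Ioc 0 Real.pi ∩ Iio t : Set ℝ) = Ioo 0 t := by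
      ext s; simp only [mem_inter_iff, mem_Ioc, mem_Iio, mem_Ioo]
      exact ⟨fun h => ⟨h.1.1, h.2⟩, fun h => ⟨⟨h.1, h.2.le.trans ht.2⟩, h.2⟩⟩
    rw [setIntegral_congr_fun measurableSet_Ioc e, setIntegral_indicator measurableSet_Iio, e2,
      integral_const_mul, ← integral_Ioc_eq_integral_Ioo, integral_complex_ofReal,
      intervalIntegral.integral_of_le ht.1.le]
  constructor
  · rw [intervalIntegrable_iff_integrableOn_Ioc_of_le hπ.le]
    exact (hFi.integral_prod_left).congr
      ((ae_restrict_iff' measurableSet_Ioc).2 (ae_of_all _ hrow))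
  · rw [intervalIntegral.integral_of_le hπ.le, intervalIntegral.integral_of_le hπ.le,
      ← setIntegral_congr_fun measurableSet_Ioc hrow,
      ← setIntegral_congr_fun measurableSet_Ioc hcol,
      integral_integral_swap (f := fun u t => F (u, t)) hFi]

lemma continuous_max_rpow {γ : ℝ} (hγ1 : γ < 1) :
    Continuous fun z : ℝ × ℝ => (max (z.1 - z.2) 0) ^ (1 - γ) :=
  Continuous.rpow_const (by fun_prop) fun _ => Or.inr (by linarith)

/-- Integration by parts from `v` on, where `(t - v) ^ (1 - γ)` vanishes and is continuous. -/
lemma integral_max_rpow_mul_deriv {γ : ℝ} (hγ1 : γ < 1) {v : ℝ} (hv : v ∈ Ioo 0 Real.pi)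
    {G g : ℝ → ℂ} (hG : ∀ t, HasDerivAt G (g t) t) (hg : Continuous g) :
    ∫ t in (0 : ℝ)..Real.pi, g t * (((max (t - v) 0) ^ (1 - γ) : ℝ) : ℂ) =
      (((max (Real.pi - v) 0) ^ (1 - γ) : ℝ) : ℂ) * G Real.pi -
        (1 - γ : ℝ) * ∫ t in v..Real.pi, ((t - v) ^ (-γ) : ℝ) * G t := by
  have hγ' : 1 - γ ≠ 0 := by linarith
  have hc : Continuous fun t : ℝ => (((max (t - v) 0) ^ (1 - γ) : ℝ) : ℂ) :=
    Complex.continuous_ofReal.comp ((continuous_max_rpow hγ1).comp (by fun_prop :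
      Continuous fun t : ℝ => (t, v)))
  have hGc : Continuous G := continuous_iff_continuousAt.2 fun t => (hG t).continuousAt
  have hgc : Continuous fun t => g t * (((max (t - v) 0) ^ (1 - γ) : ℝ) : ℂ) := hg.mul hc
  rw [← intervalIntegral.integral_add_adjacent_intervals
    (hgc.intervalIntegrable 0 v) (hgc.intervalIntegrable v Real.pi)]
  have hz : ∫ t in (0 : ℝ)..v, g t * (((max (t - v) 0) ^ (1 - γ) : ℝ) : ℂ) = 0 := by
    rw [intervalIntegral.integral_congr (g := fun _ => (0 : ℂ)) (fun t ht => by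
      rw [uIcc_of_le hv.1.le] at ht
      simp only
      rw [max_eq_right (by linarith [ht.2]), Real.zero_rpow hγ']
      simp)]
    simp
  have hd : ∀ t ∈ Ioo (min v Real.pi) (max v Real.pi),
      HasDerivAt (fun t : ℝ => (((max (t - v) 0) ^ (1 - γ) : ℝ) : ℂ))
        (((1 - γ) * (t - v) ^ (-γ) : ℝ) : ℂ) t := by
    intro t ht
    rw [min_eq_left hv.2.le, max_eq_right hv.2.le] at ht
    have hpos : 0 < t - v := by linarith [ht.1]
    have h1 : HasDerivAt (fun t : ℝ => (t - v) ^ (1 - γ)) ((1 - γ) * (t - v) ^ (-γ)) t := by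
      have := ((hasDerivAt_id t).sub_const v).rpow_const (p := 1 - γ) (Or.inl hpos.ne')
      refine this.congr_deriv ?_
      rw [show 1 - γ - 1 = -γ by ring]
      simp
    refine HasDerivAt.ofReal_comp (h1.congr_of_eventuallyEq ?_)
    filter_upwards [lt_mem_nhds ht.1] with s hs
    rw [max_eq_left (by linarith)]
  have hi := intervalIntegrable_sub_rpow hγ1 v v Real.pi
  have h := intervalIntegral.integral_mul_deriv_eq_deriv_mul_of_hasDerivAt hc.continuousOn
    hGc.continuousOn hd (fun t _ => hG t)
    (⟨(hi.const_mul (1 - γ)).1.ofReal, (hi.const_mul (1 - γ)).2.ofReal⟩)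
    (hg.intervalIntegrable v Real.pi)
  rw [hz, zero_add, intervalIntegral.integral_congr (g := fun t =>
    (((max (t - v) 0) ^ (1 - γ) : ℝ) : ℂ) * g t) (fun t _ => mul_comm _ _), h, sub_self,
    max_self, Real.zero_rpow hγ']
  have e : ∀ t, (((1 - γ) * (t - v) ^ (-γ) : ℝ) : ℂ) * G t =
      ((1 - γ : ℝ) : ℂ) * ((((t - v) ^ (-γ) : ℝ) : ℂ) * G t) := by
    intro t; push_cast; ring
  simp only [e, intervalIntegral.integral_const_mul]
  simp

/-- The superposition over `v` of `integral_max_rpow_mul_deriv`. -/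
lemma integral_mul_integral_max_rpow {γ : ℝ} (hγ1 : γ < 1) {ν : Measure ℝ} [IsFiniteMeasure ν]
    (hν : ∀ᵐ v ∂ν, v ∈ Ioo 0 Real.pi) {G g : ℝ → ℂ} (hG : ∀ t, HasDerivAt G (g t) t)
    (hg : Continuous g) :
    IntervalIntegrable (fun t => g t * ((∫ v, (max (t - v) 0) ^ (1 - γ) ∂ν : ℝ) : ℂ))
      volume 0 Real.pi ∧
    ∫ t in (0 : ℝ)..Real.pi, g t * ((∫ v, (max (t - v) 0) ^ (1 - γ) ∂ν : ℝ) : ℂ) =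
      ((∫ v, (max (Real.pi - v) 0) ^ (1 - γ) ∂ν : ℝ) : ℂ) * G Real.pi -
        (1 - γ : ℝ) * ∫ v, (∫ t in v..Real.pi, ((t - v) ^ (-γ) : ℝ) * G t) ∂ν := by
  have hπ := Real.pi_pos
  set F : ℝ × ℝ → ℂ := fun z => g z.1 * (((max (z.1 - z.2) 0) ^ (1 - γ) : ℝ) : ℂ) with hF
  have hνr : ν.restrict (Ioo 0 Real.pi) = ν := Measure.restrict_eq_self_of_ae_mem hν
  have hFc : Continuous F := (hg.comp continuous_fst).mul
    (Complex.continuous_ofReal.comp (continuous_max_rpow hγ1))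
  have hFi : Integrable F ((volume.restrict (Ioc 0 Real.pi)).prod ν) := by
    have h1 : IntegrableOn F (Icc 0 Real.pi ×ˢ Icc 0 Real.pi) (volume.prod ν) :=
      hFc.continuousOn.integrableOn_compact (isCompact_Icc.prod isCompact_Icc)
    rw [← hνr, Measure.prod_restrict]
    exact h1.mono_set (prod_mono Ioc_subset_Icc_self Ioo_subset_Icc_self)
  have hrow : ∀ t, ∫ v, F (t, v) ∂ν = g t * ((∫ v, (max (t - v) 0) ^ (1 - γ) ∂ν : ℝ) : ℂ) := by
    intro t
    simp only [hF]
    rw [integral_const_mul, integral_complex_ofReal]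
  have hGc : Continuous G := continuous_iff_continuousAt.2 fun t => (hG t).continuousAt
  have hcol : (fun v => ∫ t in Ioc 0 Real.pi, F (t, v)) =ᵐ[ν] fun v =>
      (((max (Real.pi - v) 0) ^ (1 - γ) : ℝ) : ℂ) * G Real.pi -
        (1 - γ : ℝ) * ∫ t in v..Real.pi, ((t - v) ^ (-γ) : ℝ) * G t := by
    filter_upwards [hν] with v hv
    rw [← intervalIntegral.integral_of_le hπ.le]
    exact integral_max_rpow_mul_deriv hγ1 hv hG hg
  have hbi : Integrable (fun v => (max (Real.pi - v) 0) ^ (1 - γ)) ν := by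
    have h1 : IntegrableOn (fun v => (max (Real.pi - v) 0) ^ (1 - γ)) (Icc 0 Real.pi) ν :=
      ((continuous_max_rpow hγ1).comp (by fun_prop :
        Continuous fun v : ℝ => (Real.pi, v))).continuousOn.integrableOn_compact isCompact_Icc
    rw [← hνr]
    exact h1.mono_set Ioo_subset_Icc_self
  have hbi' : Integrable (fun v => (((max (Real.pi - v) 0) ^ (1 - γ) : ℝ) : ℂ) * G Real.pi) ν :=
    hbi.ofReal.mul_const _
  have hGi : Integrable (fun v => ∫ t in v..Real.pi, ((t - v) ^ (-γ) : ℝ) * G t) ν := by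
    have hd : Integrable (fun v => (((max (Real.pi - v) 0) ^ (1 - γ) : ℝ) : ℂ) * G Real.pi -
        ∫ t in Ioc 0 Real.pi, F (t, v)) ν := hbi'.sub hFi.integral_prod_right
    have hγ' : ((1 - γ : ℝ) : ℂ) ≠ 0 := by
      exact_mod_cast (by linarith : 1 - γ ≠ 0)
    refine (hd.const_mul (((1 - γ : ℝ) : ℂ)⁻¹)).congr ?_
    filter_upwards [hcol] with v hv
    rw [hv]
    field_simp
    ring
  constructor
  · rw [intervalIntegrable_iff_integrableOn_Ioc_of_le hπ.le]
    exact (hFi.integral_prod_left).congr (ae_of_all _ hrow)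
  · rw [intervalIntegral.integral_of_le hπ.le]
    simp only [← hrow]
    rw [integral_integral_swap (f := fun t v => F (t, v)) hFi, integral_congr_ae hcol,
      integral_sub hbi' (hGi.const_mul _), integral_mul_const, integral_const_mul,
      integral_complex_ofReal]

/-- Fractional integration by parts: pairing a smooth `G` with `h` amounts, up to boundary terms of
order less than `p` at `π`, to integrating a Riemann-Liouville transform of its `p`-th derivative
against `dH`. The boundary term of order `p` cancels. -/
lemma exists_integral_mul_eq {γ : ℝ} (hγ1 : γ < 1) {p : ℕ} (hpγ : 0 < p + γ)
    {h : ℝ → ℝ} (hh : IntegrableOn h (Ioo 0 Real.pi)) {ν₁ ν₂ : Measure ℝ}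
    [IsFiniteMeasure ν₁] [IsFiniteMeasure ν₂]
    (hν₁ : ∀ᵐ v ∂ν₁, v ∈ Ioo 0 Real.pi) (hν₂ : ∀ᵐ v ∂ν₂, v ∈ Ioo 0 Real.pi)
    (hH : ∀ᵐ t, t ∈ Ioo 0 Real.pi →
      rlIntegral (p + γ) h t = ν₁.real (Ioc 0 t) - ν₂.real (Ioc 0 t)) :
    ∃ (c : ℕ → ℂ) (e : ℂ), ∀ G : ℝ → ℂ, ContDiff ℝ (p + 1 : ℕ) G →
      ∫ u in (0 : ℝ)..Real.pi, (h u : ℂ) * G u =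
        (∑ j ∈ Finset.range p, c j * iteratedDeriv j G Real.pi) +
        e * ((∫ v, (∫ t in v..Real.pi, ((t - v) ^ (-γ) : ℝ) * iteratedDeriv p G t) ∂ν₁) -
          ∫ v, (∫ t in v..Real.pi, ((t - v) ^ (-γ) : ℝ) * iteratedDeriv p G t) ∂ν₂) := by
  obtain ⟨κ, hκ⟩ := exists_integral_pow_mul_eq hγ1 hpγ hh hν₁ hν₂ hH
  have hπ := Real.pi_pos
  refine ⟨fun j => ∫ u in (0 : ℝ)..Real.pi, (h u : ℂ) *
    (((Nat.factorial j : ℝ)⁻¹ * (u - Real.pi) ^ j : ℝ) : ℂ),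
    (-1) ^ p / (Nat.factorial p : ℂ) * κ * (1 - γ : ℝ), fun G hG => ?_⟩
  set g := iteratedDeriv (p + 1) G with hg
  have hgc : Continuous g := hG.continuous_iteratedDeriv (p + 1) le_rfl
  have hGd : ∀ t, HasDerivAt (iteratedDeriv p G) (g t) t := by
    intro t
    have hdiff : Differentiable ℝ (iteratedDeriv p G) :=
      hG.differentiable_iteratedDeriv p (by exact_mod_cast Nat.lt_succ_self p)
    rw [hg, iteratedDeriv_succ]
    exact (hdiff t).hasDerivAt
  obtain ⟨hi, hswap⟩ := integral_integral_pow_swap hh p hgc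
  obtain ⟨i₁, e₁⟩ := integral_mul_integral_max_rpow hγ1 hν₁ hGd hgc
  obtain ⟨i₂, e₂⟩ := integral_mul_integral_max_rpow hγ1 hν₂ hGd hgc
  have hM : ∫ t in (0 : ℝ)..Real.pi, g t * ((∫ u in (0 : ℝ)..t, (t - u) ^ p * h u : ℝ) : ℂ) =
      κ * ((∫ t in (0 : ℝ)..Real.pi, g t * ((∫ v, (max (t - v) 0) ^ (1 - γ) ∂ν₁ : ℝ) : ℂ)) -
        ∫ t in (0 : ℝ)..Real.pi, g t * ((∫ v, (max (t - v) 0) ^ (1 - γ) ∂ν₂ : ℝ) : ℂ)) := by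
    rw [← intervalIntegral.integral_sub i₁ i₂, ← intervalIntegral.integral_const_mul]
    refine intervalIntegral.integral_congr_uIoo fun t ht => ?_
    rw [uIoo_of_le hπ.le] at ht
    rw [hκ t ⟨ht.1, ht.2.le⟩]
    push_cast
    ring
  have hpi := hκ Real.pi ⟨hπ, le_rfl⟩
  -- the coefficient of the boundary term of order `p`
  have hcp : ∫ u in (0 : ℝ)..Real.pi, (h u : ℂ) *
      (((Nat.factorial p : ℝ)⁻¹ * (u - Real.pi) ^ p : ℝ) : ℂ) =
      (-1) ^ p / (Nat.factorial p : ℂ) *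
        ((∫ u in (0 : ℝ)..Real.pi, (Real.pi - u) ^ p * h u : ℝ) : ℂ) := by
    rw [← intervalIntegral.integral_ofReal, ← intervalIntegral.integral_const_mul]
    refine intervalIntegral.integral_congr fun u _ => ?_
    have : (u - Real.pi) ^ p = (-1) ^ p * (Real.pi - u) ^ p := by rw [← mul_pow]; ring_nf
    simp only [this]
    push_cast
    ring
  have hT : ∫ u in (0 : ℝ)..Real.pi, (h u : ℂ) * G u =
      (∑ j ∈ Finset.range (p + 1), (∫ u in (0 : ℝ)..Real.pi, (h u : ℂ) *
        (((Nat.factorial j : ℝ)⁻¹ * (u - Real.pi) ^ j : ℝ) : ℂ)) * iteratedDeriv j G Real.pi) +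
      ((-1) ^ (p + 1) / (Nat.factorial p : ℂ)) * ∫ u in (0 : ℝ)..Real.pi, (h u : ℂ) *
        ∫ t in u..Real.pi, ((t - u) ^ p : ℝ) * g t := by
    have hji : ∀ j ∈ Finset.range (p + 1), IntervalIntegrable (fun u => (h u : ℂ) *
        (((Nat.factorial j : ℝ)⁻¹ * (u - Real.pi) ^ j : ℝ) : ℂ) * iteratedDeriv j G Real.pi)
        volume 0 Real.pi := fun j _ =>
      (intervalIntegrable_ofReal_mul hh (by fun_prop)).mul_const _
    simp only [← intervalIntegral.integral_mul_const]
    rw [← intervalIntegral.integral_finsetSum hji, ← intervalIntegral.integral_const_mul,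
      ← intervalIntegral.integral_add ?_ (hi.const_mul _)]
    · refine intervalIntegral.integral_congr_uIoo fun u hu => ?_
      rw [uIoo_of_le hπ.le] at hu
      rw [taylor_at_pi hG hu.2, mul_add, Finset.mul_sum]
      congr 1
      · exact Finset.sum_congr rfl fun j _ => by ring
      · ring
    · have := IntervalIntegrable.sum (Finset.range (p + 1)) hji
      exact this.congr fun u _ => by simp
  rw [hT, hswap, hM, e₁, e₂, Finset.sum_range_succ, hcp, hpi]
  push_cast
  ring

/-! ### The part of the derived series that carries `h` -/

/-- Leibniz's formula for `t ^ r n ^ (r + 1) e^{int}`: each differentiation either lowers the power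
of `t` or raises that of `n`. -/
lemma exists_iteratedDeriv_pow_mul_powExp (r j : ℕ) : ∃ d : ℕ → ℂ, (∀ b, r < b → d b = 0) ∧
    ∀ n : ℕ, iteratedDeriv j (fun t : ℝ => (t : ℂ) ^ r * powExp (r + 1) t n) = fun t : ℝ =>
      ∑ b ∈ Finset.range (r + 1), d b * ((t : ℂ) ^ b * powExp (b + j + 1) t n) := by
  induction j with
  | zero =>
    refine ⟨fun b => if b = r then 1 else 0, fun b hb => if_neg hb.ne', fun n => ?_⟩
    ext t
    simp
  | succ j ih =>
    obtain ⟨d, hd0, hd⟩ := ih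
    refine ⟨fun b => Complex.I * d b + (b + 1) * d (b + 1), fun b hb => ?_, fun n => ?_⟩
    · simp only
      rw [hd0 b hb, hd0 (b + 1) (by omega), mul_zero, mul_zero, add_zero]
    rw [iteratedDeriv_succ, hd n]
    ext t
    have h : ∀ b ∈ Finset.range (r + 1), HasDerivAt
        (fun t : ℝ => d b * ((t : ℂ) ^ b * powExp (b + j + 1) t n))
        (d b * (b * (t : ℂ) ^ (b - 1) * powExp (b + j + 1) t n +
          (t : ℂ) ^ b * (Complex.I * powExp (b + j + 1 + 1) t n))) t := by
      intro b _
      have h1 : HasDerivAt (fun t : ℝ => (t : ℂ) ^ b) (b * (t : ℂ) ^ (b - 1)) t := by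
        simpa using (Complex.ofRealCLM.hasDerivAt (x := t)).fun_pow b
      exact (h1.mul (hasDerivAt_powExp _ n t)).const_mul _
    rw [(HasDerivAt.fun_sum h).deriv]
    rw [Finset.sum_congr rfl fun b _ => mul_add (d b) _ _, Finset.sum_add_distrib, add_comm]
    simp only [add_mul (Complex.I * d _), Finset.sum_add_distrib]
    congr 1
    · refine Finset.sum_congr rfl fun b _ => ?_
      rw [show b + j + 1 + 1 = b + (j + 1) + 1 by ring]
      ring
    · rw [Finset.sum_range_succ', Finset.sum_range_succ, hd0 (r + 1) (by omega)]
      simp only [Nat.cast_zero, zero_mul, mul_zero, add_zero]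
      refine Finset.sum_congr rfl fun b _ => ?_
      rw [Nat.add_sub_cancel, show b + 1 + j + 1 = b + (j + 1) + 1 by ring]
      push_cast
      ring

lemma contDiff_pow_mul_powExp (r a n : ℕ) (N : ℕ) :
    ContDiff ℝ N fun t : ℝ => (t : ℂ) ^ r * powExp a t n := by
  have h : ContDiff ℝ N fun t : ℝ => (t : ℂ) := Complex.ofRealCLM.contDiff
  unfold powExp
  exact (h.pow r).mul (contDiff_const.mul ((contDiff_const.mul h).cexp.pow n))

namespace IsKernelDensity

variable {k : ℕ} {q m : ℝ → ℝ}

/-- The contribution of `h`: the boundary terms at `π` have exponents at most `r + p`, and the rest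
is a combination of superpositions of `fracCoeff`. -/
lemma nevIntegrable_integral_mul_pow (hm : IsKernelDensity k q m)
    (hq : ContinuousOn q (Icc 0 1)) {γ : ℝ} {p r : ℕ} (hγ0 : 0 ≤ γ) (hγ1 : γ < 1)
    (hpγ : 0 < p + γ) (hg : IntegrableOn (fun s => tail m s / s ^ (1 + γ)) (Ioc 0 1))
    (hrp : r + p ≤ k) {h : ℝ → ℝ} (hh : IntegrableOn h (Ioo 0 Real.pi))
    (hH0 : Tendsto (rlIntegral (p + γ) h) (𝓝[>] 0) (𝓝 0))
    (hH : FiniteWeightedVariation (p + γ) (rlIntegral (p + γ) h)) :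
    NevIntegrable q (fun n => ∫ u in (0 : ℝ)..Real.pi,
      (h u : ℂ) * ((u : ℂ) ^ r * powExp (r + 1) u n)) := by
  obtain ⟨ν₁, ν₂, ⟨_, _⟩, hν₁, hν₂, hβ₁, hβ₂, hν⟩ :=
    exists_measures_of_finiteWeightedVariation hH0 hH
  obtain ⟨c, e, hce⟩ := exists_integral_mul_eq hγ1 hpγ hh hν₁ hν₂ hν
  choose d _ hd using exists_iteratedDeriv_pow_mul_powExp r
  have hfrac : ∀ (ν : Measure ℝ) [IsFiniteMeasure ν], (∀ᵐ v ∂ν, v ∈ Ioo 0 Real.pi) →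
      ∀ n : ℕ, ∫ v, (∫ t in v..Real.pi, ((t - v) ^ (-γ) : ℝ) *
        iteratedDeriv p (fun t : ℝ => (t : ℂ) ^ r * powExp (r + 1) t n) t) ∂ν =
      ∑ b ∈ Finset.range (r + 1), d p b * ∫ v, fracCoeff γ p b v n ∂ν := by
    intro ν _ hν' n
    have hin : ∀ v, ∫ t in v..Real.pi, ((t - v) ^ (-γ) : ℝ) *
        iteratedDeriv p (fun t : ℝ => (t : ℂ) ^ r * powExp (r + 1) t n) t =
        ∑ b ∈ Finset.range (r + 1), d p b * fracCoeff γ p b v n := by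
      intro v
      have hi : ∀ b ∈ Finset.range (r + 1), IntervalIntegrable (fun t : ℝ =>
          d p b * ((((t - v) ^ (-γ) : ℝ) : ℂ) * ((t : ℂ) ^ b * powExp (b + p + 1) t n)))
          volume v Real.pi := by
        intro b _
        have h1 := intervalIntegrable_sub_rpow hγ1 v v Real.pi
        have hc := continuous_powExp (b + p + 1) n
        exact (IntervalIntegrable.mul_continuousOn ⟨h1.1.ofReal, h1.2.ofReal⟩
          (by fun_prop : Continuous fun t : ℝ =>
            (t : ℂ) ^ b * powExp (b + p + 1) t n).continuousOn).const_mul _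
      simp only [fracCoeff, ← intervalIntegral.integral_const_mul]
      rw [← intervalIntegral.integral_finsetSum hi, hd p n]
      refine intervalIntegral.integral_congr fun t _ => ?_
      simp only [Finset.mul_sum]
      exact Finset.sum_congr rfl fun b _ => by ring
    simp only [hin]
    rw [integral_finsetSum _ fun b _ => (integrable_fracCoeff hγ1 p b n hν').const_mul _]
    simp only [integral_const_mul]
  have key : (fun n : ℕ => ∫ u in (0 : ℝ)..Real.pi,
      (h u : ℂ) * ((u : ℂ) ^ r * powExp (r + 1) u n)) = fun n =>
      (∑ j ∈ Finset.range p, ∑ b ∈ Finset.range (r + 1),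
        (c j * d j b * (Real.pi : ℂ) ^ b) * powExp (b + j + 1) Real.pi n) +
      ((∑ b ∈ Finset.range (r + 1), (e * d p b) * ∫ v, fracCoeff γ p b v n ∂ν₁) +
        ∑ b ∈ Finset.range (r + 1), (-e * d p b) * ∫ v, fracCoeff γ p b v n ∂ν₂) := by
    ext n
    rw [hce _ (contDiff_pow_mul_powExp r (r + 1) n (p + 1)), hfrac ν₁ hν₁ n, hfrac ν₂ hν₂ n]
    congr 1
    · refine Finset.sum_congr rfl fun j _ => ?_
      rw [hd j n, Finset.mul_sum]
      exact Finset.sum_congr rfl fun b _ => by ring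
    · simp only [mul_assoc, ← Finset.mul_sum]
      ring
  rw [key]
  refine NevIntegrable.add (NevIntegrable.sum _ fun j hj => NevIntegrable.sum _ fun b hb =>
    NevIntegrable.const_mul (hm.nevIntegrable_powExp_pi hq hγ0 hpγ hg ?_) _) (NevIntegrable.add
    (NevIntegrable.sum _ fun b hb => NevIntegrable.const_mul
      (hm.nevIntegrable_integral_fracCoeff hq hγ0 hγ1 hpγ hg ?_ hν₁ hβ₁) _)
    (NevIntegrable.sum _ fun b hb => NevIntegrable.const_mul
      (hm.nevIntegrable_integral_fracCoeff hq hγ0 hγ1 hpγ hg ?_ hν₂ hβ₂) _))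
  · have := Finset.mem_range.1 hj
    have := Finset.mem_range.1 hb
    omega
  · have := Finset.mem_range.1 hb
    omega
  · have := Finset.mem_range.1 hb
    omega

end IsKernelDensity

/-! ### The part of the derived series that carries the polynomial -/

lemma I_mul_integral_pow_mul_powExp (j n : ℕ) :
    Complex.I * ∫ u in (0 : ℝ)..Real.pi, (u : ℂ) ^ (j + 1) * powExp (j + 2) u n =
      (Real.pi : ℂ) ^ (j + 1) * powExp (j + 1) Real.pi n -
        (j + 1) * ∫ u in (0 : ℝ)..Real.pi, (u : ℂ) ^ j * powExp (j + 1) u n := by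
  have h : ∀ t ∈ uIcc 0 Real.pi, HasDerivAt (fun t : ℝ => (t : ℂ) ^ (j + 1) * powExp (j + 1) t n)
      ((j + 1) * ((t : ℂ) ^ j * powExp (j + 1) t n) +
        Complex.I * ((t : ℂ) ^ (j + 1) * powExp (j + 2) t n)) t := by
    intro t _
    have h1 : HasDerivAt (fun t : ℝ => (t : ℂ) ^ (j + 1)) ((j + 1) * (t : ℂ) ^ j) t := by
      simpa using (Complex.ofRealCLM.hasDerivAt (x := t)).fun_pow (j + 1)
    refine (h1.mul (hasDerivAt_powExp (j + 1) n t)).congr_deriv ?_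
    ring
  have hc := continuous_powExp (j + 1) n
  have hc' := continuous_powExp (j + 2) n
  have hi : IntervalIntegrable (fun t : ℝ => ((j + 1 : ℂ)) * ((t : ℂ) ^ j * powExp (j + 1) t n))
      volume 0 Real.pi := Continuous.intervalIntegrable (by fun_prop) _ _
  have hi' : IntervalIntegrable (fun t : ℝ => Complex.I * ((t : ℂ) ^ (j + 1) *
      powExp (j + 2) t n)) volume 0 Real.pi := Continuous.intervalIntegrable (by fun_prop) _ _
  have := intervalIntegral.integral_eq_sub_of_hasDerivAt h (hi.add hi')
  rw [intervalIntegral.integral_add hi hi', intervalIntegral.integral_const_mul,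
    intervalIntegral.integral_const_mul] at this
  simp only [Complex.ofReal_zero, zero_pow (Nat.succ_ne_zero j), zero_mul, sub_zero] at this
  rw [← this]
  ring

/-- Up to boundary terms at `π`, the integral over `(0, π)` of `u ^ j n ^ (j + 1) e^{inu}` is
a real multiple of `(-i) ^ (j + 1)`, independent of `n`. -/
lemma exists_integral_pow_mul_powExp_eq (j : ℕ) : ∃ (c : ℕ → ℂ) (d : ℝ), ∀ n : ℕ,
    ∫ u in (0 : ℝ)..Real.pi, (u : ℂ) ^ j * powExp (j + 1) u n =
      (∑ l ∈ Finset.range (j + 1), c l * powExp l Real.pi n) + d * (-Complex.I) ^ (j + 1) := by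
  induction j with
  | zero =>
    refine ⟨fun _ => -Complex.I, -1, fun n => ?_⟩
    have hc := continuous_powExp 1 n
    have h := intervalIntegral.integral_eq_sub_of_hasDerivAt
      (fun t (_ : t ∈ uIcc 0 Real.pi) => hasDerivAt_powExp 0 n t)
      (Continuous.intervalIntegrable (by fun_prop) _ _)
    rw [intervalIntegral.integral_const_mul] at h
    have h0 : powExp 0 0 n = 1 := by simp [powExp]
    rw [h0, zero_add] at h
    simp only [pow_zero, one_mul, zero_add, Finset.range_one, Finset.sum_singleton, pow_one]
    push_cast
    linear_combination (-Complex.I) * h + (∫ t in (0 : ℝ)..Real.pi, powExp 1 t n) *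
      Complex.I_mul_I
  | succ j ih =>
    obtain ⟨c, d, h⟩ := ih
    refine ⟨fun l => if l = j + 1 then -Complex.I * (Real.pi : ℂ) ^ (j + 1)
      else Complex.I * (j + 1) * c l, -((j + 1) * d), fun n => ?_⟩
    have h1 := I_mul_integral_pow_mul_powExp j n
    rw [h n] at h1
    have h2 : ∑ l ∈ Finset.range (j + 1), (if l = j + 1 then -Complex.I * (Real.pi : ℂ) ^ (j + 1)
        else Complex.I * (j + 1) * c l) * powExp l Real.pi n =
        Complex.I * (j + 1) * ∑ l ∈ Finset.range (j + 1), c l * powExp l Real.pi n := by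
      rw [Finset.mul_sum]
      refine Finset.sum_congr rfl fun l hl => ?_
      rw [if_neg (Finset.mem_range.1 hl).ne]
      ring
    rw [Finset.sum_range_succ, h2]
    simp only [if_true]
    push_cast
    rw [show j + 1 + 1 = j + 2 by ring]
    linear_combination (-Complex.I) * h1 + ((∫ u in (0 : ℝ)..Real.pi,
      (u : ℂ) ^ (j + 1) * powExp (j + 2) u n)) * Complex.I_mul_I

lemma pow_mul_powExp (a b n : ℕ) (u : ℝ) : (n : ℂ) ^ a * powExp b u n = powExp (b + a) u n := by
  rw [powExp, powExp, pow_add]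
  ring

/-- In the derived conjugate series a monomial of the polynomial either cancels, by parity, or
contributes boundary terms at `π` only, the remaining constant being real. -/
lemma IsKernelDensity.exists_nevIntegrable_pow {k : ℕ} {q m : ℝ → ℝ} (hm : IsKernelDensity k q m)
    (hq : ContinuousOn q (Icc 0 1)) {γ : ℝ} {p r : ℕ} (hγ0 : 0 ≤ γ)
    (hpγ : 0 < p + γ) (hg : IntegrableOn (fun s => tail m s / s ^ (1 + γ)) (Ioc 0 1))
    (hrk : r ≤ k) {j : ℕ} (hj : j < r) :
    ∃ c : ℕ → ℂ, NevIntegrable q c ∧ ∀ n : ℕ,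
      (((1 - (-1) ^ (r + j) : ℝ) : ℂ) * ((-Complex.I) ^ r *
        ∫ u in (0 : ℝ)..Real.pi, (u : ℂ) ^ j * powExp (r + 1) u n)).im = (c n).im := by
  rcases Nat.even_or_odd (r + j) with hrj | hrj
  · refine ⟨fun _ => 0, NevIntegrable.zero, fun n => ?_⟩
    simp [hrj.neg_one_pow]
  · obtain ⟨c, d, h⟩ := exists_integral_pow_mul_powExp_eq j
    refine ⟨fun n => ∑ l ∈ Finset.range (j + 1), (2 * (-Complex.I) ^ r * c l) *
      powExp (l + (r - j)) Real.pi n, NevIntegrable.sum _ fun l hl =>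
      (hm.nevIntegrable_powExp_pi hq hγ0 hpγ hg ?_).const_mul _, fun n => ?_⟩
    · have := Finset.mem_range.1 hl
      omega
    have h1 : ∫ u in (0 : ℝ)..Real.pi, (u : ℂ) ^ j * powExp (r + 1) u n =
        (n : ℂ) ^ (r - j) * ∫ u in (0 : ℝ)..Real.pi, (u : ℂ) ^ j * powExp (j + 1) u n := by
      rw [← intervalIntegral.integral_const_mul]
      refine intervalIntegral.integral_congr fun u _ => ?_
      rw [mul_left_comm, pow_mul_powExp, show j + 1 + (r - j) = r + 1 by omega]
    have h2 : ((1 - (-1) ^ (r + j) : ℝ) : ℂ) * ((-Complex.I) ^ r *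
        ∫ u in (0 : ℝ)..Real.pi, (u : ℂ) ^ j * powExp (r + 1) u n) =
        (∑ l ∈ Finset.range (j + 1), (2 * (-Complex.I) ^ r * c l) *
          powExp (l + (r - j)) Real.pi n) +
        ((2 * (n : ℝ) ^ (r - j) * d : ℝ) : ℂ) * ((-Complex.I) ^ r * (-Complex.I) ^ (j + 1)) := by
      rw [h1, h n, hrj.neg_one_pow]
      simp only [← pow_mul_powExp (r - j)]
      have : ∑ l ∈ Finset.range (j + 1), (2 * (-Complex.I) ^ r * c l) *
          ((n : ℂ) ^ (r - j) * powExp l Real.pi n) = 2 * (-Complex.I) ^ r * (n : ℂ) ^ (r - j) *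
          ∑ l ∈ Finset.range (j + 1), c l * powExp l Real.pi n := by
        rw [Finset.mul_sum]
        exact Finset.sum_congr rfl fun l _ => by ring
      rw [this]
      push_cast
      ring
    obtain ⟨s, hs⟩ : Even (r + (j + 1)) := by
      rw [← add_assoc]
      exact hrj.add_one
    have h3 : (-Complex.I) ^ r * (-Complex.I) ^ (j + 1) = (((-1) ^ s : ℝ) : ℂ) := by
      rw [← pow_add, hs, ← two_mul, pow_mul]
      simp
    rw [h2, h3, ← Complex.ofReal_mul, Complex.add_im, Complex.ofReal_im, add_zero]

/-! ### The derived conjugate series as a Fourier integral over `(0, π)` -/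

lemma powExp_eq_cos_add_sin (a n : ℕ) (t : ℝ) : powExp a t n =
    (n : ℂ) ^ a * ((Real.cos (n * t) : ℂ) + (Real.sin (n * t) : ℂ) * Complex.I) := by
  rw [powExp, ← Complex.exp_nat_mul, Complex.ofReal_cos, Complex.ofReal_sin, ← Complex.exp_mul_I]
  push_cast
  ring_nf

lemma powExp_mul_powExp_zero (a n : ℕ) (s t : ℝ) :
    powExp 0 s n * powExp a t n = powExp a (s + t) n := by
  simp only [powExp]
  push_cast
  rw [mul_add, Complex.exp_add, mul_pow]
  ring

lemma periodic_powExp (a n : ℕ) : Function.Periodic (fun t => powExp a t n) (2 * Real.pi) := by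
  intro t
  simp only [powExp]
  push_cast
  rw [mul_add, Complex.exp_add, mul_comm Complex.I (2 * (Real.pi : ℂ)), Complex.exp_two_pi_mul_I,
    mul_one]

lemma conj_powExp (a n : ℕ) (t : ℝ) : (starRingEnd ℂ) (powExp a t n) = powExp a (-t) n := by
  rw [powExp_eq_cos_add_sin, powExp_eq_cos_add_sin, mul_neg, Real.cos_neg, Real.sin_neg]
  simp only [map_mul, map_add, map_pow, Complex.conj_natCast, Complex.conj_ofReal, Complex.conj_I]
  push_cast
  ring

lemma fourierA_add_fourierB {f : ℝ → ℝ} (hf : IntervalIntegrable f volume (-Real.pi) Real.pi)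
    (n : ℕ) : (fourierA f n : ℂ) + (fourierB f n : ℂ) * Complex.I =
      ((1 / Real.pi : ℝ) : ℂ) * ∫ t in (-Real.pi)..Real.pi, (f t : ℂ) * powExp 0 t n := by
  have hc : IntervalIntegrable (fun t => f t * Real.cos (n * t)) volume (-Real.pi) Real.pi :=
    hf.mul_continuousOn (by fun_prop : Continuous fun t : ℝ => Real.cos (n * t)).continuousOn
  have hs : IntervalIntegrable (fun t => f t * Real.sin (n * t)) volume (-Real.pi) Real.pi :=
    hf.mul_continuousOn (by fun_prop : Continuous fun t : ℝ => Real.sin (n * t)).continuousOn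
  have e : ∀ t : ℝ, (f t : ℂ) * powExp 0 t n = ((f t * Real.cos (n * t) : ℝ) : ℂ) +
      ((f t * Real.sin (n * t) : ℝ) : ℂ) * Complex.I := by
    intro t
    rw [powExp_eq_cos_add_sin]
    push_cast
    ring
  have hc' : IntervalIntegrable (fun t => ((f t * Real.cos (n * t) : ℝ) : ℂ)) volume
    (-Real.pi) Real.pi := ⟨hc.1.ofReal, hc.2.ofReal⟩
  have hs' : IntervalIntegrable (fun t => ((f t * Real.sin (n * t) : ℝ) : ℂ)) volume
    (-Real.pi) Real.pi := ⟨hs.1.ofReal, hs.2.ofReal⟩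
  simp only [e]
  rw [intervalIntegral.integral_add hc' (hs'.mul_const _), intervalIntegral.integral_mul_const,
    intervalIntegral.integral_ofReal, intervalIntegral.integral_ofReal, fourierA, fourierB]
  push_cast
  ring

lemma iteratedDeriv_conjTerm {f : ℝ → ℝ} (hf : IntervalIntegrable f volume (-Real.pi) Real.pi)
    (n r : ℕ) : iteratedDeriv r (conjTerm f n) = fun y =>
      ((((1 / Real.pi : ℝ) : ℂ) * ∫ t in (-Real.pi)..Real.pi, (f t : ℂ) * powExp 0 t n) *
        ((-Complex.I) ^ r * powExp r (-y) n)).im := by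
  rw [← fourierA_add_fourierB hf]
  induction r with
  | zero =>
    ext y
    rw [iteratedDeriv_zero, conjTerm, powExp_eq_cos_add_sin, mul_neg, Real.cos_neg, Real.sin_neg]
    simp [-Complex.ofReal_cos, -Complex.ofReal_sin]
    ring
  | succ r ih =>
    ext y
    rw [iteratedDeriv_succ, ih]
    have h : HasDerivAt (fun y => powExp r (-y) n) (-(Complex.I * powExp (r + 1) (-y) n)) y := by
      have := (hasDerivAt_powExp r n (-y)).scomp y (hasDerivAt_neg y)
      simpa [Function.comp_def] using this
    have h' := Complex.imCLM.hasFDerivAt.comp_hasDerivAt y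
      ((h.const_mul ((-Complex.I) ^ r)).const_mul
      ((fourierA f n : ℂ) + (fourierB f n : ℂ) * Complex.I))
    refine Eq.trans h'.deriv ?_
    rw [Complex.imCLM_apply]
    congr 2
    ring

lemma intervalIntegrable_of_periodic {f : ℝ → ℝ} (hper : Function.Periodic f (2 * Real.pi))
    (hf : IntervalIntegrable f volume (-Real.pi) Real.pi) (a b : ℝ) :
    IntervalIntegrable f volume a b := by
  refine hper.intervalIntegrable (t := -Real.pi) (by positivity) ?_ a b
  rwa [show -Real.pi + 2 * Real.pi = Real.pi by ring]

lemma integral_mul_powExp_shift {f : ℝ → ℝ} (hper : Function.Periodic f (2 * Real.pi)) (x : ℝ)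
    (a n : ℕ) : (∫ t in (-Real.pi)..Real.pi, (f t : ℂ) * powExp 0 t n) * powExp a (-x) n =
      ∫ u in (-Real.pi)..Real.pi, (f (x + u) : ℂ) * powExp a u n := by
  have hp : Function.Periodic (fun t => (f t : ℂ) * powExp a (t - x) n) (2 * Real.pi) := by
    intro t
    have := periodic_powExp a n (t - x)
    simp only at this
    simp only [hper t, add_sub_right_comm, this]
  have e : ∀ u, (f (x + u) : ℂ) * powExp a u n =
      (fun t => (f t : ℂ) * powExp a (t - x) n) (x + u) := by
    intro u
    simp
  have h := hp.intervalIntegral_add_eq (-Real.pi) (x + -Real.pi)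
  rw [show -Real.pi + 2 * Real.pi = Real.pi by ring,
    show x + -Real.pi + 2 * Real.pi = x + Real.pi by ring] at h
  simp only [e]
  rw [intervalIntegral.integral_comp_add_left (fun t => (f t : ℂ) * powExp a (t - x) n), ← h,
    ← intervalIntegral.integral_mul_const]
  refine intervalIntegral.integral_congr fun t _ => ?_
  rw [mul_assoc, powExp_mul_powExp_zero, ← sub_eq_add_neg]

/-- Folding the Fourier integral at `x` onto `(0, π)` produces the difference
`f (x + u) - (-1) ^ r f (x - u)`. -/
lemma natCast_mul_derivedConjTerm {f : ℝ → ℝ} (hper : Function.Periodic f (2 * Real.pi))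
    (hf : IntervalIntegrable f volume (-Real.pi) Real.pi) (x : ℝ) (r n : ℕ) :
    (n : ℝ) * derivedConjTerm f r x n = 1 / Real.pi * ((-Complex.I) ^ r *
      ∫ u in (0 : ℝ)..Real.pi, ((f (x + u) - (-1) ^ r * f (x - u) : ℝ) : ℂ) *
        powExp (r + 1) u n).im := by
  have hloc := intervalIntegrable_of_periodic hper hf
  have hplus : ∀ a b, IntervalIntegrable (fun u => f (x + u)) volume a b := fun a b => by
    simpa using (hloc (x + a) (x + b)).comp_add_left x
  have hminus : ∀ a b, IntervalIntegrable (fun u => f (x - u)) volume a b := fun a b => by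
    simpa using (hloc (x - a) (x - b)).comp_sub_left x
  have hpe := continuous_powExp (r + 1) n
  have ip : ∀ a b, IntervalIntegrable (fun u => (f (x + u) : ℂ) * powExp (r + 1) u n) volume a b :=
    fun a b => IntervalIntegrable.mul_continuousOn ⟨(hplus a b).1.ofReal, (hplus a b).2.ofReal⟩
      hpe.continuousOn
  have im : IntervalIntegrable (fun u => (f (x - u) : ℂ) * powExp (r + 1) u n) volume 0 Real.pi :=
    IntervalIntegrable.mul_continuousOn ⟨(hminus _ _).1.ofReal, (hminus _ _).2.ofReal⟩
      hpe.continuousOn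
  have h1 : (n : ℝ) * derivedConjTerm f r x n = 1 / Real.pi * ((-Complex.I) ^ r *
      ∫ u in (-Real.pi)..Real.pi, (f (x + u) : ℂ) * powExp (r + 1) u n).im := by
    rw [derivedConjTerm, iteratedDeriv_conjTerm hf, ← integral_mul_powExp_shift hper,
      ← Complex.im_ofReal_mul, ← Complex.im_ofReal_mul, ← pow_mul_powExp 1 r]
    congr 1
    push_cast
    ring
  have h2 : ∫ u in (-Real.pi)..(0 : ℝ), (f (x + u) : ℂ) * powExp (r + 1) u n =
      (starRingEnd ℂ) (∫ u in (0 : ℝ)..Real.pi, (f (x - u) : ℂ) * powExp (r + 1) u n) := by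
    rw [← intervalIntegral.intervalIntegral_conj]
    simp only [map_mul, Complex.conj_ofReal, conj_powExp]
    have := intervalIntegral.integral_comp_neg (a := 0) (b := Real.pi)
      (fun u => (f (x + u) : ℂ) * powExp (r + 1) u n)
    rw [neg_zero] at this
    rw [← this]
    simp only [sub_eq_add_neg]
  have h3 : ∀ z : ℂ, ((-Complex.I) ^ r * (starRingEnd ℂ) z).im =
      -((((-1) ^ r : ℝ) : ℂ) * ((-Complex.I) ^ r * z)).im := by
    intro z
    have : (-Complex.I) ^ r * (starRingEnd ℂ) z =
        (starRingEnd ℂ) ((((-1) ^ r : ℝ) : ℂ) * ((-Complex.I) ^ r * z)) := by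
      simp only [map_mul, map_pow, map_neg, Complex.conj_I, Complex.conj_ofReal, neg_neg]
      push_cast
      rw [← mul_assoc, ← mul_pow, neg_one_mul]
    rw [this, Complex.conj_im]
  have h4 : ∫ u in (0 : ℝ)..Real.pi, ((f (x + u) - (-1) ^ r * f (x - u) : ℝ) : ℂ) *
      powExp (r + 1) u n = (∫ u in (0 : ℝ)..Real.pi, (f (x + u) : ℂ) * powExp (r + 1) u n) -
      (((-1) ^ r : ℝ) : ℂ) * ∫ u in (0 : ℝ)..Real.pi, (f (x - u) : ℂ) * powExp (r + 1) u n := by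
    rw [← intervalIntegral.integral_const_mul, ← intervalIntegral.integral_sub (ip 0 Real.pi)
      (im.const_mul _)]
    refine intervalIntegral.integral_congr fun u _ => ?_
    push_cast
    ring
  rw [h1, h4, ← intervalIntegral.integral_add_adjacent_intervals (ip (-Real.pi) 0) (ip 0 Real.pi),
    h2, mul_add, Complex.add_im, h3, mul_sub, Complex.sub_im, mul_left_comm]
  ring

lemma sub_eq_hFun_add_polynomial (f : ℝ → ℝ) (x : ℝ) {r : ℕ} (θ : Fin r → ℝ) {u : ℝ} (hu : 0 < u) :
    f (x + u) - (-1) ^ r * f (x - u) = 2 * (hFun f x θ u * u ^ r) +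
      ∑ j : Fin r, θ j / (Nat.factorial j : ℝ) * ((1 - (-1) ^ (r + (j : ℕ))) * u ^ (j : ℕ)) := by
  have h1 : ∑ j : Fin r, θ j / (Nat.factorial j : ℝ) * ((1 - (-1) ^ (r + (j : ℕ))) * u ^ (j : ℕ)) =
      polyP θ u - (-1) ^ r * polyP θ (-u) := by
    rw [polyP, polyP, Finset.mul_sum, ← Finset.sum_sub_distrib]
    refine Finset.sum_congr rfl fun j _ => ?_
    rw [neg_pow u, pow_add]
    ring
  have h2 : u ^ r ≠ 0 := (pow_pos hu r).ne'
  rw [h1, hFun]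
  field_simp
  ring

lemma absNevanlinnaSummable_of_im {q : ℝ → ℝ} {u : ℕ → ℝ} {c : ℕ → ℂ} (hc : NevIntegrable q c)
    (hu : ∀ n : ℕ, (n : ℝ) * u n = (c n).im) : AbsNevanlinnaSummable q u := by
  refine ⟨1, one_pos, ?_⟩
  have h : IntegrableOn (fun w : ℝ => |(nevSum q c w / (w : ℂ) ^ 2).im|) (Ioi 1) :=
    (Integrable.im hc).abs
  refine h.congr_fun (fun w _ => ?_) measurableSet_Ioi
  have h1 : (nevSum q c w / (w : ℂ) ^ 2).im =
      (∑ n ∈ Finset.range (⌊w⌋₊ + 1), (n : ℝ) * u n * q (n / w)) / w ^ 2 := by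
    rw [← Complex.ofReal_pow, Complex.div_ofReal_im, nevSum, Complex.im_sum]
    congr 1
    refine Finset.sum_congr rfl fun n _ => ?_
    rw [Complex.im_mul_ofReal, hu n]
  simp only [h1, abs_div, abs_of_nonneg (sq_nonneg w)]

end NevanlinnaSum

theorem theorem1 (f : ℝ → ℝ) (hper : Function.Periodic f (2 * Real.pi))
    (hf : MeasureTheory.IntegrableOn f (Set.Ioc (-Real.pi) Real.pi))
    (x : ℝ) (r : ℕ) (hr : 1 ≤ r) (α β : ℝ) (hβ : β = α - r) (hβpos : 0 < β)
    (θ : Fin r → ℝ)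
    (hh : MeasureTheory.IntegrableOn (NevanlinnaSum.hFun f x θ) (Set.Ioo 0 Real.pi))
    (hH0 : Filter.Tendsto (NevanlinnaSum.rlIntegral β (NevanlinnaSum.hFun f x θ))
      (nhdsWithin 0 (Set.Ioi 0)) (nhds 0))
    (hHvar : NevanlinnaSum.FiniteWeightedVariation β
      (NevanlinnaSum.rlIntegral β (NevanlinnaSum.hFun f x θ)))
    (q : ℝ → ℝ) (hq : NevanlinnaSum.IsNevanlinnaKernel α q) :
    NevanlinnaSum.AbsNevanlinnaSummable q (NevanlinnaSum.derivedConjTerm f r x) := by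
  open NevanlinnaSum in
  have hπ := Real.pi_pos
  have hα0 : 0 ≤ α := by
    have : (0 : ℝ) ≤ r := Nat.cast_nonneg r
    linarith
  set k := ⌊α⌋₊ with hk
  have hrk : r ≤ k := Nat.le_floor (by linarith)
  obtain ⟨p, hp⟩ := Nat.exists_eq_add_of_le hrk
  set γ := α - k with hγ
  have hγ0 : 0 ≤ γ := sub_nonneg.2 (Nat.floor_le hα0)
  have hγ1 : γ < 1 := by
    have := Nat.lt_floor_add_one α
    linarith
  have hβ' : β = p + γ := by
    rw [hβ, hγ, hp]
    push_cast
    ring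
  rw [hβ'] at hH0 hHvar hβpos
  have hm := hq.isKernelDensity (hr.trans hrk)
  have hqc : ContinuousOn q (Icc 0 1) := by
    have h := (hq.absolutelyContinuous 0 (by omega)).continuousOn
    simpa [kerDeriv, uIcc_of_le zero_le_one] using h
  have hg : IntegrableOn (fun s => tail (fun t => (-1) ^ k * kerDeriv q k t) s / s ^ (1 + γ))
      (Ioc 0 1) := by
    -- only the convergence of the integral over the whole of `(0, 1]` matters
    obtain ⟨C, hC⟩ := hq.growth
    have h := (intervalIntegrable_iff_integrableOn_Ioc_of_le zero_le_one).1
      (hC 1 ⟨one_pos, le_rfl⟩).1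
    rwa [show 1 + α - (⌊α⌋₊ : ℝ) = 1 + γ by rw [hγ, hk]; ring] at h
  have hmain := hm.nevIntegrable_integral_mul_pow hqc hγ0 hγ1 hβpos hg hp.ge hh hH0 hHvar
  choose c hc hcim using fun j : Fin r =>
    hm.exists_nevIntegrable_pow hqc hγ0 hβpos hg hrk j.isLt
  have hfi : IntervalIntegrable f volume (-Real.pi) Real.pi :=
    (intervalIntegrable_iff_integrableOn_Ioc_of_le (by linarith)).2 hf
  refine absNevanlinnaSummable_of_im (((hmain.const_mul (2 * (-Complex.I) ^ r)).add
    (NevIntegrable.sum Finset.univ fun j _ => (hc j).const_mul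
      ((θ j / (Nat.factorial j : ℝ) : ℝ) : ℂ))).const_mul ((1 / Real.pi : ℝ) : ℂ)) fun n => ?_
  have hpe := continuous_powExp (r + 1) n
  rw [natCast_mul_derivedConjTerm hper hfi, Complex.im_ofReal_mul]
  have hj : ∀ j ∈ (Finset.univ : Finset (Fin r)), IntervalIntegrable (fun u : ℝ =>
      ((θ j / (Nat.factorial j : ℝ) : ℝ) : ℂ) * (((1 - (-1) ^ (r + (j : ℕ)) : ℝ) : ℂ) *
        ((u : ℂ) ^ (j : ℕ) * powExp (r + 1) u n))) volume 0 Real.pi := fun j _ =>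
    Continuous.intervalIntegrable (by fun_prop) _ _
  have hi := (intervalIntegrable_ofReal_mul hh (G := fun u : ℝ => (u : ℂ) ^ r *
    powExp (r + 1) u n) (by fun_prop)).const_mul 2
  have hsum := IntervalIntegrable.sum Finset.univ hj
  have key : ∫ u in (0 : ℝ)..Real.pi, ((f (x + u) - (-1) ^ r * f (x - u) : ℝ) : ℂ) *
      powExp (r + 1) u n =
      2 * (∫ u in (0 : ℝ)..Real.pi, (hFun f x θ u : ℂ) * ((u : ℂ) ^ r * powExp (r + 1) u n)) +
      ∑ j : Fin r, ((θ j / (Nat.factorial j : ℝ) : ℝ) : ℂ) *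
        (((1 - (-1) ^ (r + (j : ℕ)) : ℝ) : ℂ) *
          ∫ u in (0 : ℝ)..Real.pi, (u : ℂ) ^ (j : ℕ) * powExp (r + 1) u n) := by
    simp only [← intervalIntegral.integral_const_mul]
    rw [← intervalIntegral.integral_finsetSum hj, ← intervalIntegral.integral_add hi
      (hsum.congr fun u _ => by simp)]
    refine intervalIntegral.integral_congr_uIoo fun u hu => ?_
    rw [uIoo_of_le hπ.le] at hu
    rw [sub_eq_hFun_add_polynomial f x θ hu.1]
    push_cast
    rw [add_mul, Finset.sum_mul]
    congr 1
    · ring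
    · exact Finset.sum_congr rfl fun j _ => by ring
  rw [key, mul_add, Complex.add_im, Complex.add_im, Finset.mul_sum, Complex.im_sum, Complex.im_sum]
  congr 2
  · congr 1
    ring
  · refine Finset.sum_congr rfl fun j _ => ?_
    rw [Complex.im_ofReal_mul, ← hcim j n, ← Complex.im_ofReal_mul]
    congr 1
    ring
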